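/- Let $m\ge 0$ be an integer. All fields depend on $x\in\mathbb R^2$ and take values in $\mathbb R^{2+m}$ ($m=0$: planar fields; $m=1$: three-component fields of two space variables), with $u\cdot\nabla=u^1\partial_1+u^2\partial_2$, $\operatorname{div}u=\partial_1u^1+\partial_2u^2$ and $\nabla\pi=(\partial_1\pi,\partial_2\pi,0,\dots,0)$. Let $0<T<\infty$, let $u_0\in L^2(\mathbb R^2)$ with $\operatorname{div}u_0=0$, and consider $$\partial_t v+(u\cdot\nabla)u-\Delta v+\nabla\pi=0,\qquad \operatorname{div}v=0,\qquad v|_{t=0}=u_0 \qquad\text{on }(0,T)\times\mathbb R^2. \tag{1}$$ A solution of (1) is a $v\in L^\infty(0,T;L^2(\mathbb R^2))$ with $\operatorname{div}v(t)=0$ for a.e. $t$ such that, for all $\vartheta\in C_c^\infty([0,T))$ and all Schwartz fields $\omega$ with $\operatorname{div}\omega=0$, $$\vartheta(0)\langle u_0,\omega\rangle+\int_0^T\Big(\vartheta'\langle v,\omega\rangle+\vartheta\langle v,\Delta\omega\rangle+\vartheta\langle u,(u\cdot\nabla)\omega\rangle\Big)dt=0 .$$ (i) There is a function $C$ of two real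 variables such that, for all $T$ and $M$, all $u_0$ as above, every $u\in L^\infty(0,T;L^2)\cap L^2(0,T;\dot H^1)$ with $\operatorname{div}u=0$ and $$\|u(t)\|_{L^2}^2+\int_0^t\|\nabla u(\tau)\|_{L^2}^2\,d\tau\le M^2\quad\text{for a.e. }t\in(0,T),$$ and every solution $v$ of (1), $$\int_0^T\|\hat v(\tau)\|_{L^1(\mathbb R^2)}^2\,d\tau\le C(\|u_0\|_{L^2},M),\qquad \int_0^T\|v(\tau)\|_{L^\infty(\mathbb R^2)}^2\,d\tau\le C(\|u_0\|_{L^2},M).$$ In particular, if $u$ obeys the energy estimate with $M=\|u_0\|_{L^2}$, the bounds depend on $\|u_0\|_{L^2}$ only. (ii) There is a function $C$ of one real variable such that, for all $T$ and all $u_0$ as above, every weak solution $v\in L^\infty(0,T;L^2)\cap L^2(0,T;\dot H^1)$ of the Navier–Stokes equations, that is, of (1) with $u=v$, satisfies $$\int_0^T\|\hat v(\tau)\|_{L^1(\mathbb R^2)}^2\,d\tau\le C(\|u_0\|_{L^2}),\qquad \int_0^T\|v(\tau)\|_{L^\infty(\mathbb R^2)}^2\,d\tau\le C(\|u_0\|_{L^2}).$$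 Neither function $C$ depends on $T$; so for a solution on $(0,\infty)$ that has these properties on every $(0,T)$, with the same $M$ in (i), the bounds hold on $(0,\infty)$ as well. -/

import Mathlib

open MeasureTheory Set SchwartzMap
open scoped ENNReal ContDiff RealInnerProductSpace FourierTransform LineDeriv Laplacian

noncomputable section

namespace PlanarFlow

/-- The plane `ℝ²`. -/
abbrev Plane : Type := EuclideanSpace ℝ (Fin 2)

/-- Values of a velocity field depending on two space variables: two horizontal components
(the first two coordinates) followed by `m` further ones. The choice `m = 0` gives planar fields
`(u¹, u²)(x₁, x₂)`, and `m = 1` gives fields `(u¹, u², u³)(x₁, x₂)`. -/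
abbrev Vel (m : ℕ) : Type := EuclideanSpace ℝ (Fin (2 + m))

/-- The complexification `ℂ ^ (2 + m)` of the space of velocities. -/
abbrev VelC (m : ℕ) : Type := EuclideanSpace ℂ (Fin (2 + m))

/-- The space `L²(ℝ²; ℝ ^ (2 + m))` of square integrable velocity fields. -/
abbrev L2Vel (m : ℕ) : Type := Lp (α := Plane) (Vel m) 2 volume

/-- The standard basis vectors of the plane. -/
def e (j : Fin 2) : Plane := EuclideanSpace.single j 1

/-- The `j`-th horizontal component of a velocity. -/
def hor {m : ℕ} (a : Vel m) (j : Fin 2) : ℝ := a (Fin.castAdd m j)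

/-- The inclusion `ℝ ^ (2 + m) → ℂ ^ (2 + m)`. -/
def toComplex (m : ℕ) : Vel m →L[ℝ] VelC m :=
  LinearMap.toContinuousLinearMap
    { toFun := fun a => WithLp.toLp 2 fun i => (a i : ℂ)
      map_add' := fun a b => by ext i; simp
      map_smul' := fun c a => by ext i; simp }

/-- The Fourier transform of a real square integrable velocity field, again an `L²` field
(normalised with the character `exp (- 2 π i x · ξ)`). -/
def fourierL2 {m : ℕ} (f : L2Vel m) : Lp (α := Plane) (VelC m) 2 volume :=
  𝓕 ((toComplex m).compLp f)

/-- `div f = 0` in the sense of distributions. Only the horizontal components enter, since nothing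
depends on the further space variables. -/
def IsDivFree {m : ℕ} (f : L2Vel m) : Prop :=
  ∀ φ : 𝓢(Plane, ℝ), ∫ x, ∑ j, hor (f x) j * (∂_{e j} φ) x = 0

/-- `g j` is the `j`-th partial derivative of `f` in the sense of distributions. -/
def IsWeakGradient {m : ℕ} (f : L2Vel m) (g : Fin 2 → L2Vel m) : Prop :=
  ∀ (j : Fin 2) (φ : 𝓢(Plane, ℝ)), ∫ x, (∂_{e j} φ) x • f x = - ∫ x, φ x • g j x

/-- Divergence-free Schwartz vector fields. -/
def IsDivFreeTest {m : ℕ} (w : 𝓢(Plane, Vel m)) : Prop :=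
  ∀ x, ∑ j, hor ((∂_{e j} w) x) j = 0

/-- The energy class `L^∞(0,T; L²) ∩ L²(0,T; Ḣ¹)`; the field `Du` is the spatial gradient
of `u`. -/
structure InEnergyClass {m : ℕ} (T : ℝ) (u : ℝ → L2Vel m) (Du : ℝ → Fin 2 → L2Vel m) :
    Prop where
  memLp_top : MemLp u ∞ (volume.restrict (Ioo 0 T))
  memLp_grad : ∀ j, MemLp (fun t => Du t j) 2 (volume.restrict (Ioo 0 T))
  isWeakGradient : ∀ᵐ t ∂(volume.restrict (Ioo 0 T)), IsWeakGradient (u t) (Du t)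

/-- `v ∈ L^∞(0,T; L²)` is a distributional solution, on `(0,T) × ℝ²` and for some pressure `π`, of
`∂ₜ v + (u · ∇) u - Δ v + ∇ π = 0`, `div v = 0`, `v(0) = u₀`, where `(u · ∇) u` is written as
`∂₁ (u¹ u) + ∂₂ (u² u)`, as one may for a divergence-free `u`. The equation is tested against
`ϑ(t) w(x)` with `ϑ` smooth and compactly supported in `[0,T)` and `w` a divergence-free Schwartz
field, which removes the pressure. The case `u = v` is the Navier-Stokes system. -/
structure IsWeakSolution {m : ℕ} (T : ℝ) (u₀ : L2Vel m) (u v : ℝ → L2Vel m) : Prop where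
  memLp_top : MemLp v ∞ (volume.restrict (Ioo 0 T))
  isDivFree : ∀ᵐ t ∂(volume.restrict (Ioo 0 T)), IsDivFree (v t)
  equation : ∀ (ϑ : ℝ → ℝ) (w : 𝓢(Plane, Vel m)), ContDiff ℝ ∞ ϑ → HasCompactSupport ϑ →
    tsupport ϑ ⊆ Iio T → IsDivFreeTest w →
    ϑ 0 * (∫ x, ⟪u₀ x, w x⟫) +
      ∫ t in Ioo 0 T,
        (deriv ϑ t * (∫ x, ⟪v t x, w x⟫) +
          ϑ t * ((∫ x, ⟪v t x, (Δ w) x⟫) +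
            ∫ x, ∑ j, hor (u t x) j * ⟪u t x, (∂_{e j} w) x⟫)) = 0

end PlanarFlow

end

/-!
On the Fourier side the equation `∂ₜ v + (u · ∇) u - Δ v + ∇ π = 0` becomes, after the Leray
projection, one ordinary differential equation for each frequency: `∂ₜ V = - 4 π² |ξ|² V + N`,
where `|N|` is at most a constant times `|ξ|` times the convolution of `|U|` with itself, and `U`,
`V` are the Fourier transforms of `u`, `v`. By Duhamel's formula `|V|` is bounded by the heat flow
of the initial value plus the heat flow of `|N|` (`ae_ae_enorm_le_heat_add_duhamel`). The two parts
are estimated in `L²` in time with values in `L¹` in frequency, with kernels in place of Besov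
spaces.

For the free part the square of the norm is the quadratic form of the kernel `1 / (|ξ|² + |η|²)`,
which is bounded on `L²(ℝ²)` by Schur's test (`lintegral_lintegral_inv_add_sq_le`): a Hilbert
inequality in the plane.

For the Duhamel part let `F s t` be the `L¹` norm of the contribution of the time `s` at the later
time `t`. It decreases in `t`, and its integral in `t` is at most a constant times the quadratic
form of the kernel `1 / |ξ + η|` at `|U s|`, which Schur's test bounds by the norm of `u(s)` in
`Ḣ^{1/2}`, squared (`lintegral_lintegral_inv_norm_add_le`). A superposition of decreasing profiles
is bounded in `L²` by twice the `L²` norm of their masses (`sq_lintegral_superposition_le`), and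
the fourth power of the `Ḣ^{1/2}` norm is integrable in time because it is at most the energy times
the dissipation. Hence the bound `C (‖u₀‖² + M⁴)`, without any dependence on `T`
(`lintegral_sq_lintegral_enorm_le`). The inversion formula turns the bound for `v̂` in `L¹` into
one for `v` in `L^∞`.

For the Navier-Stokes equations the missing bound of `u = v` by the initial value is the energy
equality (`ae_energy_eq`). Each frequency satisfies an energy identity with an additional transfer
term. The total transfer is absolutely convergent, by the trilinear estimate
`lintegral_lintegral_mul_mul_add_le`, and it vanishes: the Leray symbol disappears against a
divergence-free field, and the change of variables `(ξ, η) ↦ (ξ - η, -η)` shows that the remaining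
trilinear integral is real, whereas the transfer is its imaginary part up to a factor
(`integral_transfer_eq_zero`).

The equation for each frequency comes from testing with the fields `Δφ e_i - ∇ ∂_i φ`, which are
divergence-free (`IsWeakSolution.ae_frequency_equation`). To speak of single frequencies, jointly
measurable representatives of the Fourier transforms are fixed first
(`exists_stronglyMeasurable_fourierL2`).
-/

namespace PlanarFlow

/-! ### Kernel estimates in the plane -/

/-- Weighted inequality between the geometric and the arithmetic mean. -/
theorem two_mul_mul_le_sq_mul_add_sq_mul_inv (a b : ℝ≥0∞) {t : ℝ≥0∞} (h0 : t ≠ 0) (h1 : t ≠ ⊤) :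
    2 * (a * b) ≤ a ^ 2 * t + b ^ 2 * t⁻¹ := by
  rcases eq_or_ne a ⊤ with rfl | ha
  · simp [h0]
  rcases eq_or_ne b ⊤ with rfl | hb
  · simp [h1]
  lift a to NNReal using ha
  lift b to NNReal using hb
  lift t to NNReal using h1
  have ht : t ≠ 0 := by exact_mod_cast h0
  rw [← ENNReal.coe_inv ht]
  norm_cast
  rw [← NNReal.coe_le_coe]
  push_cast
  have htp : (0 : ℝ) < t := lt_of_le_of_ne t.2 (by exact_mod_cast ht.symm)
  have : (a : ℝ) ^ 2 * t + b ^ 2 * (t : ℝ)⁻¹ - 2 * (a * b) = (a * t - b) ^ 2 * (t : ℝ)⁻¹ := by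
    field_simp
    ring
  nlinarith [mul_nonneg (sq_nonneg ((a : ℝ) * t - b)) (inv_nonneg.2 htp.le)]

/-- Schur's test for a symmetric positive kernel `K`, tested on the weight `p`. -/
theorem lintegral_lintegral_kernel_le {α : Type*} [MeasurableSpace α] {μ : Measure α} [SFinite μ]
    {K : α → α → ℝ≥0∞} {p W f : α → ℝ≥0∞} (hK : Measurable (Function.uncurry K))
    (hKs : ∀ x y, K x y = K y x) (hp : Measurable p) (hf : Measurable f)
    (hp0 : ∀ᵐ x ∂μ, p x ≠ 0 ∧ p x ≠ ⊤)
    (hW : ∀ᵐ x ∂μ, ∫⁻ y, K x y * p y ∂μ ≤ p x * W x) :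
    ∫⁻ x, ∫⁻ y, K x y * (f x * f y) ∂μ ∂μ ≤ ∫⁻ x, W x * f x ^ 2 ∂μ := by
  set J : ℝ≥0∞ := ∫⁻ x, ∫⁻ y, K x y * (f x ^ 2 * (p y * (p x)⁻¹)) ∂μ ∂μ with hJ
  have hKm : ∀ x, Measurable (K x) := fun x => hK.of_uncurry_left
  have hm1 : Measurable fun q : α × α => K q.1 q.2 * (f q.1 ^ 2 * (p q.2 * (p q.1)⁻¹)) := by
    have : Measurable fun q : α × α => K q.1 q.2 := hK
    fun_prop
  have hm2 : Measurable fun q : α × α => K q.1 q.2 * (f q.2 ^ 2 * (p q.1 * (p q.2)⁻¹)) := by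
    have : Measurable fun q : α × α => K q.1 q.2 := hK
    fun_prop
  have hJ2 : J = ∫⁻ x, ∫⁻ y, K x y * (f y ^ 2 * (p x * (p y)⁻¹)) ∂μ ∂μ := by
    rw [lintegral_lintegral_swap hm2.aemeasurable, hJ]
    simp_rw [fun x y => hKs y x]
  have hJle : J ≤ ∫⁻ x, W x * f x ^ 2 ∂μ := by
    refine lintegral_mono_ae ?_
    filter_upwards [hp0, hW] with x hx hxW
    calc ∫⁻ y, K x y * (f x ^ 2 * (p y * (p x)⁻¹)) ∂μ
        = ∫⁻ y, (f x ^ 2 * (p x)⁻¹) * (K x y * p y) ∂μ := by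
          congr 1; ext y; ring
      _ = (f x ^ 2 * (p x)⁻¹) * ∫⁻ y, K x y * p y ∂μ :=
          lintegral_const_mul _ ((hKm x).mul hp)
      _ ≤ (f x ^ 2 * (p x)⁻¹) * (p x * W x) := by gcongr
      _ = ((p x)⁻¹ * p x) * (W x * f x ^ 2) := by ring
      _ = W x * f x ^ 2 := by rw [ENNReal.inv_mul_cancel hx.1 hx.2, one_mul]
  have h2 : 2 * ∫⁻ x, ∫⁻ y, K x y * (f x * f y) ∂μ ∂μ ≤ J + J := by
    calc 2 * ∫⁻ x, ∫⁻ y, K x y * (f x * f y) ∂μ ∂μ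
        = ∫⁻ x, ∫⁻ y, 2 * (K x y * (f x * f y)) ∂μ ∂μ := by
          rw [← lintegral_const_mul' _ _ (by simp)]
          congr 1; ext x
          rw [lintegral_const_mul' _ _ (by simp)]
      _ ≤ ∫⁻ x, ∫⁻ y, (K x y * (f x ^ 2 * (p y * (p x)⁻¹))
            + K x y * (f y ^ 2 * (p x * (p y)⁻¹))) ∂μ ∂μ := by
          refine lintegral_mono_ae ?_
          filter_upwards [hp0] with x hx
          refine lintegral_mono_ae ?_
          filter_upwards [hp0] with y hy
          have := two_mul_mul_le_sq_mul_add_sq_mul_inv (f x) (f y) (t := p y * (p x)⁻¹)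
            (mul_ne_zero hy.1 (ENNReal.inv_ne_zero.2 hx.2))
            (ENNReal.mul_ne_top hy.2 (ENNReal.inv_ne_top.2 hx.1))
          rw [ENNReal.mul_inv (Or.inl hy.1) (Or.inl hy.2), inv_inv, mul_comm (p y)⁻¹] at this
          calc 2 * (K x y * (f x * f y)) = K x y * (2 * (f x * f y)) := by ring
            _ ≤ K x y * _ := by gcongr
            _ = _ := mul_add _ _ _
      _ = J + J := by
          have hx1 : ∀ x, Measurable fun y => K x y * (f x ^ 2 * (p y * (p x)⁻¹)) := fun x =>
            hm1.comp measurable_prodMk_left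
          simp_rw [lintegral_add_left (hx1 _)]
          rw [lintegral_add_left hm1.lintegral_prod_right', ← hJ2]
  rw [← two_mul] at h2
  exact ((ENNReal.mul_le_mul_iff_right (by simp) (by simp)).1 h2).trans hJle

/-- Integration in polar coordinates of a radial function. -/
theorem lintegral_comp_norm {f : ℝ → ℝ≥0∞} (hf : Measurable f) :
    ∫⁻ x : Plane, f ‖x‖ = ENNReal.ofReal (2 * Real.pi) * ∫⁻ r in Ioi (0 : ℝ),
        ENNReal.ofReal r * f r := by
  have hd : Module.finrank ℝ Plane = 2 := by simp
  calc ∫⁻ x : Plane, f ‖x‖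
      = ∫⁻ x : ({(0)}ᶜ : Set Plane), f ‖(x : Plane)‖ ∂((volume : Measure Plane).comap (↑)) := by
        rw [lintegral_subtype_comap (measurableSet_singleton _).compl fun x : Plane => f (‖x‖),
          restrict_compl_singleton]
    _ = ∫⁻ x, f x.2 ∂(volume : Measure Plane).toSphere.prod
          (.volumeIoiPow (Module.finrank ℝ Plane - 1)) := by
        simpa using (volume : Measure Plane).measurePreserving_homeomorphUnitSphereProd.lintegral_comp_emb
          (Homeomorph.measurableEmbedding _) (f ∘ Subtype.val ∘ Prod.snd)
    _ = (volume : Measure Plane).toSphere univ *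
          ∫⁻ x : Ioi (0 : ℝ), f x ∂.volumeIoiPow (Module.finrank ℝ Plane - 1) := by
        rw [lintegral_prod _ (by fun_prop)]
        simp only [lintegral_const]
        rw [mul_comm]
    _ = _ := by
        rw [Measure.toSphere_apply_univ, hd, EuclideanSpace.volume_ball_fin_two]
        congr 1
        · rw [ENNReal.ofReal_mul (by norm_num)]; simp
        · rw [Measure.volumeIoiPow,
            lintegral_withDensity_eq_lintegral_mul _ (by fun_prop) (by fun_prop)]
          rw [← lintegral_subtype_comap measurableSet_Ioi]
          simp

theorem lintegral_norm_le_rpow {p r : ℝ} (hp : p < 2) (hr : 0 < r) :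
    ∫⁻ x in {x : Plane | ‖x‖ ≤ r}, ENNReal.ofReal (‖x‖ ^ (-p)) =
      ENNReal.ofReal (2 * Real.pi * (r ^ (2 - p) / (2 - p))) := by
  have hs : MeasurableSet {x : Plane | ‖x‖ ≤ r} := measurableSet_le (by fun_prop) (by fun_prop)
  rw [← lintegral_indicator hs]
  have h := lintegral_comp_norm (f := (Iic r).indicator fun s => ENNReal.ofReal (s ^ (-p)))
    ((by fun_prop : Measurable fun s : ℝ => ENNReal.ofReal (s ^ (-p))).indicator measurableSet_Iic)
  have e1 : (fun x : Plane => (Iic r).indicator (fun s => ENNReal.ofReal (s ^ (-p))) ‖x‖) =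
      {x : Plane | ‖x‖ ≤ r}.indicator fun x => ENNReal.ofReal (‖x‖ ^ (-p)) := by
    ext x; simp [indicator]
  rw [e1] at h
  rw [h, ENNReal.ofReal_mul (p := 2 * Real.pi) (by positivity)]
  congr 1
  have e2 : ∀ s ∈ Ioi (0 : ℝ), ENNReal.ofReal s * (Iic r).indicator
      (fun s => ENNReal.ofReal (s ^ (-p))) s
      = (Iic r).indicator (fun s => ENNReal.ofReal (s ^ (1 - p))) s := by
    intro s (hs : 0 < s)
    by_cases hsr : s ≤ r
    · simp only [indicator, mem_Iic, hsr, if_true]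
      rw [← ENNReal.ofReal_mul hs.le, sub_eq_add_neg, Real.rpow_add hs, Real.rpow_one]
    · simp [indicator, hsr]
  rw [setLIntegral_congr_fun measurableSet_Ioi e2, lintegral_indicator measurableSet_Iic,
    Measure.restrict_restrict measurableSet_Iic, Iic_inter_Ioi]
  have hint : IntegrableOn (fun s : ℝ => s ^ (1 - p)) (Ioc 0 r) := by
    have := (intervalIntegral.intervalIntegrable_rpow' (a := 0) (b := r)
      (r := 1 - p) (by linarith)).1
    exact this
  rw [← ofReal_integral_eq_lintegral_ofReal hint
    ((ae_restrict_mem measurableSet_Ioc).mono fun s hs => Real.rpow_nonneg hs.1.le _),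
    ← intervalIntegral.integral_of_le hr.le, integral_rpow (Or.inl (by linarith)),
    Real.zero_rpow (by linarith)]
  congr 1
  ring_nf

theorem lintegral_le_norm_rpow {p r : ℝ} (hp : 2 < p) (hr : 0 < r) :
    ∫⁻ x in {x : Plane | r ≤ ‖x‖}, ENNReal.ofReal (‖x‖ ^ (-p)) =
      ENNReal.ofReal (2 * Real.pi * (r ^ (2 - p) / (p - 2))) := by
  have hs : MeasurableSet {x : Plane | r ≤ ‖x‖} := measurableSet_le (by fun_prop) (by fun_prop)
  rw [← lintegral_indicator hs]
  have h := lintegral_comp_norm (f := (Ici r).indicator fun s => ENNReal.ofReal (s ^ (-p)))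
    ((by fun_prop : Measurable fun s : ℝ => ENNReal.ofReal (s ^ (-p))).indicator measurableSet_Ici)
  have e1 : (fun x : Plane => (Ici r).indicator (fun s => ENNReal.ofReal (s ^ (-p))) ‖x‖) =
      {x : Plane | r ≤ ‖x‖}.indicator fun x => ENNReal.ofReal (‖x‖ ^ (-p)) := by
    ext x; simp [indicator]
  rw [e1] at h
  rw [h, ENNReal.ofReal_mul (p := 2 * Real.pi) (by positivity)]
  congr 1
  have e2 : ∀ s ∈ Ioi (0 : ℝ), ENNReal.ofReal s * (Ici r).indicator
      (fun s => ENNReal.ofReal (s ^ (-p))) s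
      = (Ici r).indicator (fun s => ENNReal.ofReal (s ^ (1 - p))) s := by
    intro s (hs : 0 < s)
    by_cases hsr : r ≤ s
    · simp only [indicator, mem_Ici, hsr, if_true]
      rw [← ENNReal.ofReal_mul hs.le, sub_eq_add_neg, Real.rpow_add hs, Real.rpow_one]
    · simp [indicator, hsr]
  rw [setLIntegral_congr_fun measurableSet_Ioi e2, lintegral_indicator measurableSet_Ici,
    Measure.restrict_restrict measurableSet_Ici,
    inter_eq_left.2 (show Ici r ⊆ Ioi 0 from fun s (hs : r ≤ s) => hr.trans_le hs),
        ← setLIntegral_congr Ioi_ae_eq_Ici]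
  rw [← ofReal_integral_eq_lintegral_ofReal (integrableOn_Ioi_rpow_of_lt (by linarith) hr)
    ((ae_restrict_mem measurableSet_Ioi).mono fun s hs => Real.rpow_nonneg (hr.trans hs).le _),
    integral_Ioi_rpow_of_lt (by linarith) hr]
  congr 1
  rw [show 1 - p + 1 = 2 - p by ring, show p - 2 = -(2 - p) by ring, div_neg, neg_div]

theorem ae_norm_pos : ∀ᵐ x : Plane, 0 < ‖x‖ := by
  filter_upwards [Measure.ae_ne volume (0 : Plane)] with x hx using norm_pos_iff.2 hx

/-- The Cauchy-Schwarz inequality for nonnegative functions, squared. -/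
theorem sq_lintegral_mul_le {α : Type*} [MeasurableSpace α] {μ : Measure α} {f g : α → ℝ≥0∞}
    (hf : AEMeasurable f μ) (hg : AEMeasurable g μ) :
    (∫⁻ x, f x * g x ∂μ) ^ 2 ≤ (∫⁻ x, f x ^ 2 ∂μ) * ∫⁻ x, g x ^ 2 ∂μ := by
  have h := ENNReal.lintegral_mul_le_Lp_mul_Lq μ Real.HolderConjugate.two_two hf hg
  have h2 : ∀ c : ℝ≥0∞, (c ^ (1 / (2 : ℝ))) ^ 2 = c := by
    intro c
    rw [← ENNReal.rpow_natCast, ← ENNReal.rpow_mul]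
    norm_num
  calc (∫⁻ x, f x * g x ∂μ) ^ 2
      ≤ ((∫⁻ x, f x ^ (2 : ℝ) ∂μ) ^ (1 / (2 : ℝ)) *
          (∫⁻ x, g x ^ (2 : ℝ) ∂μ) ^ (1 / (2 : ℝ))) ^ 2 := by
        gcongr
        exact h
    _ = _ := by
        rw [mul_pow, h2, h2]
        simp only [ENNReal.rpow_two]

/-- Interpolation of the half derivative between the energy and the dissipation, squared. -/
theorem sq_lintegral_norm_mul_sq_le {f : Plane → ℝ≥0∞} (hf : Measurable f) :
    (∫⁻ x, ENNReal.ofReal ‖x‖ * f x ^ 2) ^ 2 ≤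
      (∫⁻ x, f x ^ 2) * ∫⁻ x, ENNReal.ofReal (‖x‖ ^ 2) * f x ^ 2 := by
  have h := sq_lintegral_mul_le (μ := (volume : Measure Plane)) (f := f)
    (g := fun x => ENNReal.ofReal ‖x‖ * f x) hf.aemeasurable (by fun_prop)
  calc (∫⁻ x, ENNReal.ofReal ‖x‖ * f x ^ 2) ^ 2
      = (∫⁻ x, f x * (ENNReal.ofReal ‖x‖ * f x)) ^ 2 := by
        congr 2; ext x; ring
    _ ≤ _ := h
    _ = _ := by
        congr 2; ext x; rw [mul_pow, ENNReal.ofReal_pow (norm_nonneg _)]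

/-- The kernel `1 / (|x|² + |y|²)` is bounded on `L²(ℝ²)`: this is the Hilbert type inequality
which puts the solution of the heat equation in `L²` in time with values in the functions
with integrable Fourier transform. -/
theorem lintegral_lintegral_inv_add_sq_le {f : Plane → ℝ≥0∞} (hf : Measurable f) :
    ∫⁻ x, ∫⁻ y, ENNReal.ofReal (1 / (‖x‖ ^ 2 + ‖y‖ ^ 2)) * (f x * f y) ≤
      ENNReal.ofReal (4 * Real.pi) * ∫⁻ x, f x ^ 2 := by
  rw [← lintegral_const_mul _ (by fun_prop)]
  refine lintegral_lintegral_kernel_le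
    (K := fun x y : Plane => ENNReal.ofReal (1 / (‖x‖ ^ 2 + ‖y‖ ^ 2)))
    (p := fun x => ENNReal.ofReal (‖x‖ ^ (-1 : ℝ)))
    (W := fun _ => ENNReal.ofReal (4 * Real.pi)) (by unfold Function.uncurry; fun_prop)
    (fun x y => by rw [add_comm]) (by fun_prop) hf ?_ ?_
  · filter_upwards [ae_norm_pos] with x hx
    exact ⟨(ENNReal.ofReal_pos.2 (by positivity)).ne', ENNReal.ofReal_ne_top⟩
  · filter_upwards [ae_norm_pos] with x hx
    set r := ‖x‖
    have hu : ({y : Plane | ‖y‖ ≤ r} ∪ {y : Plane | r ≤ ‖y‖}) = univ := by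
      ext y; simpa using le_total ‖y‖ r
    have hA : MeasurableSet {y : Plane | ‖y‖ ≤ r} := measurableSet_le (by fun_prop) (by fun_prop)
    have hB : MeasurableSet {y : Plane | r ≤ ‖y‖} := measurableSet_le (by fun_prop) (by fun_prop)
    rw [← setLIntegral_univ, ← hu]
    refine (lintegral_union_le _ _ _).trans ?_
    have h1 : ∫⁻ y in {y : Plane | ‖y‖ ≤ r},
        ENNReal.ofReal (1 / (r ^ 2 + ‖y‖ ^ 2)) * ENNReal.ofReal (‖y‖ ^ (-1 : ℝ)) ≤
        ENNReal.ofReal (2 * Real.pi * r⁻¹) := by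
      calc _ ≤ ∫⁻ y in {y : Plane | ‖y‖ ≤ r},
              ENNReal.ofReal ((r ^ 2)⁻¹) * ENNReal.ofReal (‖y‖ ^ (-1 : ℝ)) := by
            refine lintegral_mono fun y => ?_
            gcongr
            rw [one_div]
            gcongr
            nlinarith [sq_nonneg ‖y‖]
        _ = ENNReal.ofReal ((r ^ 2)⁻¹) * ENNReal.ofReal (2 * Real.pi * (r ^ (2 - 1 : ℝ) / (2 - 1))) := by
            rw [lintegral_const_mul _ (by fun_prop), lintegral_norm_le_rpow (by norm_num) hx]
        _ = _ := by
            rw [← ENNReal.ofReal_mul (by positivity)]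
            congr 1
            norm_num
            field_simp
    have h2 : ∫⁻ y in {y : Plane | r ≤ ‖y‖},
        ENNReal.ofReal (1 / (r ^ 2 + ‖y‖ ^ 2)) * ENNReal.ofReal (‖y‖ ^ (-1 : ℝ)) ≤
        ENNReal.ofReal (2 * Real.pi * r⁻¹) := by
      calc _ ≤ ∫⁻ y in {y : Plane | r ≤ ‖y‖}, ENNReal.ofReal (‖y‖ ^ (-(3 : ℝ))) := by
            refine setLIntegral_mono' hB fun y (hy : r ≤ ‖y‖) => ?_
            have hy0 : 0 < ‖y‖ := hx.trans_le hy
            rw [← ENNReal.ofReal_mul (by positivity)]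
            refine ENNReal.ofReal_le_ofReal ?_
            rw [Real.rpow_neg hy0.le, Real.rpow_neg hy0.le, Real.rpow_one,
              show (3 : ℝ) = ((3 : ℕ) : ℝ) by norm_num, Real.rpow_natCast, one_div, ← mul_inv]
            gcongr
            nlinarith [sq_nonneg r]
        _ = _ := by
            rw [lintegral_le_norm_rpow (by norm_num) hx]
            congr 1
            norm_num
            rw [Real.rpow_neg_one]
    refine (add_le_add h1 h2).trans_eq ?_
    rw [← ENNReal.ofReal_add (by positivity) (by positivity), ← ENNReal.ofReal_mul (by positivity),
      Real.rpow_neg_one]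
    congr 1
    ring

/-- The weight `|y| ^ (-3/2)` is a test weight for the kernel `1 / |x + y|`. The plane is cut into
the disc of radius `|x| / 2` around `0`, the one around `-x`, and the rest, where the smaller of
`|y|` and `|x + y|` bounds the integrand by its power `-5/2`. -/
theorem lintegral_inv_norm_add_mul_rpow_le {x : Plane} (hx : 0 < ‖x‖) :
    ∫⁻ y : Plane, ENNReal.ofReal (‖x + y‖⁻¹) * ENNReal.ofReal (‖y‖ ^ (-(3 / 2) : ℝ)) ≤
      ENNReal.ofReal (‖x‖ ^ (-(3 / 2) : ℝ)) * ENNReal.ofReal (56 * Real.pi * ‖x‖) := by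
  -- in terms of `s`, all the half-integral powers of the radius become integral ones
  obtain ⟨s, hs, hsx⟩ : ∃ s : ℝ, 0 < s ∧ ‖x‖ / 2 = s ^ 2 :=
    ⟨√(‖x‖ / 2), by positivity, (Real.sq_sqrt (by positivity)).symm⟩
  set ρ := ‖x‖ / 2 with hρ
  have hρ0 : 0 < ρ := by positivity
  have hpow : ∀ (n : ℝ), ρ ^ n = s ^ (2 * n) := by
    intro n
    rw [hsx, ← Real.rpow_natCast, ← Real.rpow_mul hs.le]; norm_num
  have htr : ∀ (g : Plane → ℝ≥0∞) (A : Set Plane), MeasurableSet A →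
      ∫⁻ y in (fun y => x + y) ⁻¹' A, g (x + y) = ∫⁻ y in A, g y := fun g A hA => by
    rw [← lintegral_indicator hA, ← lintegral_indicator (hA.preimage (by fun_prop)),
      ← lintegral_add_left_eq_self (A.indicator g) x]
    rfl
  set A : Set Plane := {y | ‖y‖ ≤ ρ} with hAdef
  set C : Set Plane := {y | ρ ≤ ‖y‖} with hCdef
  have hA : MeasurableSet A := measurableSet_le (by fun_prop) (by fun_prop)
  have hC : MeasurableSet C := measurableSet_le (by fun_prop) (by fun_prop)
  have hA' : MeasurableSet ((fun y => x + y) ⁻¹' A) := hA.preimage (by fun_prop)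
  have hC' : MeasurableSet ((fun y => x + y) ⁻¹' C) := hC.preimage (by fun_prop)
  have hu : A ∪ ((fun y => x + y) ⁻¹' A ∪ (C ∩ (fun y => x + y) ⁻¹' C)) = univ := by
    ext y
    simp only [A, C, mem_union, mem_inter_iff, mem_preimage, mem_ofPred_eq, mem_univ, iff_true]
    rcases le_total ‖y‖ ρ with h | h
    · exact Or.inl h
    · rcases le_total ‖x + y‖ ρ with h' | h'
      · exact Or.inr (Or.inl h')
      · exact Or.inr (Or.inr ⟨h, h'⟩)
  set F : Plane → ℝ≥0∞ := fun y => ENNReal.ofReal (‖x + y‖⁻¹) * ENNReal.ofReal (‖y‖ ^ (-(3 / 2) : ℝ))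
  have h1 : ∫⁻ y in A, F y ≤ ENNReal.ofReal (4 * Real.pi * s⁻¹) := by
    calc _ ≤ ∫⁻ y in A, ENNReal.ofReal (ρ⁻¹) * ENNReal.ofReal (‖y‖ ^ (-(3 / 2) : ℝ)) := by
          refine setLIntegral_mono' hA fun y (hy : ‖y‖ ≤ ρ) => ?_
          have : ρ ≤ ‖x + y‖ := by
            have := norm_sub_norm_le x (-y)
            rw [norm_neg, sub_neg_eq_add] at this
            linarith
          simp only [F]
          gcongr
      _ = ENNReal.ofReal (ρ⁻¹) * ENNReal.ofReal (2 * Real.pi * (ρ ^ (2 - 3 / 2 : ℝ) / (2 - 3 / 2))) := by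
          rw [lintegral_const_mul _ (by fun_prop), lintegral_norm_le_rpow (by norm_num) hρ0]
      _ = _ := by
          rw [← ENNReal.ofReal_mul (by positivity), hpow]
          congr 1
          norm_num
          rw [hsx]
          field_simp
          ring
  have h2 : ∫⁻ y in (fun y => x + y) ⁻¹' A, F y ≤ ENNReal.ofReal (2 * Real.pi * s⁻¹) := by
    calc _ ≤ ∫⁻ y in (fun y => x + y) ⁻¹' A,
            ENNReal.ofReal (‖x + y‖ ^ (-1 : ℝ)) * ENNReal.ofReal (ρ ^ (-(3 / 2) : ℝ)) := by
          refine setLIntegral_mono' hA' fun y (hy : ‖x + y‖ ≤ ρ) => ?_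
          have : ρ ≤ ‖y‖ := by
            have := norm_sub_norm_le x (x + y)
            rw [show x - (x + y) = -y by abel, norm_neg] at this
            linarith
          simp only [F]
          rw [Real.rpow_neg_one]
          exact mul_le_mul' le_rfl (ENNReal.ofReal_le_ofReal
            (Real.rpow_le_rpow_of_nonpos hρ0 this (by norm_num)))
      _ = ENNReal.ofReal (2 * Real.pi * (ρ ^ (2 - 1 : ℝ) / (2 - 1))) * ENNReal.ofReal (ρ ^ (-(3 / 2) : ℝ)) := by
          rw [lintegral_mul_const _ (by fun_prop),
            htr (fun z => ENNReal.ofReal (‖z‖ ^ (-1 : ℝ))) A hA,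
            lintegral_norm_le_rpow (by norm_num) hρ0]
      _ = _ := by
          rw [← ENNReal.ofReal_mul (by positivity), hpow, hpow]
          congr 1
          have e1 : s ^ (2 * (2 - 1) : ℝ) = s ^ 2 := by norm_num
          have e2 : s ^ (2 * -(3 / 2) : ℝ) = (s ^ 3)⁻¹ := by
            rw [show (2 * -(3 / 2) : ℝ) = -((3 : ℕ) : ℝ) by norm_num, Real.rpow_neg hs.le,
              Real.rpow_natCast]
          rw [e1, e2]
          field_simp
          norm_num
  have hfar : ∫⁻ y in C, ENNReal.ofReal (‖y‖ ^ (-(5 / 2) : ℝ)) =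
      ENNReal.ofReal (4 * Real.pi * s⁻¹) := by
    rw [lintegral_le_norm_rpow (by norm_num) hρ0, hpow]
    congr 1
    have e1 : s ^ (2 * (2 - 5 / 2) : ℝ) = s⁻¹ := by
      rw [show (2 * (2 - 5 / 2) : ℝ) = -1 by norm_num, Real.rpow_neg_one]
    rw [e1]
    ring
  have h3 : ∫⁻ y in C ∩ (fun y => x + y) ⁻¹' C, F y ≤ ENNReal.ofReal (8 * Real.pi * s⁻¹) := by
    calc _ ≤ ∫⁻ y in C ∩ (fun y => x + y) ⁻¹' C, (ENNReal.ofReal (‖y‖ ^ (-(5 / 2) : ℝ)) +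
            ENNReal.ofReal (‖x + y‖ ^ (-(5 / 2) : ℝ))) := by
          refine setLIntegral_mono' (hC.inter hC') fun y hy => ?_
          have hy1 : 0 < ‖y‖ := hρ0.trans_le hy.1
          have hy2 : 0 < ‖x + y‖ := hρ0.trans_le hy.2
          simp only [F]
          rw [← ENNReal.ofReal_mul (by positivity), ← ENNReal.ofReal_add (by positivity) (by positivity)]
          refine ENNReal.ofReal_le_ofReal ?_
          have hsplit : ∀ t : ℝ, 0 < t → t ^ (-(5 / 2) : ℝ) = t⁻¹ * t ^ (-(3 / 2) : ℝ) := by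
            intro t ht
            rw [← Real.rpow_neg_one, ← Real.rpow_add ht]; norm_num
          rcases le_total ‖y‖ ‖x + y‖ with h | h
          · have : ‖x + y‖⁻¹ * ‖y‖ ^ (-(3 / 2) : ℝ) ≤ ‖y‖⁻¹ * ‖y‖ ^ (-(3 / 2) : ℝ) := by gcongr
            rw [← hsplit _ hy1] at this
            exact this.trans (le_add_of_nonneg_right (by positivity))
          · have : ‖x + y‖⁻¹ * ‖y‖ ^ (-(3 / 2) : ℝ) ≤ ‖x + y‖⁻¹ * ‖x + y‖ ^ (-(3 / 2) : ℝ) := by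
              exact mul_le_mul_of_nonneg_left
                (Real.rpow_le_rpow_of_nonpos hy2 h (by norm_num)) (by positivity)
            rw [← hsplit _ hy2] at this
            exact this.trans (le_add_of_nonneg_left (by positivity))
      _ = (∫⁻ y in C ∩ (fun y => x + y) ⁻¹' C, ENNReal.ofReal (‖y‖ ^ (-(5 / 2) : ℝ))) +
            ∫⁻ y in C ∩ (fun y => x + y) ⁻¹' C, ENNReal.ofReal (‖x + y‖ ^ (-(5 / 2) : ℝ)) :=
          lintegral_add_left (by fun_prop) _
      _ ≤ (∫⁻ y in C, ENNReal.ofReal (‖y‖ ^ (-(5 / 2) : ℝ))) +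
            ∫⁻ y in (fun y => x + y) ⁻¹' C, ENNReal.ofReal (‖x + y‖ ^ (-(5 / 2) : ℝ)) :=
          add_le_add (lintegral_mono_set inter_subset_left) (lintegral_mono_set inter_subset_right)
      _ = _ := by
          rw [htr (fun z => ENNReal.ofReal (‖z‖ ^ (-(5 / 2) : ℝ))) C hC, hfar,
            ← ENNReal.ofReal_add (by positivity) (by positivity)]
          congr 1
          ring
  calc ∫⁻ y, F y = ∫⁻ y in A ∪ ((fun y => x + y) ⁻¹' A ∪ (C ∩ (fun y => x + y) ⁻¹' C)), F y := by
        rw [hu, setLIntegral_univ]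
    _ ≤ (∫⁻ y in A, F y) + ((∫⁻ y in (fun y => x + y) ⁻¹' A, F y) +
          ∫⁻ y in C ∩ (fun y => x + y) ⁻¹' C, F y) :=
        (lintegral_union_le _ _ _).trans (by gcongr; exact lintegral_union_le _ _ _)
    _ ≤ ENNReal.ofReal (4 * Real.pi * s⁻¹) + (ENNReal.ofReal (2 * Real.pi * s⁻¹) +
          ENNReal.ofReal (8 * Real.pi * s⁻¹)) := by gcongr
    _ ≤ _ := by
        rw [← ENNReal.ofReal_add (by positivity) (by positivity),
          ← ENNReal.ofReal_add (by positivity) (by positivity),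
              ← ENNReal.ofReal_mul (by positivity)]
        refine ENNReal.ofReal_le_ofReal ?_
        have hx2 : ‖x‖ = 2 * s ^ 2 := by rw [← hsx, hρ]; ring
        have hle : (2 * s) ^ (-3 : ℝ) ≤ ‖x‖ ^ (-(3 / 2) : ℝ) := by
          have : ((2 * s) ^ 2 : ℝ) ^ (-(3 / 2) : ℝ) = (2 * s) ^ (-3 : ℝ) := by
            rw [← Real.rpow_natCast, ← Real.rpow_mul (by positivity)]; norm_num
          rw [← this]
          refine Real.rpow_le_rpow_of_nonpos hx ?_ (by norm_num)
          rw [hx2]; nlinarith [sq_nonneg s]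
        have e3 : (2 * s) ^ (-3 : ℝ) = (8 * s ^ 3)⁻¹ := by
          rw [show (-3 : ℝ) = -((3 : ℕ) : ℝ) by norm_num, Real.rpow_neg (by positivity),
            Real.rpow_natCast]; ring
        calc 4 * Real.pi * s⁻¹ + (2 * Real.pi * s⁻¹ + 8 * Real.pi * s⁻¹)
            = (8 * s ^ 3)⁻¹ * (56 * Real.pi * ‖x‖) := by rw [hx2]; field_simp; norm_num
          _ ≤ _ := by rw [← e3]; gcongr

/-- The bilinear form with kernel `1 / |x + y|` is controlled by the weighted norm of `L²`
with weight `|x|`, which lies between `L²` and its first moment. -/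
theorem lintegral_lintegral_inv_norm_add_le {f : Plane → ℝ≥0∞} (hf : Measurable f) :
    ∫⁻ x, ∫⁻ y, ENNReal.ofReal (‖x + y‖⁻¹) * (f x * f y) ≤
      ENNReal.ofReal (56 * Real.pi) * ∫⁻ x, ENNReal.ofReal ‖x‖ * f x ^ 2 := by
  rw [← lintegral_const_mul _ (by fun_prop)]
  refine (lintegral_lintegral_kernel_le (K := fun x y : Plane => ENNReal.ofReal (‖x + y‖⁻¹))
    (p := fun x => ENNReal.ofReal (‖x‖ ^ (-(3 / 2) : ℝ)))
    (W := fun x => ENNReal.ofReal (56 * Real.pi * ‖x‖)) (by unfold Function.uncurry; fun_prop)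
    (fun x y => by rw [add_comm]) (by fun_prop) hf ?_ ?_).trans_eq ?_
  · filter_upwards [ae_norm_pos] with x hx
    exact ⟨(ENNReal.ofReal_pos.2 (by positivity)).ne', ENNReal.ofReal_ne_top⟩
  · filter_upwards [ae_norm_pos] with x hx using lintegral_inv_norm_add_mul_rpow_le hx
  · congr 1; ext x
    rw [ENNReal.ofReal_mul (by positivity), mul_assoc]

/-- The trilinear estimate which takes the place of Ladyzhenskaya's inequality in the energy
equality. By symmetry only `|x| ≤ |y|` matters; there the product of `f x * g (x + y)` and `f y` is
split with the weight `ε |x|`, whose inverse has the integral `2 π |y| / ε` over `|x| ≤ |y|`. -/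
theorem lintegral_lintegral_mul_mul_add_le {f g : Plane → ℝ≥0∞} (hf : Measurable f)
    (hg : Measurable g) {ε : ℝ≥0∞} (hε : ε ≠ 0) (hε' : ε ≠ ⊤) :
    ∫⁻ x, ∫⁻ y, f x * f y * g (x + y) ≤
      (∫⁻ x, ENNReal.ofReal ‖x‖ * f x ^ 2) *
        (ε * (∫⁻ x, g x ^ 2) + ENNReal.ofReal (2 * Real.pi) * ε⁻¹) := by
  obtain ⟨S, hSm, hS1, hS0⟩ : ∃ S : Plane → Plane → ℝ≥0∞,
      Measurable (fun q : Plane × Plane => S q.1 q.2) ∧ (∀ x y, ‖x‖ ≤ ‖y‖ → S x y = 1) ∧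
        ∀ x y, ¬ ‖x‖ ≤ ‖y‖ → S x y = 0 :=
    ⟨fun x y => {q : Plane × Plane | ‖q.1‖ ≤ ‖q.2‖}.indicator 1 (x, y),
      measurable_one.indicator (measurableSet_le (by fun_prop) (by fun_prop)),
      fun x y h => by simp [h], fun x y h => by simp [h]⟩
  have hSy : ∀ x, Measurable (S x) := fun x => hSm.comp measurable_prodMk_left
  have hm0 : Measurable fun q : Plane × Plane => S q.1 q.2 * (f q.1 * f q.2 * g (q.1 + q.2)) :=
    hSm.mul (by fun_prop)
  have hm1 : Measurable fun q : Plane × Plane =>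
      S q.1 q.2 * (f q.2 ^ 2 * (ENNReal.ofReal ‖q.1‖ * ε)⁻¹) :=
    hSm.mul (by fun_prop)
  have hm2 : Measurable fun q : Plane × Plane =>
      (f q.1 * g (q.1 + q.2)) ^ 2 * (ENNReal.ofReal ‖q.1‖ * ε) := by fun_prop
  set I : ℝ≥0∞ := ∫⁻ x, ∫⁻ y, S x y * (f x * f y * g (x + y)) with hI
  have hle : ∫⁻ x, ∫⁻ y, f x * f y * g (x + y) ≤ I + I := by
    have hswap : I = ∫⁻ x, ∫⁻ y, S y x * (f x * f y * g (x + y)) := by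
      rw [hI, lintegral_lintegral_swap]
      · congr 1; ext x; congr 1; ext y
        rw [mul_comm (f y), add_comm]
      · exact hm0.aemeasurable
    have hx : ∀ x, Measurable fun y => S x y * (f x * f y * g (x + y)) := fun x =>
      hm0.comp measurable_prodMk_left
    have : I + I = ∫⁻ x, ∫⁻ y, (S x y * (f x * f y * g (x + y)) + S y x * (f x * f y * g (x + y))) := by
      simp_rw [lintegral_add_left (hx _)]
      rw [lintegral_add_left hm0.lintegral_prod_right', ← hswap]
    rw [this]
    refine lintegral_mono fun x => lintegral_mono fun y => ?_
    rcases le_total ‖x‖ ‖y‖ with h | h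
    · have : S x y = 1 := hS1 _ _ h
      simp only [this, one_mul]
      exact le_self_add
    · have : S y x = 1 := hS1 _ _ h
      simp only [this, one_mul]
      exact le_add_self
  have hII : I + I ≤ (∫⁻ x, ∫⁻ y, (f x * g (x + y)) ^ 2 * (ENNReal.ofReal ‖x‖ * ε)) +
      ∫⁻ x, ∫⁻ y, S x y * (f y ^ 2 * (ENNReal.ofReal ‖x‖ * ε)⁻¹) := by
    rw [← lintegral_add_left hm2.lintegral_prod_right', ← two_mul, hI,
      ← lintegral_const_mul' _ _ (by simp)]
    refine lintegral_mono_ae ?_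
    filter_upwards [ae_norm_pos] with x hx
    rw [← lintegral_const_mul' _ _ (by simp), ← lintegral_add_left (by fun_prop)]
    refine lintegral_mono fun y => ?_
    by_cases h : ‖x‖ ≤ ‖y‖
    · have : S x y = 1 := hS1 _ _ h
      rw [this, one_mul, one_mul]
      have := two_mul_mul_le_sq_mul_add_sq_mul_inv (f x * g (x + y)) (f y)
        (t := ENNReal.ofReal ‖x‖ * ε) (mul_ne_zero (ENNReal.ofReal_pos.2 hx).ne' hε)
        (ENNReal.mul_ne_top ENNReal.ofReal_ne_top hε')
      calc 2 * (f x * f y * g (x + y)) = 2 * (f x * g (x + y) * f y) := by ring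
        _ ≤ _ := this
    · have : S x y = 0 := hS0 _ _ h
      simp [this]
  have h1 : ∫⁻ x, ∫⁻ y, (f x * g (x + y)) ^ 2 * (ENNReal.ofReal ‖x‖ * ε) =
      (∫⁻ x, ENNReal.ofReal ‖x‖ * f x ^ 2) * (ε * ∫⁻ x, g x ^ 2) := by
    rw [← lintegral_mul_const _ (by fun_prop)]
    congr 1; ext x
    calc ∫⁻ y, (f x * g (x + y)) ^ 2 * (ENNReal.ofReal ‖x‖ * ε)
        = ∫⁻ y, (ENNReal.ofReal ‖x‖ * f x ^ 2 * ε) * g (x + y) ^ 2 := by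
          congr 1; ext y; ring
      _ = (ENNReal.ofReal ‖x‖ * f x ^ 2 * ε) * ∫⁻ y, g (x + y) ^ 2 :=
          lintegral_const_mul _ (by fun_prop)
      _ = _ := by
          rw [lintegral_add_left_eq_self (fun y => g y ^ 2) x]
          ring
  have h2 : ∫⁻ x, ∫⁻ y, S x y * (f y ^ 2 * (ENNReal.ofReal ‖x‖ * ε)⁻¹) ≤
      (∫⁻ x, ENNReal.ofReal ‖x‖ * f x ^ 2) * (ENNReal.ofReal (2 * Real.pi) * ε⁻¹) := by
    rw [lintegral_lintegral_swap hm1.aemeasurable,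
      ← lintegral_mul_const _ (by fun_prop)]
    refine lintegral_mono_ae ?_
    filter_upwards [ae_norm_pos] with y hy
    have hb : MeasurableSet {x : Plane | ‖x‖ ≤ ‖y‖} := measurableSet_le (by fun_prop) (by fun_prop)
    calc ∫⁻ x, S x y * (f y ^ 2 * (ENNReal.ofReal ‖x‖ * ε)⁻¹)
        = ∫⁻ x, (f y ^ 2 * ε⁻¹) *
            {x : Plane | ‖x‖ ≤ ‖y‖}.indicator (fun x => ENNReal.ofReal (‖x‖ ^ (-1 : ℝ))) x := by
          refine lintegral_congr_ae ?_
          filter_upwards [ae_norm_pos] with x hx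
          by_cases h : ‖x‖ ≤ ‖y‖
          · have : S x y = 1 := hS1 _ _ h
            rw [this, one_mul, ENNReal.mul_inv (Or.inr hε') (Or.inr hε),
              indicator_of_mem (show x ∈ {x : Plane | ‖x‖ ≤ ‖y‖} from h),
              Real.rpow_neg_one, ENNReal.ofReal_inv_of_pos hx]
            ring
          · have : S x y = 0 := hS0 _ _ h
            simp [this, h]
      _ = (f y ^ 2 * ε⁻¹) * ENNReal.ofReal (2 * Real.pi * (‖y‖ ^ (2 - 1 : ℝ) / (2 - 1))) := by
          rw [lintegral_const_mul _ ((by fun_prop : Measurable fun x : Plane =>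
              ENNReal.ofReal (‖x‖ ^ (-1 : ℝ))).indicator hb), lintegral_indicator hb,
            lintegral_norm_le_rpow (by norm_num) hy]
      _ ≤ _ := by
          rw [show (2 : ℝ) - 1 = 1 by norm_num, Real.rpow_one, div_one,
            ENNReal.ofReal_mul (p := 2 * Real.pi) (by positivity)]
          apply le_of_eq
          ring
  calc _ ≤ I + I := hle
    _ ≤ _ := hII
    _ ≤ _ := by
      rw [h1, mul_add]
      gcongr

/-! ### Superposition of decreasing profiles -/

/-- The superposition estimate when the left-hand side is known to be
finite, so that a half of it can be absorbed. -/
theorem sq_lintegral_superposition_le_of_ne_top {F : ℝ → ℝ → ℝ≥0∞} {D : ℝ → ℝ≥0∞}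
    (hF : Measurable (Function.uncurry F)) (h0 : ∀ s t, t ≤ s → F s t = 0)
    (hanti : ∀ s r t, s < r → r ≤ t → F s t ≤ F s r) (hint : ∀ᵐ s, ∫⁻ t, F s t ≤ D s)
    (hfin : ∫⁻ t, (∫⁻ s, F s t) ^ 2 ≠ ⊤) :
    ∫⁻ t, (∫⁻ s, F s t) ^ 2 ≤ 4 * ∫⁻ s, D s ^ 2 := by
  set W : ℝ → ℝ≥0∞ := fun t => ∫⁻ s, F s t with hW
  have hFm : Measurable fun q : ℝ × ℝ => F q.1 q.2 := hF
  have hFl : ∀ t, Measurable fun s => F s t := fun t => hFm.comp measurable_prodMk_right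
  have hFr : ∀ r, Measurable fun t => F r t := fun r => hFm.comp measurable_prodMk_left
  have hWm : Measurable W := hFm.lintegral_prod_left'
  have hsq : ∀ t, W t ^ 2 ≤ 2 * ∫⁻ r, F r t * W r := by
    intro t
    have hG : Measurable fun q : ℝ × ℝ => F q.1 t * (Iic q.1).indicator (fun s => F s t) q.2 := by
      have hset : MeasurableSet {q : ℝ × ℝ | q.2 ≤ q.1} :=
        measurableSet_le (by fun_prop) (by fun_prop)
      have : (fun q : ℝ × ℝ => (Iic q.1).indicator (fun s => F s t) q.2) =
          {q : ℝ × ℝ | q.2 ≤ q.1}.indicator fun q => F q.2 t := by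
        ext q; simp [indicator]
      refine ((hFl t).comp measurable_fst).mul ?_
      rw [this]
      exact ((hFl t).comp measurable_snd).indicator hset
    set I : ℝ≥0∞ := ∫⁻ r, ∫⁻ s, F r t * (Iic r).indicator (fun s => F s t) s with hI
    have h1 : W t ^ 2 ≤ I + I := by
      have hsw : I = ∫⁻ r, ∫⁻ s, F s t * (Iic s).indicator (fun s => F s t) r := by
        rw [hI, lintegral_lintegral_swap hG.aemeasurable]
      calc W t ^ 2 = ∫⁻ r, ∫⁻ s, F r t * F s t := by
            simp_rw [lintegral_const_mul _ (hFl t)]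
            rw [lintegral_mul_const _ (hFl t), sq]
        _ ≤ ∫⁻ r, ∫⁻ s, (F r t * (Iic r).indicator (fun s => F s t) s +
              F s t * (Iic s).indicator (fun s => F s t) r) := by
            refine lintegral_mono fun r => lintegral_mono fun s => ?_
            rcases le_total s r with h | h
            · simp [h]
            · simp [h, mul_comm]
        _ = I + I := by
            have hx : ∀ r, Measurable fun s => F r t * (Iic r).indicator (fun s => F s t) s :=
              fun r => hG.comp measurable_prodMk_left
            simp_rw [lintegral_add_left (hx _)]
            rw [lintegral_add_left hG.lintegral_prod_right', ← hsw]
    have h2 : I ≤ ∫⁻ r, F r t * W r := by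
      refine lintegral_mono fun r => ?_
      rw [lintegral_const_mul _ ((hFl t).indicator measurableSet_Iic)]
      rcases le_or_gt t r with h | h
      · simp [h0 r t h]
      · gcongr
        refine lintegral_mono_ae ?_
        filter_upwards [Measure.ae_ne volume r] with s hs
        by_cases hsr : s ≤ r
        · simpa [hsr] using hanti s r t (lt_of_le_of_ne hsr hs) h.le
        · simp [hsr]
    calc W t ^ 2 ≤ I + I := h1
      _ = 2 * I := (two_mul I).symm
      _ ≤ _ := by gcongr
  set X : ℝ≥0∞ := ∫⁻ t, W t ^ 2 with hX
  have key : X ≤ X / 2 + 2 * ∫⁻ s, D s ^ 2 := by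
    calc X ≤ ∫⁻ t, 2 * ∫⁻ r, F r t * W r := lintegral_mono hsq
      _ = 2 * ∫⁻ r, ∫⁻ t, F r t * W r := by
          rw [lintegral_const_mul' _ _ (by simp), lintegral_lintegral_swap]
          exact Measurable.aemeasurable ((hFm.comp measurable_swap).mul (hWm.comp measurable_snd))
      _ = ∫⁻ r, 2 * (W r * ∫⁻ t, F r t) := by
          rw [← lintegral_const_mul' _ _ (by simp)]
          congr 1; ext r
          rw [lintegral_mul_const _ (hFr r), mul_comm (W r)]
      _ ≤ ∫⁻ r, (W r ^ 2 * 2⁻¹ + D r ^ 2 * 2) := by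
          refine lintegral_mono_ae ?_
          filter_upwards [hint] with r hr
          have := two_mul_mul_le_sq_mul_add_sq_mul_inv (W r) (D r) (t := 2⁻¹) (by simp) (by simp)
          rw [inv_inv] at this
          refine le_trans ?_ this
          gcongr
      _ = X / 2 + 2 * ∫⁻ s, D s ^ 2 := by
          rw [lintegral_add_left (by fun_prop), lintegral_mul_const' _ _ (by simp),
            lintegral_mul_const' _ _ (by simp), mul_comm 2, div_eq_mul_inv]
  have hX2 : X / 2 ≠ ⊤ := (ENNReal.div_lt_top hfin (by simp)).ne
  have : X / 2 ≤ 2 * ∫⁻ s, D s ^ 2 := by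
    have : X / 2 + X / 2 ≤ X / 2 + 2 * ∫⁻ s, D s ^ 2 := by rwa [ENNReal.add_halves]
    exact (ENNReal.add_le_add_iff_left hX2).1 this
  calc X = X / 2 + X / 2 := (ENNReal.add_halves X).symm
    _ ≤ (2 * ∫⁻ s, D s ^ 2) + 2 * ∫⁻ s, D s ^ 2 := add_le_add this this
    _ = _ := by rw [← two_mul, ← mul_assoc]; norm_num

/-- A superposition `W t = ∫ F s t ds` of profiles `F s`, each supported on `(s, ∞)` and
nonincreasing there, is bounded in `L²` by twice the norm of the masses `s ↦ ∫ F s t dt`.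
Indeed `∫ W² = 2 ∬ ∫ F s t F r t` over `s < r < t`, and there `F s t ≤ F s r`, so that
`∫ W² ≤ 2 ∫ W D`. -/
theorem sq_lintegral_superposition_le {F : ℝ → ℝ → ℝ≥0∞} {D : ℝ → ℝ≥0∞} {T : ℝ}
    (hF : Measurable (Function.uncurry F)) (h0 : ∀ s t, ¬ (0 < s ∧ s < t ∧ t < T) → F s t = 0)
    (hanti : ∀ s r t, s < r → r ≤ t → F s t ≤ F s r) (hint : ∀ᵐ s, ∫⁻ t, F s t ≤ D s) :
    ∫⁻ t, (∫⁻ s, F s t) ^ 2 ≤ 4 * ∫⁻ s, D s ^ 2 := by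
  have hFm : Measurable fun q : ℝ × ℝ => F q.1 q.2 := hF
  have hFl : ∀ t, Measurable fun s => F s t := fun t => hFm.comp measurable_prodMk_right
  -- the truncations have a finite norm, which the absorption argument needs
  have hn : ∀ n : ℕ, ∫⁻ t, (∫⁻ s, min (F s t) n) ^ 2 ≤ 4 * ∫⁻ s, D s ^ 2 := by
    intro n
    refine sq_lintegral_superposition_le_of_ne_top (F := fun s t => min (F s t) n)
      (Measurable.min hFm measurable_const) (fun s t h => ?_) (fun s r t h1 h2 => ?_) ?_ ?_
    · rw [h0 s t (fun h' => absurd h'.2.1 (not_lt.2 h))]; simp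
    · exact min_le_min_right _ (hanti s r t h1 h2)
    · filter_upwards [hint] with s hs
      exact (lintegral_mono fun t => min_le_left _ _).trans hs
    · have hb : ∀ t, (∫⁻ s, min (F s t) (n : ℝ≥0∞)) ^ 2 ≤
          (Ioo 0 T).indicator (fun _ => ((n : ℝ≥0∞) * ENNReal.ofReal T) ^ 2) t := by
        intro t
        by_cases ht : t ∈ Ioo 0 T
        · rw [indicator_of_mem ht]
          gcongr
          calc ∫⁻ s, min (F s t) (n : ℝ≥0∞) ≤ ∫⁻ s, (Ioo 0 T).indicator (fun _ => (n : ℝ≥0∞)) s := by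
                refine lintegral_mono fun s => ?_
                by_cases hs : s ∈ Ioo 0 T
                · simp [hs]
                · rw [h0 s t fun h => hs ⟨h.1, h.2.1.trans h.2.2⟩]; simp
            _ = _ := by
                rw [lintegral_indicator measurableSet_Ioo]; simp
        · have : ∀ s, F s t = 0 := fun s => h0 s t fun h => ht ⟨h.1.trans h.2.1, h.2.2⟩
          simp [this]
      refine ne_top_of_le_ne_top ?_ (lintegral_mono hb)
      rw [lintegral_indicator measurableSet_Ioo]
      simp [ENNReal.mul_eq_top]
  have hpt : ∀ a : ℝ≥0∞, Filter.Tendsto (fun n : ℕ => min a (n : ℝ≥0∞)) Filter.atTop (nhds a) := by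
    intro a
    have := (tendsto_const_nhds (x := a)).min ENNReal.tendsto_nat_nhds_top
    simpa using this
  have hmono : ∀ a : ℝ≥0∞, Monotone fun n : ℕ => min a (n : ℝ≥0∞) := fun a n k h =>
    min_le_min_left _ (by exact_mod_cast h)
  have hlim : ∀ t, Filter.Tendsto (fun n : ℕ => ∫⁻ s, min (F s t) (n : ℝ≥0∞)) Filter.atTop
      (nhds (∫⁻ s, F s t)) := fun t =>
    lintegral_tendsto_of_tendsto_of_monotone
      (fun n => ((hFl t).min measurable_const).aemeasurable)
      (Filter.Eventually.of_forall fun s => hmono _) (Filter.Eventually.of_forall fun s => hpt _)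
  refine le_of_tendsto' (lintegral_tendsto_of_tendsto_of_monotone (fun n => ?_)
    (Filter.Eventually.of_forall fun t n k h => ?_)
    (Filter.Eventually.of_forall fun t => ENNReal.Tendsto.pow (hlim t))) hn
  · exact ((Measurable.lintegral_prod_left'
      (hFm.min (measurable_const (a := (n : ℝ≥0∞))))).pow_const 2).aemeasurable
  · exact pow_le_pow_left' (lintegral_mono fun s => hmono _ h) 2

/-! ### The Fourier transform of square integrable fields -/

/-- A real Schwartz function, regarded as a complex one. -/
noncomputable def complexify (φ : 𝓢(Plane, ℝ)) : 𝓢(Plane, ℂ) :=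
  SchwartzMap.postcompCLM (𝕜 := ℝ) Complex.ofRealCLM φ

@[simp]
theorem complexify_apply (φ : 𝓢(Plane, ℝ)) (x : Plane) : complexify φ x = (φ x : ℂ) := rfl

theorem complexify_lineDeriv (φ : 𝓢(Plane, ℝ)) (v : Plane) :
    complexify (∂_{v} φ) = (∂_{v} (complexify φ) : 𝓢(Plane, ℂ)) := by
  ext x
  rw [complexify_apply, SchwartzMap.lineDerivOp_apply_eq_fderiv,
    SchwartzMap.lineDerivOp_apply_eq_fderiv,
    show ⇑(complexify φ) = Complex.ofRealCLM ∘ φ from rfl,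
    fderiv_comp _ (by fun_prop) φ.differentiableAt, ContinuousLinearMap.fderiv]
  simp

theorem fourierInv_lineDeriv_apply (f : 𝓢(Plane, ℂ)) (v ξ : Plane) :
    (𝓕⁻ (∂_{v} f : 𝓢(Plane, ℂ)) : 𝓢(Plane, ℂ)) ξ =
      -(2 * Real.pi * Complex.I) * ((inner ℝ ξ v : ℝ) : ℂ) * (𝓕⁻ f : 𝓢(Plane, ℂ)) ξ := by
  have : (inner ℝ · v : Plane → ℝ).HasTemperateGrowth := by fun_prop
  rw [SchwartzMap.fourierInv_lineDerivOp_eq]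
  simp [this]
  ring

/-- The inverse Fourier transform of a real test function. -/
noncomputable def invFourier (φ : 𝓢(Plane, ℝ)) : 𝓢(Plane, ℂ) := 𝓕⁻ (complexify φ)

theorem inner_e (ξ : Plane) (j : Fin 2) : (inner ℝ ξ (e j) : ℝ) = ξ j := by
  simp [e, PiLp.inner_apply]

theorem invFourier_lineDeriv_apply (φ : 𝓢(Plane, ℝ)) (j : Fin 2) (ξ : Plane) :
    invFourier (∂_{e j} φ) ξ = -(2 * Real.pi * Complex.I) * (ξ j : ℂ) * invFourier φ ξ := by
  rw [invFourier, complexify_lineDeriv, fourierInv_lineDeriv_apply, inner_e]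
  rfl

/-- Every complex test function is a complex combination of inverse Fourier transforms of real
ones. -/
theorem exists_eq_invFourier_add (ψ : 𝓢(Plane, ℂ)) :
    ∃ φ₁ φ₂ : 𝓢(Plane, ℝ), ∀ ξ, ψ ξ = invFourier φ₁ ξ + Complex.I * invFourier φ₂ ξ := by
  refine ⟨SchwartzMap.postcompCLM (𝕜 := ℝ) Complex.reCLM (𝓕 ψ),
    SchwartzMap.postcompCLM (𝕜 := ℝ) Complex.imCLM (𝓕 ψ), fun ξ => ?_⟩
  have h : 𝓕 ψ = complexify (SchwartzMap.postcompCLM (𝕜 := ℝ) Complex.reCLM (𝓕 ψ)) +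
      Complex.I • complexify (SchwartzMap.postcompCLM (𝕜 := ℝ) Complex.imCLM (𝓕 ψ)) := by
    ext x
    simp [SchwartzMap.postcompCLM_apply, mul_comm Complex.I, Complex.re_add_im]
  have h2 : ψ = 𝓕⁻ (𝓕 ψ) := (FourierTransform.fourierInv_fourier_eq ψ).symm
  conv_lhs => rw [h2, h]
  rw [FourierTransform.fourierInv_add, FourierTransform.fourierInv_smul]
  rfl

theorem memLp_schwartz (φ : 𝓢(Plane, ℂ)) : MemLp φ 2 (volume : Measure Plane) := φ.memLp 2

/-- Duality formula characterising the Fourier transform of a square integrable function. -/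
theorem integral_mul_eq_integral_fourierInv_mul (f : Lp (α := Plane) ℂ 2 volume) (φ : 𝓢(Plane, ℂ)) :
    ∫ x, φ x * f x = ∫ ξ, (𝓕⁻ φ : 𝓢(Plane, ℂ)) ξ * (𝓕 f : Lp (α := Plane) ℂ 2 volume) ξ := by
  have h := congrArg (fun D => D (𝓕⁻ φ)) (Lp.fourier_toTemperedDistribution_eq f)
  simpa [TemperedDistribution.fourier_apply] using h

theorem memLp_apply {m : ℕ} (f : L2Vel m) (k : Fin (2 + m)) :
    MemLp (fun x => f x k) 2 (volume : Measure Plane) :=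
  (Lp.memLp f).of_le (((EuclideanSpace.proj k : Vel m →L[ℝ] ℝ).continuous.comp_aestronglyMeasurable
    (Lp.aestronglyMeasurable f))) (Filter.Eventually.of_forall fun x => PiLp.norm_apply_le (f x) k)

theorem memLp_apply_complex {m : ℕ} (f : Lp (α := Plane) (VelC m) 2 volume) (k : Fin (2 + m)) :
    MemLp (fun x => f x k) 2 (volume : Measure Plane) :=
  (Lp.memLp f).of_le (((EuclideanSpace.proj k : VelC m →L[ℂ] ℂ).continuous.comp_aestronglyMeasurable
    (Lp.aestronglyMeasurable f))) (Filter.Eventually.of_forall fun x => PiLp.norm_apply_le (f x) k)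

theorem memLp_ofReal_apply {m : ℕ} (f : L2Vel m) (k : Fin (2 + m)) :
    MemLp (fun x => (f x k : ℂ)) 2 (volume : Measure Plane) := (memLp_apply f k).ofReal

/-- Componentwise duality formula for the Fourier transform of a velocity field. -/
theorem integral_mul_apply_eq {m : ℕ} (f : L2Vel m) (k : Fin (2 + m)) (φ : 𝓢(Plane, ℂ)) :
    ∫ x, φ x * (f x k : ℂ) = ∫ ξ, (𝓕⁻ φ : 𝓢(Plane, ℂ)) ξ * fourierL2 f ξ k := by
  have h := congrArg (fun D => D (𝓕⁻ φ))
    (Lp.fourier_toTemperedDistribution_eq ((toComplex m).compLp f))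
  have h1 : ∫ x, φ x • ((toComplex m).compLp f) x =
      ∫ ξ, (𝓕⁻ φ : 𝓢(Plane, ℂ)) ξ • (fourierL2 f) ξ := by
    simpa [TemperedDistribution.fourier_apply, fourierL2] using h
  have hi : ∀ (ψ : 𝓢(Plane, ℂ)) (g : Lp (α := Plane) (VelC m) 2 volume),
      Integrable fun x => ψ x • g x := fun ψ g =>
    memLp_one_iff_integrable.1 ((Lp.memLp g).smul (memLp_schwartz ψ))
  have h2 := congrArg (EuclideanSpace.proj k : VelC m →L[ℂ] ℂ) h1
  rw [← ContinuousLinearMap.integral_comp_comm _ (hi _ _),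
    ← ContinuousLinearMap.integral_comp_comm _ (hi _ _)] at h2
  refine Eq.trans (integral_congr_ae ?_) h2
  filter_upwards [ContinuousLinearMap.coeFn_compLp (toComplex m) f] with x hx
  rw [hx]
  simp [toComplex]

theorem ofReal_integral_apply_mul_eq {m : ℕ} (f : L2Vel m) (k : Fin (2 + m)) (φ : 𝓢(Plane, ℝ)) :
    ((∫ x, f x k * φ x : ℝ) : ℂ) = ∫ ξ, invFourier φ ξ * fourierL2 f ξ k := by
  rw [invFourier, ← integral_mul_apply_eq, ← integral_complex_ofReal]
  congr 1; ext x; simp [mul_comm]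

/-- A function which integrates to zero against the inverse Fourier transforms of all real
Schwartz functions vanishes almost everywhere. -/
theorem ae_eq_zero_of_integral_invFourier {K : Plane → ℂ} (hK : LocallyIntegrable K)
    (hi : ∀ ψ : 𝓢(Plane, ℂ), Integrable fun ξ => ψ ξ * K ξ)
    (h : ∀ φ : 𝓢(Plane, ℝ), ∫ ξ, invFourier φ ξ * K ξ = 0) : ∀ᵐ ξ, K ξ = 0 := by
  refine ae_eq_zero_of_integral_contDiff_smul_eq_zero hK fun g hg hgc => ?_
  have hg1 : HasCompactSupport (Complex.ofRealCLM ∘ g) := hgc.comp_left rfl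
  have hg2 : ContDiff ℝ ∞ (Complex.ofRealCLM ∘ g) := by fun_prop
  obtain ⟨φ₁, φ₂, hφ⟩ := exists_eq_invFourier_add (hg1.toSchwartzMap hg2)
  have : ∀ ξ, g ξ • K ξ = invFourier φ₁ ξ * K ξ + Complex.I * (invFourier φ₂ ξ * K ξ) := by
    intro ξ
    have h1 : (hg1.toSchwartzMap hg2) ξ = (g ξ : ℂ) := rfl
    rw [Complex.real_smul, ← h1, hφ]
    ring
  simp_rw [this]
  rw [integral_add (hi _) ((hi _).const_mul _), integral_const_mul, h, h]
  simp

theorem memLp_coord_mul_schwartz (ψ : 𝓢(Plane, ℂ)) (j : Fin 2) :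
    MemLp (fun ξ : Plane => (ξ j : ℂ) * ψ ξ) 2 := by
  have h : (fun ξ : Plane => ((ξ j : ℝ) : ℂ)).HasTemperateGrowth := by
    have : (fun ξ : Plane => ((ξ j : ℝ) : ℂ)) =
      (Complex.ofRealCLM ∘L (EuclideanSpace.proj j : Plane →L[ℝ] ℝ)) := by ext; simp
    rw [this]
    exact ContinuousLinearMap.hasTemperateGrowth _
  have := memLp_schwartz (SchwartzMap.smulLeftCLM ℂ (fun ξ : Plane => ((ξ j : ℝ) : ℂ)) ψ)
  refine this.congr_norm ?_ ?_
  · exact Measurable.aestronglyMeasurable (by fun_prop)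
  · exact Filter.Eventually.of_forall fun ξ => by
      rw [SchwartzMap.smulLeftCLM_apply_apply h]; rfl

/-- Uniqueness: the Fourier transform of a component, as an element of scalar `L²`. -/
theorem fourier_toLp_apply_ae_eq {m : ℕ} (f : L2Vel m) (k : Fin (2 + m)) :
    (𝓕 ((memLp_ofReal_apply f k).toLp _) : Lp (α := Plane) ℂ 2 volume) =ᵐ[volume]
      fun ξ => fourierL2 f ξ k := by
  set g : Lp (α := Plane) ℂ 2 volume := 𝓕 ((memLp_ofReal_apply f k).toLp _) with hg
  have hG := memLp_apply_complex (fourierL2 f) k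
  have hg2 := Lp.memLp g
  have hi : ∀ ψ : 𝓢(Plane, ℂ), Integrable fun ξ => ψ ξ * (g ξ - fourierL2 f ξ k) := fun ψ =>
    MemLp.integrable_mul (memLp_schwartz ψ) (hg2.sub hG)
  have := ae_eq_zero_of_integral_invFourier
    ((hg2.sub hG).locallyIntegrable (by norm_num)) hi fun φ => ?_
  · filter_upwards [this] with ξ hξ
    exact sub_eq_zero.1 hξ
  · have i1 : Integrable fun ξ => invFourier φ ξ * g ξ :=
      MemLp.integrable_mul (memLp_schwartz _) hg2
    have i2 : Integrable fun ξ => invFourier φ ξ * fourierL2 f ξ k :=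
      MemLp.integrable_mul (memLp_schwartz _) hG
    simp only [Pi.sub_apply, mul_sub]
    rw [integral_sub i1 i2, sub_eq_zero, hg, invFourier, ← integral_mul_eq_integral_fourierInv_mul,
      ← integral_mul_apply_eq]
    refine integral_congr_ae ?_
    filter_upwards [(memLp_ofReal_apply f k).coeFn_toLp] with x hx
    rw [hx]

/-- The correlation `η ↦ ∫ ψ (η + ζ) G ζ dζ` of a Schwartz function with a square integrable
function is square integrable. -/
theorem memLp_correlation (ψ : 𝓢(Plane, ℂ)) {G : Plane → ℂ} (hG : MemLp G 2) :
    MemLp (fun η => ∫ ζ, ψ (η + ζ) * G ζ) 2 := by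
  have hmeas : AEStronglyMeasurable (fun η => ∫ ζ, ψ (η + ζ) * G ζ) := by
    refine AEStronglyMeasurable.integral_prod_right' (f := fun q : Plane × Plane => ψ (q.1 + q.2) * G q.2) ?_
    exact (Continuous.aestronglyMeasurable (by fun_prop)).mul hG.1.comp_snd
  refine ⟨hmeas, ?_⟩
  rw [eLpNorm_lt_top_iff_lintegral_rpow_enorm_lt_top (by norm_num) (by norm_num)]
  have hGl : ∫⁻ ζ, ‖G ζ‖ₑ ^ 2 < ⊤ := by
    have := (eLpNorm_lt_top_iff_lintegral_rpow_enorm_lt_top (by norm_num) (by norm_num)).1 hG.2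
    simpa using this
  have hψ : ∫⁻ ζ, ‖ψ ζ‖ₑ < ⊤ := ψ.integrable.2
  have hmψ : Measurable fun ζ => ‖ψ ζ‖ₑ := ψ.continuous.measurable.enorm
  have hb : ∀ η, ‖∫ ζ, ψ (η + ζ) * G ζ‖ₑ ^ 2 ≤
      (∫⁻ ζ, ‖ψ ζ‖ₑ) * ∫⁻ ζ, ‖ψ (η + ζ)‖ₑ * ‖G ζ‖ₑ ^ 2 := by
    intro η
    have hm1 : Measurable fun ζ => ‖ψ (η + ζ)‖ₑ := hmψ.comp (by fun_prop)
    have hhalf : ∀ c : ℝ≥0∞, (c ^ (1 / 2 : ℝ)) ^ 2 = c := by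
      intro c
      rw [← ENNReal.rpow_natCast, ← ENNReal.rpow_mul]
      norm_num
    calc ‖∫ ζ, ψ (η + ζ) * G ζ‖ₑ ^ 2 ≤ (∫⁻ ζ, ‖ψ (η + ζ) * G ζ‖ₑ) ^ 2 := by
          gcongr; exact enorm_integral_le_lintegral_enorm _
      _ = (∫⁻ ζ, ‖ψ (η + ζ)‖ₑ ^ (1 / 2 : ℝ) * (‖ψ (η + ζ)‖ₑ ^ (1 / 2 : ℝ) * ‖G ζ‖ₑ)) ^ 2 := by
          congr 2; ext ζ
          rw [enorm_mul, ← mul_assoc, ← sq, hhalf]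
      _ ≤ (∫⁻ ζ, (‖ψ (η + ζ)‖ₑ ^ (1 / 2 : ℝ)) ^ 2) *
            ∫⁻ ζ, (‖ψ (η + ζ)‖ₑ ^ (1 / 2 : ℝ) * ‖G ζ‖ₑ) ^ 2 :=
          sq_lintegral_mul_le (hm1.pow_const _).aemeasurable
            ((hm1.pow_const _).aemeasurable.mul hG.1.enorm)
      _ = _ := by
          simp_rw [mul_pow, hhalf]
          rw [lintegral_add_left_eq_self (fun ζ => ‖ψ ζ‖ₑ) η]
  have : ∫⁻ η, ‖∫ ζ, ψ (η + ζ) * G ζ‖ₑ ^ 2 < ⊤ := by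
    calc _ ≤ ∫⁻ η, (∫⁻ ζ, ‖ψ ζ‖ₑ) * ∫⁻ ζ, ‖ψ (η + ζ)‖ₑ * ‖G ζ‖ₑ ^ 2 := lintegral_mono hb
      _ = (∫⁻ ζ, ‖ψ ζ‖ₑ) * ∫⁻ ζ, ∫⁻ η, ‖ψ (η + ζ)‖ₑ * ‖G ζ‖ₑ ^ 2 := by
          rw [lintegral_const_mul' _ _ hψ.ne, lintegral_lintegral_swap]
          have h1 : Measurable fun q : Plane × Plane => ‖ψ (q.1 + q.2)‖ₑ := hmψ.comp (by fun_prop)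
          exact h1.aemeasurable.mul ((hG.1.enorm.pow_const 2).comp_snd)
      _ = (∫⁻ ζ, ‖ψ ζ‖ₑ) * ∫⁻ ζ, (∫⁻ η, ‖ψ η‖ₑ) * ‖G ζ‖ₑ ^ 2 := by
          congr 2; ext ζ
          have h1 : Measurable fun η => ‖ψ (η + ζ)‖ₑ := hmψ.comp (by fun_prop)
          rw [lintegral_mul_const _ h1, lintegral_add_right_eq_self (fun η => ‖ψ η‖ₑ) ζ]
      _ = (∫⁻ ζ, ‖ψ ζ‖ₑ) * ((∫⁻ ζ, ‖ψ ζ‖ₑ) * ∫⁻ ζ, ‖G ζ‖ₑ ^ 2) := by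
          rw [lintegral_const_mul' _ _ hψ.ne]
      _ < ⊤ := ENNReal.mul_lt_top hψ (ENNReal.mul_lt_top hψ hGl)
  simpa using this

theorem fourierInv_mul_apply (s φ : 𝓢(Plane, ℂ)) (ζ : Plane) :
    (𝓕⁻ (SchwartzMap.pairing (ContinuousLinearMap.mul ℂ ℂ) s φ) : 𝓢(Plane, ℂ)) ζ =
      ∫ η, (𝓕 s : 𝓢(Plane, ℂ)) η * (𝓕⁻ φ : 𝓢(Plane, ℂ)) (η + ζ) := by
  have h1 : SchwartzMap.pairing (ContinuousLinearMap.mul ℂ ℂ) s φ =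
      𝓕 (SchwartzMap.convolution (ContinuousLinearMap.mul ℂ ℂ) (𝓕⁻ s) (𝓕⁻ φ)) := by
    rw [SchwartzMap.fourier_convolution, FourierTransform.fourier_fourierInv_eq,
      FourierTransform.fourier_fourierInv_eq]
  rw [h1, FourierTransform.fourierInv_fourier_eq, SchwartzMap.convolution_apply, convolution_def,
    ← integral_neg_eq_self]
  congr 1; ext η
  have : (𝓕⁻ s : 𝓢(Plane, ℂ)) (-η) = (𝓕 s : 𝓢(Plane, ℂ)) η := by
    rw [SchwartzMap.fourierInv_apply_eq]; simp
  simp [this, add_comm]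

/-- Absolute integrability of the trilinear expression in the convolution formula. -/
theorem integrable_mul_mul_sub {F G : Plane → ℂ} (hF : MemLp F 2) (hG : MemLp G 2)
    (ψ : 𝓢(Plane, ℂ)) :
    Integrable (fun q : Plane × Plane => ψ q.1 * (F q.2 * G (q.1 - q.2))) (volume.prod volume) := by
  have hFl : ∫⁻ ζ, ‖F ζ‖ₑ ^ 2 < ⊤ := by
    have := (eLpNorm_lt_top_iff_lintegral_rpow_enorm_lt_top (by norm_num) (by norm_num)).1 hF.2
    simpa using this
  have hGl : ∫⁻ ζ, ‖G ζ‖ₑ ^ 2 < ⊤ := by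
    have := (eLpNorm_lt_top_iff_lintegral_rpow_enorm_lt_top (by norm_num) (by norm_num)).1 hG.2
    simpa using this
  have hm : AEStronglyMeasurable (fun q : Plane × Plane => ψ q.1 * (F q.2 * G (q.1 - q.2)))
      (volume.prod volume) :=
    (Continuous.aestronglyMeasurable (by fun_prop)).mul (hF.1.comp_snd.mul
      (hG.1.comp_quasiMeasurePreserving (quasiMeasurePreserving_sub volume volume)))
  refine ⟨hm, ?_⟩
  rw [hasFiniteIntegral_iff_enorm, lintegral_prod _ hm.enorm]
  have hle : ∀ ξ, (∫⁻ η, ‖F η‖ₑ * ‖G (ξ - η)‖ₑ) ≤ (∫⁻ ζ, ‖F ζ‖ₑ ^ 2) + ∫⁻ ζ, ‖G ζ‖ₑ ^ 2 := by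
    intro ξ
    rw [← lintegral_sub_left_eq_self (fun ζ => ‖G ζ‖ₑ ^ 2) ξ, ← lintegral_add_left' (by
      exact hF.1.enorm.pow_const 2)]
    refine lintegral_mono fun η => ?_
    have := two_mul_mul_le_sq_mul_add_sq_mul_inv ‖F η‖ₑ ‖G (ξ - η)‖ₑ (t := 1) (by simp) (by simp)
    simp only [mul_one, inv_one] at this
    refine le_trans ?_ this
    rw [two_mul]
    exact le_self_add
  calc ∫⁻ ξ, ∫⁻ η, ‖ψ ξ * (F η * G (ξ - η))‖ₑ
      = ∫⁻ ξ, ‖ψ ξ‖ₑ * ∫⁻ η, ‖F η‖ₑ * ‖G (ξ - η)‖ₑ := by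
        congr 1; ext ξ
        simp_rw [enorm_mul]
        rw [lintegral_const_mul' _ _ (by simp)]
    _ ≤ ∫⁻ ξ, ‖ψ ξ‖ₑ * ((∫⁻ ζ, ‖F ζ‖ₑ ^ 2) + ∫⁻ ζ, ‖G ζ‖ₑ ^ 2) := by
        refine lintegral_mono fun ξ => ?_
        gcongr
        exact hle ξ
    _ = (∫⁻ ξ, ‖ψ ξ‖ₑ) * ((∫⁻ ζ, ‖F ζ‖ₑ ^ 2) + ∫⁻ ζ, ‖G ζ‖ₑ ^ 2) :=
        lintegral_mul_const _ ψ.continuous.measurable.enorm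
    _ < ⊤ := ENNReal.mul_lt_top ψ.integrable.2 (ENNReal.add_lt_top.2 ⟨hFl, hGl⟩)

/-- The same with the substitution `ξ = η + ζ`. -/
theorem integrable_mul_mul_add {F G : Plane → ℂ} (hF : MemLp F 2) (hG : MemLp G 2)
    (ψ : 𝓢(Plane, ℂ)) :
    Integrable (fun q : Plane × Plane => F q.1 * (ψ (q.1 + q.2) * G q.2)) (volume.prod volume) := by
  have h := (integrable_mul_mul_sub hF hG ψ).swap
  have mp : MeasurePreserving (fun q : Plane × Plane => (q.1, q.1 + q.2)) (volume.prod volume)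
      (volume.prod volume) := measurePreserving_prod_add volume volume
  have h2 := mp.integrable_comp_of_integrable h
  refine h2.congr (Filter.Eventually.of_forall fun q => ?_)
  simp only [Function.comp, Prod.swap]
  rw [add_sub_cancel_left]
  ring

/-- The Fourier transform turns products into convolutions, in the sense of duality. -/
theorem integral_mul_mul_eq_integral_convolution (f : Lp (α := Plane) ℂ 2 volume) {g G : Plane → ℂ}
    (hg : MemLp g 2) (hG : MemLp G 2)
    (hpair : ∀ φ : 𝓢(Plane, ℂ), ∫ x, φ x * g x = ∫ ξ, (𝓕⁻ φ : 𝓢(Plane, ℂ)) ξ * G ξ)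
    (φ : 𝓢(Plane, ℂ)) :
    ∫ x, φ x * (f x * g x) = ∫ ξ, (𝓕⁻ φ : 𝓢(Plane, ℂ)) ξ *
      ∫ η, (𝓕 f : Lp (α := Plane) ℂ 2 volume) η * G (ξ - η) := by
  have hgφ : MemLp (fun x => φ x * g x) 2 (volume : Measure Plane) :=
    MemLp.mul (p := ⊤) (q := 2) hg (φ.memLp_top volume)
  have hH := memLp_correlation (𝓕⁻ φ : 𝓢(Plane, ℂ)) hG
  set H : Plane → ℂ := fun η => ∫ ζ, (𝓕⁻ φ : 𝓢(Plane, ℂ)) (η + ζ) * G ζ with hHdef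
  have key : ∫ x, f x * (φ x * g x) = ∫ η, (𝓕 f : Lp (α := Plane) ℂ 2 volume) η * H η := by
    have hL : ∀ (a : Lp (α := Plane) ℂ 2 volume) (b : Plane → ℂ) (hb : MemLp b 2 volume),
        ContinuousLinearMap.lpPairing volume 2 2 (ContinuousLinearMap.mul ℂ ℂ) a (hb.toLp b) =
          ∫ x, a x * b x := by
      intro a b hb
      rw [ContinuousLinearMap.lpPairing_eq_integral]
      refine integral_congr_ae ?_
      filter_upwards [hb.coeFn_toLp] with x hx
      rw [hx]; rfl
    rw [← hL f _ hgφ, ← hL _ _ hH]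
    refine DenseRange.induction_on
      (p := fun f : Lp (α := Plane) ℂ 2 volume =>
        ContinuousLinearMap.lpPairing volume 2 2 (ContinuousLinearMap.mul ℂ ℂ) f (hgφ.toLp _) =
        ContinuousLinearMap.lpPairing volume 2 2 (ContinuousLinearMap.mul ℂ ℂ)
          (𝓕 f : Lp (α := Plane) ℂ 2 volume) (hH.toLp _))
      (SchwartzMap.denseRange_toLpCLM (p := 2) ENNReal.ofNat_ne_top) f ?_ ?_
    · refine isClosed_eq ?_ ?_
      · fun_prop
      · have : Continuous fun f : Lp (α := Plane) ℂ 2 volume => (𝓕 f : Lp (α := Plane) ℂ 2 volume) :=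
          FourierTransform.continuous_fourier
        fun_prop
    · intro s
      rw [hL, hL, SchwartzMap.toLpCLM_apply, SchwartzMap.toLp_fourier_eq]
      calc ∫ x, (s.toLp 2 volume) x * (φ x * g x)
          = ∫ x, (SchwartzMap.pairing (ContinuousLinearMap.mul ℂ ℂ) s φ) x * g x := by
            refine integral_congr_ae ?_
            filter_upwards [s.coeFn_toLp 2 volume] with x hx
            rw [hx, SchwartzMap.pairing_apply_apply]
            simp [mul_assoc]
        _ = ∫ ζ, (∫ η, (𝓕 s : 𝓢(Plane, ℂ)) η * (𝓕⁻ φ : 𝓢(Plane, ℂ)) (η + ζ)) * G ζ := by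
            rw [hpair]
            simp_rw [fourierInv_mul_apply]
        _ = ∫ ζ, ∫ η, (𝓕 s : 𝓢(Plane, ℂ)) η * ((𝓕⁻ φ : 𝓢(Plane, ℂ)) (η + ζ) * G ζ) := by
            simp_rw [← integral_mul_const, mul_assoc]
        _ = ∫ η, (𝓕 s : 𝓢(Plane, ℂ)) η * H η := by
            rw [← integral_integral_swap
              (integrable_mul_mul_add (memLp_schwartz (𝓕 s)) hG (𝓕⁻ φ))]
            simp_rw [integral_const_mul]
            rfl
        _ = _ := by
            refine integral_congr_ae ?_
            filter_upwards [(𝓕 s : 𝓢(Plane, ℂ)).coeFn_toLp 2 volume] with x hx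
            rw [hx]
  calc ∫ x, φ x * (f x * g x) = ∫ x, f x * (φ x * g x) := by
        congr 1; ext x; ring
    _ = ∫ η, (𝓕 f : Lp (α := Plane) ℂ 2 volume) η * H η := key
    _ = ∫ η, ∫ ξ, (𝓕⁻ φ : 𝓢(Plane, ℂ)) ξ *
          ((𝓕 f : Lp (α := Plane) ℂ 2 volume) η * G (ξ - η)) := by
        congr 1; ext η
        rw [hHdef, ← integral_const_mul, ← integral_sub_right_eq_self _ η]
        congr 1; ext ξ
        rw [add_sub_cancel]
        ring
    _ = _ := by
        have hi : Integrable (Function.uncurry fun η ξ : Plane => (𝓕⁻ φ : 𝓢(Plane, ℂ)) ξ *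
            ((𝓕 f : Lp (α := Plane) ℂ 2 volume) η * G (ξ - η))) (volume.prod volume) :=
          (integrable_mul_mul_sub (Lp.memLp _) hG (𝓕⁻ φ)).swap
        rw [integral_integral_swap hi]
        simp_rw [integral_const_mul]

/-- The convolution formula for two components of velocity fields. -/
theorem ofReal_integral_apply_mul_apply_mul_eq {m : ℕ} (f g : L2Vel m) (j k : Fin (2 + m))
    (φ : 𝓢(Plane, ℝ)) :
    ((∫ x, f x j * (g x k * φ x) : ℝ) : ℂ) =
      ∫ ξ, invFourier φ ξ * ∫ η, fourierL2 f η j * fourierL2 g (ξ - η) k := by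
  have h := integral_mul_mul_eq_integral_convolution ((memLp_ofReal_apply f j).toLp _)
    (memLp_ofReal_apply g k) (memLp_apply_complex (fourierL2 g) k)
    (fun φ => integral_mul_apply_eq g k φ) (complexify φ)
  rw [← integral_complex_ofReal]
  calc ∫ x, ((f x j * (g x k * φ x) : ℝ) : ℂ)
      = ∫ x, complexify φ x * ((memLp_ofReal_apply f j).toLp _ x * (g x k : ℂ)) := by
        refine integral_congr_ae ?_
        filter_upwards [(memLp_ofReal_apply f j).coeFn_toLp] with x hx
        rw [hx]
        push_cast [complexify_apply]
        ring
    _ = _ := h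
    _ = _ := by
        rw [invFourier]
        congr 1; ext ξ
        congr 1
        refine integral_congr_ae ?_
        filter_upwards [fourier_toLp_apply_ae_eq f j] with η hη
        rw [hη]

theorem integrable_schwartz_mul_apply {m : ℕ} (f : L2Vel m) (k : Fin (2 + m)) (ψ : 𝓢(Plane, ℂ)) :
    Integrable fun ξ => ψ ξ * fourierL2 f ξ k :=
  MemLp.integrable_mul (memLp_schwartz ψ) (memLp_apply_complex (fourierL2 f) k)

theorem integrable_schwartz_mul_coord_mul_apply {m : ℕ} (f : L2Vel m) (j : Fin 2)
    (k : Fin (2 + m)) (ψ : 𝓢(Plane, ℂ)) :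
    Integrable fun ξ => ψ ξ * ((ξ j : ℂ) * fourierL2 f ξ k) := by
  have : Integrable fun ξ => ((ξ j : ℂ) * ψ ξ) * fourierL2 f ξ k :=
    MemLp.integrable_mul (memLp_coord_mul_schwartz ψ j) (memLp_apply_complex (fourierL2 f) k)
  exact this.congr (Filter.Eventually.of_forall fun ξ => by ring)

theorem locallyIntegrable_coord_mul_apply {m : ℕ} (f : L2Vel m) (j : Fin 2) (k : Fin (2 + m)) :
    LocallyIntegrable fun ξ => (ξ j : ℂ) * fourierL2 f ξ k := by
  have h1 : LocallyIntegrable fun ξ => fourierL2 f ξ k :=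
    (memLp_apply_complex (fourierL2 f) k).locallyIntegrable (by norm_num)
  exact locallyIntegrableOn_univ.1
    ((locallyIntegrableOn_univ.2 h1).continuousOn_mul
      (g := fun ξ : Plane => (ξ j : ℂ)) (by fun_prop) isOpen_univ.isLocallyClosed)

theorem invFourier_neg (φ : 𝓢(Plane, ℝ)) (ξ : Plane) :
    invFourier φ (-ξ) = (starRingEnd ℂ) (invFourier φ ξ) := by
  rw [invFourier, SchwartzMap.fourierInv_coe, Real.fourierInv_eq, Real.fourierInv_eq,
    ← integral_conj]
  congr 1; ext x
  simp [Circle.smul_def, ← Circle.coe_inv_eq_conj, ← AddChar.map_neg_eq_inv]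

/-- The Fourier transform of a real field is Hermitian symmetric. -/
theorem fourierL2_neg_ae {m : ℕ} (f : L2Vel m) (k : Fin (2 + m)) :
    ∀ᵐ ξ, fourierL2 f (-ξ) k = (starRingEnd ℂ) (fourierL2 f ξ k) := by
  have hF := memLp_apply_complex (fourierL2 f) k
  have hF' : MemLp (fun ξ => (starRingEnd ℂ) (fourierL2 f (-ξ) k)) 2 := by
    have h := hF.comp_measurePreserving (Measure.measurePreserving_neg (volume : Measure Plane))
    exact h.star
  have i1 : ∀ ψ : 𝓢(Plane, ℂ), Integrable fun ξ => ψ ξ * (starRingEnd ℂ) (fourierL2 f (-ξ) k) :=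
    fun ψ => MemLp.integrable_mul (memLp_schwartz ψ) hF'
  have i2 : ∀ ψ : 𝓢(Plane, ℂ), Integrable fun ξ => ψ ξ * fourierL2 f ξ k :=
    integrable_schwartz_mul_apply f k
  have := ae_eq_zero_of_integral_invFourier
    (K := fun ξ => (starRingEnd ℂ) (fourierL2 f (-ξ) k) - fourierL2 f ξ k)
    ((hF'.sub hF).locallyIntegrable (by norm_num))
    (fun ψ => by simp only [mul_sub]; exact (i1 ψ).sub (i2 ψ)) fun φ => ?_
  · filter_upwards [this] with ξ hξ
    rw [← Complex.conj_conj (fourierL2 f (-ξ) k), sub_eq_zero.1 hξ]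
  · simp only [mul_sub]
    rw [integral_sub (i1 _) (i2 _), sub_eq_zero, ← integral_neg_eq_self]
    simp only [neg_neg, invFourier_neg, ← map_mul]
    rw [integral_conj, ← ofReal_integral_apply_mul_eq, Complex.conj_ofReal]

/-- On the Fourier side, a divergence-free field is orthogonal to the frequency. -/
theorem sum_coord_mul_fourierL2_ae {m : ℕ} {f : L2Vel m} (hf : IsDivFree f) :
    ∀ᵐ ξ : Plane, ∑ j : Fin 2, (ξ j : ℂ) * fourierL2 f ξ (Fin.castAdd m j) = 0 := by
  have i1 : ∀ (j : Fin 2) (ψ : 𝓢(Plane, ℂ)),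
      Integrable fun ξ => ψ ξ * ((ξ j : ℂ) * fourierL2 f ξ (Fin.castAdd m j)) := fun j ψ =>
    integrable_schwartz_mul_coord_mul_apply f j _ ψ
  have i3 : ∀ (j : Fin 2) (φ : 𝓢(Plane, ℝ)), Integrable fun x => hor (f x) j * φ x := fun j φ =>
    MemLp.integrable_mul (memLp_apply f (Fin.castAdd m j)) (φ.memLp 2 volume)
  refine ae_eq_zero_of_integral_invFourier
    (K := fun ξ => ∑ j : Fin 2, (ξ j : ℂ) * fourierL2 f ξ (Fin.castAdd m j)) ?_ ?_ fun φ => ?_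
  · simp only [Fin.sum_univ_two]
    exact (locallyIntegrable_coord_mul_apply f 0 _).add (locallyIntegrable_coord_mul_apply f 1 _)
  · intro ψ
    simp only [Finset.mul_sum]
    exact integrable_finsetSum _ fun j _ => i1 j ψ
  · have h := hf φ
    rw [integral_finsetSum _ fun j _ => i3 j _] at h
    have h2 := congrArg (fun r : ℝ => (r : ℂ)) h
    simp only [Complex.ofReal_sum, hor, ofReal_integral_apply_mul_eq, Complex.ofReal_zero] at h2
    simp only [Finset.mul_sum]
    rw [integral_finsetSum _ fun j _ => i1 j _]
    have h3 : ∀ j : Fin 2, ∫ ξ, invFourier (∂_{e j} φ) ξ * fourierL2 f ξ (Fin.castAdd m j) =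
        -(2 * Real.pi * Complex.I) *
          ∫ ξ, invFourier φ ξ * ((ξ j : ℂ) * fourierL2 f ξ (Fin.castAdd m j)) := by
      intro j
      rw [← integral_const_mul]
      congr 1; ext ξ
      rw [invFourier_lineDeriv_apply]
      ring
    simp only [h3, ← Finset.mul_sum] at h2
    refine (mul_eq_zero.1 h2).resolve_left ?_
    simp [Real.pi_ne_zero]

/-- The Fourier transform of the weak gradient. -/
theorem fourierL2_weakGradient_ae {m : ℕ} {f : L2Vel m} {g : Fin 2 → L2Vel m}
    (h : IsWeakGradient f g) (j : Fin 2) (k : Fin (2 + m)) :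
    ∀ᵐ ξ : Plane, fourierL2 (g j) ξ k =
      2 * Real.pi * Complex.I * ((ξ j : ℂ) * fourierL2 f ξ k) := by
  have i1 := integrable_schwartz_mul_apply (g j) k
  have i2 : ∀ ψ : 𝓢(Plane, ℂ),
      Integrable fun ξ => ψ ξ * (2 * Real.pi * Complex.I * ((ξ j : ℂ) * fourierL2 f ξ k)) := by
    intro ψ
    refine ((integrable_schwartz_mul_coord_mul_apply f j k ψ).const_mul
      (2 * Real.pi * Complex.I)).congr (Filter.Eventually.of_forall fun ξ => ?_)
    simp only
    ring
  have := ae_eq_zero_of_integral_invFourier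
    (K := fun ξ => fourierL2 (g j) ξ k - 2 * Real.pi * Complex.I * ((ξ j : ℂ) * fourierL2 f ξ k))
    (((memLp_apply_complex (fourierL2 (g j)) k).locallyIntegrable (by norm_num)).sub
      ((locallyIntegrable_coord_mul_apply f j k).smul (2 * Real.pi * Complex.I)))
    (fun ψ => by simp only [mul_sub]; exact (i1 ψ).sub (i2 ψ)) fun φ => ?_
  · filter_upwards [this] with ξ hξ using sub_eq_zero.1 hξ
  · simp only [mul_sub]
    rw [integral_sub (i1 _) (i2 _), sub_eq_zero]
    have hi : ∀ (f : L2Vel m) (φ : 𝓢(Plane, ℝ)), Integrable fun x => φ x • f x := fun f φ =>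
      memLp_one_iff_integrable.1 ((Lp.memLp f).smul (φ.memLp 2 volume))
    have h1 := congrArg (EuclideanSpace.proj k : Vel m →L[ℝ] ℝ) (h j φ)
    rw [map_neg, ← ContinuousLinearMap.integral_comp_comm _ (hi _ _),
      ← ContinuousLinearMap.integral_comp_comm _ (hi _ _)] at h1
    simp only [map_smul, smul_eq_mul, PiLp.proj_apply, mul_comm (φ _),
      mul_comm ((∂_{e j} φ : 𝓢(Plane, ℝ)) _)] at h1
    have h2 := congrArg (fun r : ℝ => (r : ℂ)) h1
    simp only [Complex.ofReal_neg] at h2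
    rw [ofReal_integral_apply_mul_eq, ofReal_integral_apply_mul_eq] at h2
    rw [← neg_eq_iff_eq_neg.2 h2, ← integral_neg]
    congr 1; ext ξ
    rw [invFourier_lineDeriv_apply]
    ring

theorem norm_toComplex {m : ℕ} (a : Vel m) : ‖toComplex m a‖ = ‖a‖ := by
  simp [toComplex, EuclideanSpace.norm_eq]

theorem lintegral_enorm_sq_eq {E : Type*} [NormedAddCommGroup E]
    (g : Lp (α := Plane) E 2 volume) : ∫⁻ ξ, ‖g ξ‖ₑ ^ 2 = ENNReal.ofReal (‖g‖ ^ 2) := by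
  have h : eLpNorm g 2 volume ^ 2 = ∫⁻ ξ, ‖g ξ‖ₑ ^ 2 := by
    rw [eLpNorm_eq_lintegral_rpow_enorm_toReal (by norm_num) (by norm_num)]
    rw [← ENNReal.rpow_natCast, ← ENNReal.rpow_mul]
    simp
  rw [← h, Lp.norm_def, ENNReal.ofReal_pow ENNReal.toReal_nonneg,
    ENNReal.ofReal_toReal (Lp.memLp g).2.ne]

/-- Plancherel's theorem for velocity fields. -/
theorem norm_fourierL2 {m : ℕ} (f : L2Vel m) : ‖fourierL2 f‖ = ‖f‖ := by
  rw [fourierL2, Lp.norm_fourier_eq, Lp.norm_def, Lp.norm_def]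
  congr 1
  refine eLpNorm_congr_norm_ae ?_
  filter_upwards [ContinuousLinearMap.coeFn_compLp (toComplex m) f] with x hx
  rw [hx, norm_toComplex]

theorem lintegral_enorm_fourierL2_sq {m : ℕ} (f : L2Vel m) :
    ∫⁻ ξ, ‖fourierL2 f ξ‖ₑ ^ 2 = ENNReal.ofReal (‖f‖ ^ 2) := by
  rw [lintegral_enorm_sq_eq, norm_fourierL2]

/-- Plancherel's theorem for the weak gradient. -/
theorem lintegral_norm_sq_mul_enorm_fourierL2_sq {m : ℕ} {f : L2Vel m} {g : Fin 2 → L2Vel m}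
    (h : IsWeakGradient f g) :
    ∫⁻ ξ : Plane, ENNReal.ofReal (4 * Real.pi ^ 2 * ‖ξ‖ ^ 2) * ‖fourierL2 f ξ‖ₑ ^ 2 =
      ENNReal.ofReal (∑ j, ‖g j‖ ^ 2) := by
  rw [ENNReal.ofReal_sum_of_nonneg fun _ _ => by positivity]
  simp_rw [← lintegral_enorm_fourierL2_sq]
  rw [← lintegral_finsetSum' _ fun j _ => (Lp.aestronglyMeasurable _).enorm.pow_const 2]
  refine lintegral_congr_ae ?_
  have hk : ∀ᵐ ξ : Plane, ∀ j k, fourierL2 (g j) ξ k =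
      2 * Real.pi * Complex.I * ((ξ j : ℂ) * fourierL2 f ξ k) :=
    ae_all_iff.2 fun j => ae_all_iff.2 fun k => fourierL2_weakGradient_ae h j k
  filter_upwards [hk] with ξ hξ
  have hj : ∀ j, ‖fourierL2 (g j) ξ‖ₑ ^ 2 =
      ENNReal.ofReal (4 * Real.pi ^ 2 * ξ j ^ 2) * ‖fourierL2 f ξ‖ₑ ^ 2 := by
    intro j
    have : fourierL2 (g j) ξ = (2 * Real.pi * Complex.I * (ξ j : ℂ)) • fourierL2 f ξ := by
      ext k
      rw [hξ j k, PiLp.smul_apply, smul_eq_mul]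
      ring
    rw [this, enorm_smul, mul_pow]
    congr 1
    rw [← ofReal_norm, ← ENNReal.ofReal_pow (norm_nonneg _)]
    congr 1
    simp only [norm_mul, Complex.norm_ofNat, Complex.norm_real, Complex.norm_I, Real.norm_eq_abs,
      mul_pow, sq_abs]
    ring
  simp_rw [hj]
  rw [← Finset.sum_mul, ← ENNReal.ofReal_sum_of_nonneg fun _ _ => by positivity,
    EuclideanSpace.real_norm_sq_eq, Finset.mul_sum]

/-- A square integrable field is bounded by the integral of its Fourier transform. -/
theorem eLpNorm_top_le_eLpNorm_fourierL2 {m : ℕ} (f : L2Vel m) :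
    eLpNorm f ⊤ volume ≤ eLpNorm (fourierL2 f) 1 volume := by
  by_cases htop : eLpNorm (fourierL2 f) 1 volume = ⊤
  · rw [htop]; exact le_top
  have hF : Integrable (fourierL2 f) := memLp_one_iff_integrable.1
    ⟨Lp.aestronglyMeasurable _, lt_top_iff_ne_top.2 htop⟩
  set g : Plane → VelC m := 𝓕⁻ (fourierL2 f : Plane → VelC m) with hg
  have hgc : Continuous g := by
    have : Continuous (𝓕 (fourierL2 f : Plane → VelC m)) :=
      VectorFourier.fourierIntegral_continuous Real.continuous_fourierChar
        (by exact continuous_inner) hF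
    have h2 : g = fun x => 𝓕 (fourierL2 f : Plane → VelC m) (-x) := by
      ext1 x; exact Real.fourierInv_eq_fourier_neg _ _
    rw [h2]; fun_prop
  have hae : ∀ᵐ x, ((toComplex m).compLp f) x = g x := by
    refine ae_eq_of_integral_contDiff_smul_eq ((Lp.memLp _).locallyIntegrable (by norm_num))
      hgc.locallyIntegrable fun η hη hηc => ?_
    have h1 : HasCompactSupport (Complex.ofRealCLM ∘ η) := hηc.comp_left rfl
    have h2 : ContDiff ℝ ∞ (Complex.ofRealCLM ∘ η) := by fun_prop
    set φ : 𝓢(Plane, ℂ) := h1.toSchwartzMap h2 with hφ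
    have hd : ∫ x, φ x • ((toComplex m).compLp f) x =
        ∫ ξ, (𝓕⁻ φ : 𝓢(Plane, ℂ)) ξ • (fourierL2 f) ξ := by
      have h := congrArg (fun D => D (𝓕⁻ φ))
        (Lp.fourier_toTemperedDistribution_eq ((toComplex m).compLp f))
      simpa [TemperedDistribution.fourier_apply, fourierL2] using h
    have hs : ∫ ξ, (𝓕⁻ φ : 𝓢(Plane, ℂ)) ξ • (fourierL2 f) ξ = ∫ x, φ x • g x := by
      have hc : Continuous fun p : Plane × Plane => ((-innerₗ Plane) p.1) p.2 :=
        (continuous_inner (𝕜 := ℝ)).neg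
      have h3 := VectorFourier.integral_fourierIntegral_smul_eq_flip (μ := volume) (ν := volume)
        (L := -innerₗ Plane) Real.continuous_fourierChar hc φ.integrable hF
      refine Eq.trans ?_ (h3.trans ?_)
      · congr 1; ext1 ξ
        rw [SchwartzMap.fourierInv_coe]
        rfl
      · congr 1; ext1 x
        rw [hg, Real.fourierInv_eq, VectorFourier.fourierIntegral]
        simp [real_inner_comm]
    have e1 : ∀ x, η x • ((toComplex m).compLp f) x = φ x • ((toComplex m).compLp f) x := fun x =>
      (Complex.coe_smul _ _).symm
    have e2 : ∀ x, η x • g x = φ x • g x := fun x => (Complex.coe_smul _ _).symm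
    simp_rw [e1, e2]
    rw [hd, hs]
  rw [eLpNorm_exponent_top]
  refine essSup_le_of_ae_le _ ?_
  filter_upwards [hae, ContinuousLinearMap.coeFn_compLp (toComplex m) f] with x hx hx2
  have : ‖f x‖ₑ = ‖g x‖ₑ := by
    rw [← hx, hx2, ← ofReal_norm, ← ofReal_norm, norm_toComplex]
  rw [this, eLpNorm_one_eq_lintegral_enorm, hg, Real.fourierInv_eq]
  refine (enorm_integral_le_lintegral_enorm _).trans_eq ?_
  congr 1; ext ξ
  rw [← ofReal_norm, Circle.norm_smul, ofReal_norm]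

/-! ### Divergence-free test fields and the equation on the Fourier side -/

/-- The Schwartz field with given components. -/
noncomputable def field {m : ℕ} (c : Fin (2 + m) → 𝓢(Plane, ℝ)) : 𝓢(Plane, Vel m) :=
  ∑ k, SchwartzMap.postcompCLM (𝕜 := ℝ)
    (ContinuousLinearMap.toSpanSingleton ℝ (EuclideanSpace.single k (1 : ℝ) : Vel m)) (c k)

theorem schwartz_sum_apply {E : Type*} [NormedAddCommGroup E] [NormedSpace ℝ E] {ι : Type*}
    (s : Finset ι) (g : ι → 𝓢(Plane, E)) (x : Plane) : (∑ k ∈ s, g k) x = ∑ k ∈ s, g k x := by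
  classical
  induction s using Finset.induction_on with
  | empty => simp
  | insert a s ha ih => rw [Finset.sum_insert ha, Finset.sum_insert ha, add_apply, ih]

theorem field_apply {m : ℕ} (c : Fin (2 + m) → 𝓢(Plane, ℝ)) (x : Plane) (k : Fin (2 + m)) :
    field c x k = c k x := by
  rw [field, schwartz_sum_apply]
  simp [SchwartzMap.postcompCLM_apply, Pi.single_apply]

theorem lineDeriv_field {m : ℕ} (c : Fin (2 + m) → 𝓢(Plane, ℝ)) (v : Plane) :
    (∂_{v} (field c) : 𝓢(Plane, Vel m)) = field fun k => ∂_{v} (c k) := by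
  ext x k
  rw [field_apply, SchwartzMap.lineDerivOp_apply_eq_fderiv, SchwartzMap.lineDerivOp_apply_eq_fderiv]
  have h : ⇑(c k) = (EuclideanSpace.proj k : Vel m →L[ℝ] ℝ) ∘ (field c) := by
    ext y; simp [field_apply]
  rw [h, fderiv_comp _ (by fun_prop) (field c).differentiableAt, ContinuousLinearMap.fderiv]
  simp

theorem laplacian_eq_sum_e {E : Type*} [NormedAddCommGroup E] [NormedSpace ℝ E]
    (f : 𝓢(Plane, E)) : Δ f = ∑ j, ∂_{e j} (∂_{e j} f : 𝓢(Plane, E)) := by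
  rw [SchwartzMap.laplacian_eq_sum (EuclideanSpace.basisFun (Fin 2) ℝ)]
  simp [e]

theorem laplacian_field {m : ℕ} (c : Fin (2 + m) → 𝓢(Plane, ℝ)) :
    Δ (field c) = field fun k => Δ (c k) := by
  ext x k
  simp only [field_apply, laplacian_eq_sum_e, lineDeriv_field, schwartz_sum_apply]
  rw [WithLp.ofLp_sum, Finset.sum_apply]
  simp [field_apply]

/-- The horizontal coordinates of the frequency, extended by zero to the further components. -/
def extFreq {m : ℕ} (ξ : Plane) (k : Fin (2 + m)) : ℝ := Fin.addCases (fun j => ξ j) (fun _ => 0) k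

/-- The direction of the plane which corresponds to a component: zero for the further ones. -/
noncomputable def extDir {m : ℕ} (k : Fin (2 + m)) : Plane := Fin.addCases e (fun _ => 0) k

theorem inner_extDir {m : ℕ} (ξ : Plane) (k : Fin (2 + m)) :
    (inner ℝ ξ (extDir k) : ℝ) = extFreq ξ k := by
  induction k using Fin.addCases with
  | left j => simp [extDir, extFreq, inner_e]
  | right j => simp [extDir, extFreq]

/-- The symbol `|ξ|² δ_ik - ξ_i ξ_k`, a polynomial multiple of the Leray projector. -/
noncomputable def leraySymbol {m : ℕ} (i k : Fin (2 + m)) (ξ : Plane) : ℝ :=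
  (if i = k then ‖ξ‖ ^ 2 else 0) - extFreq ξ i * extFreq ξ k

/-- The components of the test field `Δφ e_i - ∇ ∂_i φ`. -/
noncomputable def testComp {m : ℕ} (i : Fin (2 + m)) (φ : 𝓢(Plane, ℝ)) (k : Fin (2 + m)) :
    𝓢(Plane, ℝ) :=
  (if i = k then (Δ φ : 𝓢(Plane, ℝ)) else 0) - ∂_{extDir k} (∂_{extDir i} φ : 𝓢(Plane, ℝ))

theorem complexify_add (φ χ : 𝓢(Plane, ℝ)) : complexify (φ + χ) = complexify φ + complexify χ :=
  map_add _ _ _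

theorem invFourier_add (φ χ : 𝓢(Plane, ℝ)) : invFourier (φ + χ) = invFourier φ + invFourier χ := by
  rw [invFourier, complexify_add, FourierTransform.fourierInv_add]; rfl

theorem invFourier_zero : invFourier 0 = 0 := by
  have := invFourier_add 0 0
  simpa using this

theorem invFourier_sub (φ χ : 𝓢(Plane, ℝ)) : invFourier (φ - χ) = invFourier φ - invFourier χ := by
  have := invFourier_add (φ - χ) χ
  rw [sub_add_cancel] at this
  rw [this, add_sub_cancel_right]

theorem invFourier_sum {ι : Type*} (s : Finset ι) (φ : ι → 𝓢(Plane, ℝ)) :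
    invFourier (∑ k ∈ s, φ k) = ∑ k ∈ s, invFourier (φ k) := by
  classical
  induction s using Finset.induction_on with
  | empty => simp [invFourier_zero]
  | insert a s ha ih => rw [Finset.sum_insert ha, Finset.sum_insert ha, invFourier_add, ih]

theorem invFourier_eq_zero {φ : 𝓢(Plane, ℝ)} (h : invFourier φ = 0) : φ = 0 := by
  have h1 : complexify φ = 0 := by
    have h2 : (𝓕 (𝓕⁻ (complexify φ) : 𝓢(Plane, ℂ)) : 𝓢(Plane, ℂ)) = complexify φ :=
      FourierTransform.fourier_fourierInv_eq _
    rw [← h2, show (𝓕⁻ (complexify φ) : 𝓢(Plane, ℂ)) = 0 from h]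
    exact map_zero (SchwartzMap.fourierTransformCLM ℂ)
  ext x
  have := congrArg (fun f : 𝓢(Plane, ℂ) => f x) h1
  simpa using this

theorem invFourier_lineDeriv_apply' (φ : 𝓢(Plane, ℝ)) (v ξ : Plane) :
    invFourier (∂_{v} φ) ξ =
      -(2 * Real.pi * Complex.I) * ((inner ℝ ξ v : ℝ) : ℂ) * invFourier φ ξ := by
  rw [invFourier, complexify_lineDeriv, fourierInv_lineDeriv_apply]
  rfl

theorem invFourier_laplacian_apply (φ : 𝓢(Plane, ℝ)) (ξ : Plane) :
    invFourier (Δ φ) ξ = -(4 * Real.pi ^ 2) * ((‖ξ‖ ^ 2 : ℝ) : ℂ) * invFourier φ ξ := by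
  rw [laplacian_eq_sum_e, invFourier_sum, schwartz_sum_apply]
  simp only [invFourier_lineDeriv_apply]
  rw [EuclideanSpace.real_norm_sq_eq]
  simp only [Fin.sum_univ_two]
  push_cast
  linear_combination (4 * (Real.pi : ℂ) ^ 2 * ((ξ 0 : ℂ) ^ 2 + (ξ 1 : ℂ) ^ 2) * invFourier φ ξ) *
    Complex.I_sq

/-- The test fields are, up to a factor, the columns of the Leray symbol on the Fourier side. -/
theorem invFourier_testComp_apply {m : ℕ} (i k : Fin (2 + m)) (φ : 𝓢(Plane, ℝ)) (ξ : Plane) :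
    invFourier (testComp i φ k) ξ =
      -(4 * Real.pi ^ 2) * (leraySymbol i k ξ : ℂ) * invFourier φ ξ := by
  rw [testComp, invFourier_sub, sub_apply, invFourier_lineDeriv_apply',
    invFourier_lineDeriv_apply', inner_extDir, inner_extDir, leraySymbol]
  split_ifs with h
  · rw [invFourier_laplacian_apply]
    push_cast
    linear_combination (-4 * (Real.pi : ℂ) ^ 2 * (extFreq ξ i * extFreq ξ k) * invFourier φ ξ) *
      Complex.I_sq
  · rw [invFourier_zero, zero_apply]
    push_cast
    linear_combination (-4 * (Real.pi : ℂ) ^ 2 * (extFreq ξ i * extFreq ξ k) * invFourier φ ξ) *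
      Complex.I_sq

theorem extFreq_castAdd {m : ℕ} (ξ : Plane) (j : Fin 2) : extFreq ξ (Fin.castAdd m j) = ξ j := by
  simp [extFreq]

theorem extFreq_natAdd {m : ℕ} (ξ : Plane) (j : Fin m) : extFreq ξ (Fin.natAdd 2 j) = 0 := by
  simp [extFreq]

theorem sum_extFreq_mul {m : ℕ} (ξ : Plane) (F : Fin (2 + m) → ℂ) :
    ∑ k, (extFreq ξ k : ℂ) * F k = ∑ j : Fin 2, (ξ j : ℂ) * F (Fin.castAdd m j) := by
  rw [Fin.sum_univ_add]
  simp [extFreq_castAdd, extFreq_natAdd]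

/-- The Leray symbol acts on divergence-free fields as multiplication by `|ξ|²`. -/
theorem sum_leraySymbol_mul {m : ℕ} {ξ : Plane} {F : Fin (2 + m) → ℂ} (i : Fin (2 + m))
    (h : ∑ j : Fin 2, (ξ j : ℂ) * F (Fin.castAdd m j) = 0) :
    ∑ k, (leraySymbol i k ξ : ℂ) * F k = ((‖ξ‖ ^ 2 : ℝ) : ℂ) * F i := by
  simp only [leraySymbol, Complex.ofReal_sub, sub_mul, Finset.sum_sub_distrib]
  have h1 : ∑ k, ((extFreq ξ i * extFreq ξ k : ℝ) : ℂ) * F k = 0 := by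
    simp only [Complex.ofReal_mul, mul_assoc]
    rw [← Finset.mul_sum, sum_extFreq_mul, h, mul_zero]
  rw [h1, sub_zero, Finset.sum_eq_single i (fun k _ hk => by simp [Ne.symm hk]) (by simp)]
  simp

theorem leraySymbol_symm {m : ℕ} (i k : Fin (2 + m)) (ξ : Plane) :
    leraySymbol i k ξ = leraySymbol k i ξ := by
  simp only [leraySymbol, eq_comm (a := i), mul_comm (extFreq ξ i)]

theorem isDivFreeTest_field_testComp {m : ℕ} (i : Fin (2 + m)) (φ : 𝓢(Plane, ℝ)) :
    IsDivFreeTest (field (testComp i φ)) := by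
  have h : (∑ j : Fin 2, ∂_{e j} (testComp i φ (Fin.castAdd m j)) : 𝓢(Plane, ℝ)) = 0 := by
    refine invFourier_eq_zero ?_
    ext ξ
    rw [invFourier_sum, schwartz_sum_apply]
    simp only [invFourier_lineDeriv_apply, invFourier_testComp_apply]
    have h0 : ∑ j : Fin 2, (ξ j : ℂ) * (leraySymbol i (Fin.castAdd m j) ξ : ℂ) = 0 := by
      rw [← sum_extFreq_mul ξ fun k => (leraySymbol i k ξ : ℂ)]
      have h2 : ∑ k : Fin (2 + m), extFreq ξ k * extFreq ξ k = ‖ξ‖ ^ 2 := by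
        rw [Fin.sum_univ_add, EuclideanSpace.real_norm_sq_eq]
        simp [extFreq_castAdd, extFreq_natAdd, sq]
      have h3 : ∑ k : Fin (2 + m), extFreq ξ k * leraySymbol i k ξ = 0 := by
        simp only [leraySymbol, mul_sub, Finset.sum_sub_distrib, mul_ite, mul_zero]
        rw [Finset.sum_ite_eq Finset.univ i fun k => extFreq ξ k * ‖ξ‖ ^ 2]
        simp only [Finset.mem_univ, if_true]
        have : ∀ k : Fin (2 + m), extFreq ξ k * (extFreq ξ i * extFreq ξ k) =
          extFreq ξ i * (extFreq ξ k * extFreq ξ k) := fun k => by ring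
        simp only [this]
        rw [← Finset.mul_sum, h2, sub_self]
      exact_mod_cast h3
    rw [zero_apply]
    simp only [Fin.sum_univ_two] at h0 ⊢
    linear_combination (8 * (Real.pi : ℂ) ^ 3 * Complex.I * invFourier φ ξ) * h0
  intro x
  have := congrArg (fun f : 𝓢(Plane, ℝ) => f x) h
  simpa [schwartz_sum_apply, lineDeriv_field, hor, field_apply] using this

theorem inner_vel {m : ℕ} (a b : Vel m) : (inner ℝ a b : ℝ) = ∑ k, a k * b k := by
  simp [PiLp.inner_apply, mul_comm]

theorem ofReal_integral_inner_field {m : ℕ} (f : L2Vel m) (c : Fin (2 + m) → 𝓢(Plane, ℝ)) :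
    ((∫ x, (inner ℝ (f x) (field c x) : ℝ) : ℝ) : ℂ) =
      ∫ ξ, ∑ k, invFourier (c k) ξ * fourierL2 f ξ k := by
  have i3 : ∀ (k : Fin (2 + m)), Integrable fun x => f x k * c k x := fun k =>
    MemLp.integrable_mul (memLp_apply f k) ((c k).memLp 2 volume)
  simp only [inner_vel, field_apply]
  rw [integral_finsetSum _ fun k _ => i3 k,
    integral_finsetSum _ fun k _ => integrable_schwartz_mul_apply f k _]
  simp only [Complex.ofReal_sum, ofReal_integral_apply_mul_eq]

/-- The convolution of two components of the Fourier transform of a field: the Fourier transform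
of the product of these components. -/
noncomputable def conv {m : ℕ} (F : Plane → VelC m) (j k : Fin (2 + m)) (ξ : Plane) : ℂ :=
  ∫ η, F η j * F (ξ - η) k

/-- `|ξ|²` times the Fourier transform of the `i`-th component of the Leray projection of
`- (u · ∇) u`, written in terms of the Fourier transform `F` of `u`. -/
noncomputable def nonlin {m : ℕ} (F : Plane → VelC m) (i : Fin (2 + m)) (ξ : Plane) : ℂ :=
  ∑ j : Fin 2, ∑ k, -(2 * Real.pi * Complex.I) * (ξ j : ℂ) * (leraySymbol i k ξ : ℂ) *
    conv F (Fin.castAdd m j) k ξ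

theorem integrable_invFourier_mul_conv {m : ℕ} (f : L2Vel m) (j k : Fin (2 + m)) (φ : 𝓢(Plane, ℝ)) :
    Integrable fun ξ => invFourier φ ξ * conv (fourierL2 f) j k ξ := by
  have h := (integrable_mul_mul_sub (memLp_apply_complex (fourierL2 f) j)
    (memLp_apply_complex (fourierL2 f) k) (invFourier φ)).integral_prod_left
  refine h.congr (Filter.Eventually.of_forall fun ξ => ?_)
  simp only [conv]
  rw [integral_const_mul]

theorem integrable_apply_mul_apply_mul {m : ℕ} (f : L2Vel m) (j k : Fin (2 + m)) (φ : 𝓢(Plane, ℝ)) :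
    Integrable fun x => f x j * (f x k * φ x) := by
  have : MemLp (fun x => φ x * f x k) 2 (volume : Measure Plane) :=
    MemLp.mul (p := ⊤) (q := 2) (memLp_apply f k) (φ.memLp_top volume)
  have h : Integrable fun x => f x j * (φ x * f x k) := MemLp.integrable_mul (memLp_apply f j) this
  exact h.congr (Filter.Eventually.of_forall fun x => by ring)

/-- Tested against the field with the components `testComp i φ`, a divergence-free field
shows only its `i`-th component: the Leray symbol acts on it as a multiplication. -/
theorem ofReal_integral_inner_testField {m : ℕ} {f : L2Vel m} (hf : IsDivFree f) (i : Fin (2 + m))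
    (φ : 𝓢(Plane, ℝ)) :
    ((∫ x, (inner ℝ (f x) (field (testComp i φ) x) : ℝ) : ℝ) : ℂ) = -(4 * Real.pi ^ 2) *
      ∫ ξ : Plane, invFourier φ ξ * (((‖ξ‖ ^ 2 : ℝ) : ℂ) * fourierL2 f ξ i) := by
  rw [ofReal_integral_inner_field, ← integral_const_mul]
  refine integral_congr_ae ?_
  filter_upwards [sum_coord_mul_fourierL2_ae hf] with ξ hξ
  rw [← sum_leraySymbol_mul i hξ]
  simp only [invFourier_testComp_apply, Finset.mul_sum]
  refine Finset.sum_congr rfl fun k _ => by ring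

theorem ofReal_integral_inner_laplacian_testField {m : ℕ} {f : L2Vel m} (hf : IsDivFree f)
    (i : Fin (2 + m)) (φ : 𝓢(Plane, ℝ)) :
    ((∫ x, (inner ℝ (f x) ((Δ (field (testComp i φ)) : 𝓢(Plane, Vel m)) x) : ℝ) : ℝ) : ℂ) =
      -(4 * Real.pi ^ 2) * ∫ ξ : Plane, invFourier φ ξ *
        (-(4 * Real.pi ^ 2) * ((‖ξ‖ ^ 2 : ℝ) : ℂ) * (((‖ξ‖ ^ 2 : ℝ) : ℂ) * fourierL2 f ξ i)) := by
  rw [laplacian_field, ofReal_integral_inner_field, ← integral_const_mul]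
  refine integral_congr_ae ?_
  filter_upwards [sum_coord_mul_fourierL2_ae hf] with ξ hξ
  rw [← sum_leraySymbol_mul i hξ]
  simp only [invFourier_laplacian_apply, invFourier_testComp_apply, Finset.mul_sum]
  refine Finset.sum_congr rfl fun k _ => by ring

theorem ofReal_integral_convection_testField {m : ℕ} (f : L2Vel m) (i : Fin (2 + m))
    (φ : 𝓢(Plane, ℝ)) :
    ((∫ x, ∑ j, hor (f x) j *
        (inner ℝ (f x) ((∂_{e j} (field (testComp i φ)) : 𝓢(Plane, Vel m)) x) : ℝ) : ℝ) : ℂ) =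
      -(4 * Real.pi ^ 2) * ∫ ξ : Plane, invFourier φ ξ * nonlin (fourierL2 f) i ξ := by
  simp only [lineDeriv_field, inner_vel, field_apply, Finset.mul_sum, hor]
  have h0 : ∀ j : Fin 2, Integrable fun x => ∑ k, f x (Fin.castAdd m j) *
      (f x k * (∂_{e j} (testComp i φ k) : 𝓢(Plane, ℝ)) x) := fun j =>
    integrable_finsetSum _ fun k _ => integrable_apply_mul_apply_mul f _ _ _
  rw [integral_finsetSum _ fun j _ => h0 j, Complex.ofReal_sum]
  have h1 : ∀ j : Fin 2, ((∫ x, ∑ k, f x (Fin.castAdd m j) *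
      (f x k * (∂_{e j} (testComp i φ k) : 𝓢(Plane, ℝ)) x) : ℝ) : ℂ) =
      ∫ ξ, ∑ k, invFourier (∂_{e j} (testComp i φ k)) ξ *
        conv (fourierL2 f) (Fin.castAdd m j) k ξ := by
    intro j
    rw [integral_finsetSum _ fun k _ => integrable_apply_mul_apply_mul f _ _ _,
      integral_finsetSum _ fun k _ => integrable_invFourier_mul_conv f _ _ _, Complex.ofReal_sum]
    simp only [ofReal_integral_apply_mul_apply_mul_eq]
    rfl
  simp only [h1]
  have h2 : ∀ j : Fin 2, Integrable fun ξ => ∑ k, invFourier (∂_{e j} (testComp i φ k)) ξ *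
      conv (fourierL2 f) (Fin.castAdd m j) k ξ := fun j =>
    integrable_finsetSum _ fun k _ => integrable_invFourier_mul_conv f _ _ _
  rw [← integral_finsetSum _ fun j _ => h2 j, ← integral_const_mul]
  congr 1; ext ξ
  simp only [nonlin, Finset.mul_sum, invFourier_lineDeriv_apply, invFourier_testComp_apply]
  refine Finset.sum_congr rfl fun j _ => Finset.sum_congr rfl fun k _ => by ring

/-- The weak formulation on the Fourier side, with the pressure eliminated. -/
theorem IsWeakSolution.fourier_equation {m : ℕ} {T : ℝ} {u₀ : L2Vel m} {u v : ℝ → L2Vel m}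
    (h : IsWeakSolution T u₀ u v) (h0 : IsDivFree u₀) (i : Fin (2 + m)) {ϑ : ℝ → ℝ}
    (hϑ : ContDiff ℝ ∞ ϑ) (hϑc : HasCompactSupport ϑ) (hϑT : tsupport ϑ ⊆ Iio T)
    (φ : 𝓢(Plane, ℝ)) :
    ((ϑ 0 : ℝ) : ℂ) * (∫ ξ : Plane, invFourier φ ξ * (((‖ξ‖ ^ 2 : ℝ) : ℂ) * fourierL2 u₀ ξ i)) +
      ∫ t in Ioo 0 T, (((deriv ϑ t : ℝ) : ℂ) *
          (∫ ξ : Plane, invFourier φ ξ * (((‖ξ‖ ^ 2 : ℝ) : ℂ) * fourierL2 (v t) ξ i)) +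
        ((ϑ t : ℝ) : ℂ) * ((∫ ξ : Plane, invFourier φ ξ * (-(4 * Real.pi ^ 2) * ((‖ξ‖ ^ 2 : ℝ) : ℂ) *
            (((‖ξ‖ ^ 2 : ℝ) : ℂ) * fourierL2 (v t) ξ i))) +
          ∫ ξ : Plane, invFourier φ ξ * nonlin (fourierL2 (u t)) i ξ)) = 0 := by
  have h1 := congrArg (fun r : ℝ => (r : ℂ))
    (h.equation ϑ (field (testComp i φ)) hϑ hϑc hϑT (isDivFreeTest_field_testComp i φ))
  simp only [Complex.ofReal_add, Complex.ofReal_mul, Complex.ofReal_zero] at h1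
  rw [ofReal_integral_inner_testField h0, ← integral_complex_ofReal] at h1
  have h2 : (-(4 * (Real.pi : ℂ) ^ 2)) ≠ 0 := by simp [Real.pi_ne_zero]
  refine (mul_eq_zero.1 (Eq.trans ?_ h1)).resolve_left h2
  rw [mul_add, mul_left_comm]
  congr 1
  · rw [← integral_const_mul]
    refine integral_congr_ae ?_
    filter_upwards [h.isDivFree] with t ht
    simp only [Complex.ofReal_add, Complex.ofReal_mul]
    rw [ofReal_integral_inner_testField ht, ofReal_integral_inner_laplacian_testField ht,
      ofReal_integral_convection_testField]
    ring

/-! ### Jointly measurable representatives -/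

/-- A measurable family of square integrable functions has a jointly measurable representative:
it is the limit of families with countably many values which converge so fast that they converge
almost everywhere in space, for every time. -/
theorem exists_stronglyMeasurable_uncurry_ae_eq {E : Type*} [NormedAddCommGroup E]
    [CompleteSpace E] [SecondCountableTopology E] (f : ℝ → Lp (α := Plane) E 2 volume)
    (hf : StronglyMeasurable f) :
    ∃ F : ℝ → Plane → E, StronglyMeasurable (Function.uncurry F) ∧ ∀ t, F t =ᵐ[volume] f t := by
  classical
  borelize E
  have : Fact ((2 : ℝ≥0∞) ≠ ⊤) := ⟨by norm_num⟩
  set d := TopologicalSpace.denseSeq (Lp (α := Plane) E 2 volume) with hd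
  have hex : ∀ n : ℕ, ∃ k : ℝ → ℕ, Measurable k ∧ ∀ t, dist (f t) (d (k t)) < (1 / 4) ^ n := by
    intro n
    have h : ∀ t, ∃ k, dist (f t) (d k) < (1 / 4) ^ n := fun t =>
      (TopologicalSpace.denseRange_denseSeq _).exists_dist_lt (f t) (by positivity)
    exact ⟨_, measurable_find h fun k => measurableSet_lt
      (hf.dist stronglyMeasurable_const).measurable measurable_const, fun t => Nat.find_spec (h t)⟩
  choose k hk hdist using hex
  set G : ℕ → ℝ → Lp (α := Plane) E 2 volume := fun n t => d (k n t) with hG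
  have hmeas : ∀ n, StronglyMeasurable fun p : ℝ × Plane => G n p.1 p.2 := by
    intro n
    have h : Measurable fun p : Plane × ℕ => d p.2 p.1 :=
      measurable_from_prod_countable_left fun l => (Lp.stronglyMeasurable (d l)).measurable
    exact (h.comp (measurable_snd.prodMk ((hk n).comp measurable_fst))).stronglyMeasurable
  refine ⟨fun t x => Filter.limUnder Filter.atTop fun n => G n t x,
      StronglyMeasurable.limUnder hmeas,
    fun t => ?_⟩
  have hdle : ∀ N n l : ℕ, N ≤ n → N ≤ l →
      eLpNorm (G n t - G l t : Plane → E) 2 volume < ENNReal.ofReal (2 * (1 / 4) ^ N) := by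
    intro N n l hn hl
    rw [← Lp.edist_def, edist_dist]
    refine (ENNReal.ofReal_lt_ofReal_iff (by positivity)).2 ?_
    have h1 := dist_triangle_left (G n t) (G l t) (f t)
    have h2 : ((1 : ℝ) / 4) ^ n ≤ (1 / 4) ^ N := pow_le_pow_of_le_one (by norm_num) (by norm_num) hn
    have h3 : ((1 : ℝ) / 4) ^ l ≤ (1 / 4) ^ N := pow_le_pow_of_le_one (by norm_num) (by norm_num) hl
    linarith [hdist n t, hdist l t]
  have hsum : ∑' N : ℕ, ENNReal.ofReal (2 * (1 / 4) ^ N) ≠ ⊤ :=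
    ((summable_geometric_of_lt_one (by norm_num) (by norm_num)).mul_left 2).tsum_ofReal_ne_top
  have hlim := Lp.ae_tendsto_of_cauchy_eLpNorm (p := 2) (fun n => Lp.aestronglyMeasurable (G n t))
    (by norm_num) hsum hdle
  have hconv : Filter.Tendsto (fun n => eLpNorm (G n t - f t : Plane → E) 2 volume) Filter.atTop
      (nhds 0) := by
    simp_rw [← Lp.edist_def, edist_dist, ← ENNReal.ofReal_zero]
    refine ENNReal.tendsto_ofReal (squeeze_zero (fun n => dist_nonneg) (fun n => ?_)
      (tendsto_pow_atTop_nhds_zero_of_lt_one (r := 1 / 4) (by norm_num) (by norm_num)))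
    rw [dist_comm]
    exact (hdist n t).le
  obtain ⟨ns, hns, hsub⟩ := (tendstoInMeasure_of_tendsto_eLpNorm (p := 2) (by norm_num)
    (fun n => Lp.aestronglyMeasurable (G n t)) (Lp.aestronglyMeasurable (f t))
    hconv).exists_seq_tendsto_ae
  filter_upwards [hlim, hsub] with x ⟨l, hl⟩ hx
  have := tendsto_nhds_unique (hl.comp hns.tendsto_atTop) hx
  rw [← this]
  exact hl.limUnder_eq

theorem continuous_fourierL2 {m : ℕ} : Continuous (fourierL2 (m := m)) := by
  have h1 : Continuous fun f : Lp (α := Plane) (VelC m) 2 volume =>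
      (𝓕 f : Lp (α := Plane) (VelC m) 2 volume) := FourierTransform.continuous_fourier
  have h2 : Continuous fun f : L2Vel m => (toComplex m).compLp f :=
    (ContinuousLinearMap.compLpL 2 volume (toComplex m)).continuous
  exact h1.comp h2

/-- The Fourier transform of a measurable family of fields has a jointly measurable
representative. -/
theorem exists_stronglyMeasurable_fourierL2 {m : ℕ} {T : ℝ} {v : ℝ → L2Vel m}
    (hv : AEStronglyMeasurable v (volume.restrict (Ioo 0 T))) :
    ∃ F : ℝ → Plane → VelC m, StronglyMeasurable (Function.uncurry F) ∧
      ∀ᵐ t ∂(volume.restrict (Ioo 0 T)), F t =ᵐ[volume] fourierL2 (v t) := by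
  obtain ⟨F, hF, hFv⟩ := exists_stronglyMeasurable_uncurry_ae_eq (fun t => fourierL2 (hv.mk v t))
    (continuous_fourierL2.comp_stronglyMeasurable hv.stronglyMeasurable_mk)
  refine ⟨F, hF, ?_⟩
  filter_upwards [hv.ae_eq_mk] with t ht
  rw [ht]
  exact hFv t

/-! ### Absolutely continuous functions of time -/

/-- The product rule for primitives, by Fubini's theorem on a square cut along its diagonal. -/
theorem integral_mul_integral_eq {p q : ℝ → ℂ} {t : ℝ} (ht : 0 ≤ t)
    (hp : IntervalIntegrable p volume 0 t) (hq : IntervalIntegrable q volume 0 t) :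
    (∫ s in (0)..t, p s) * (∫ s in (0)..t, q s) =
      ∫ s in (0)..t, (p s * (∫ r in (0)..s, q r) + q s * ∫ r in (0)..s, p r) := by
  rw [intervalIntegrable_iff_integrableOn_Ioc_of_le ht] at hp hq
  rw [intervalIntegral.integral_of_le ht, intervalIntegral.integral_of_le ht,
    intervalIntegral.integral_of_le ht]
  set μ := (volume : Measure ℝ).restrict (Ioc 0 t) with hμ
  have hpq : Integrable (fun z : ℝ × ℝ => p z.1 * q z.2) (μ.prod μ) := Integrable.mul_prod hp hq
  set A : Set (ℝ × ℝ) := {z | z.2 ≤ z.1} with hA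
  have hAm : MeasurableSet A := measurableSet_le measurable_snd measurable_fst
  have i1 : Integrable (A.indicator fun z : ℝ × ℝ => p z.1 * q z.2) (μ.prod μ) :=
    hpq.indicator hAm
  have i2 : Integrable (Aᶜ.indicator fun z : ℝ × ℝ => p z.1 * q z.2) (μ.prod μ) :=
    hpq.indicator hAm.compl
  have e1 : ∀ s ∈ Ioc 0 t, ∫ r, A.indicator (fun z : ℝ × ℝ => p z.1 * q z.2) (s, r) ∂μ =
      p s * ∫ r in (0)..s, q r := by
    intro s hs
    have : ∀ r, A.indicator (fun z : ℝ × ℝ => p z.1 * q z.2) (s, r) =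
        (Iic s).indicator (fun r => p s * q r) r := fun r => by
      simp only [indicator, hA, mem_ofPred_eq, mem_Iic]
    simp_rw [this]
    rw [integral_indicator measurableSet_Iic, hμ, Measure.restrict_restrict measurableSet_Iic,
      integral_const_mul, intervalIntegral.integral_of_le hs.1.le]
    congr 3
    ext r
    simp only [mem_inter_iff, mem_Iic, mem_Ioc]
    constructor
    · rintro ⟨h1, h2, h3⟩; exact ⟨h2, h1⟩
    · rintro ⟨h1, h2⟩; exact ⟨h2, h1, h2.trans hs.2⟩
  have e2 : ∀ r ∈ Ioc 0 t, ∫ s, Aᶜ.indicator (fun z : ℝ × ℝ => p z.1 * q z.2) (s, r) ∂μ =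
      q r * ∫ s in (0)..r, p s := by
    intro r hr
    have : ∀ s, Aᶜ.indicator (fun z : ℝ × ℝ => p z.1 * q z.2) (s, r) =
        (Iio r).indicator (fun s => q r * p s) s := fun s => by
      simp only [indicator, hA, mem_compl_iff, mem_ofPred_eq, not_le, mem_Iio, mul_comm]
    simp_rw [this]
    rw [integral_indicator measurableSet_Iio, hμ, Measure.restrict_restrict measurableSet_Iio,
      integral_const_mul, intervalIntegral.integral_of_le hr.1.le, integral_Ioc_eq_integral_Ioo]
    congr 3
    ext s
    simp only [mem_inter_iff, mem_Iio, mem_Ioc, mem_Ioo]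
    constructor
    · rintro ⟨h1, h2, h3⟩; exact ⟨h2, h1⟩
    · rintro ⟨h1, h2⟩; exact ⟨h2, h1, h2.le.trans hr.2⟩
  have a1 : (∫ z, A.indicator (fun z : ℝ × ℝ => p z.1 * q z.2) z ∂(μ.prod μ)) =
      ∫ s, p s * (∫ r in (0)..s, q r) ∂μ := by
    rw [integral_prod _ i1]
    exact setIntegral_congr_fun measurableSet_Ioc e1
  have a2 : (∫ z, Aᶜ.indicator (fun z : ℝ × ℝ => p z.1 * q z.2) z ∂(μ.prod μ)) =
      ∫ s, q s * (∫ r in (0)..s, p r) ∂μ := by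
    rw [integral_prod_symm _ i2]
    exact setIntegral_congr_fun measurableSet_Ioc e2
  have j1 : Integrable (fun s => p s * ∫ r in (0)..s, q r) μ :=
    i1.integral_prod_left.congr ((ae_restrict_iff' measurableSet_Ioc).2 (.of_forall e1))
  have j2 : Integrable (fun s => q s * ∫ r in (0)..s, p r) μ :=
    i2.integral_prod_right.congr ((ae_restrict_iff' measurableSet_Ioc).2 (.of_forall e2))
  rw [integral_add j1 j2, ← a1, ← a2, ← integral_prod_mul, ← integral_add i1 i2]
  congr 1; ext z
  rw [indicator_self_add_compl_apply]

/-- The product rule for absolutely continuous functions. -/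
theorem mul_eq_add_integral {y z p q : ℝ → ℂ} {t : ℝ} (ht : 0 ≤ t)
    (hp : IntervalIntegrable p volume 0 t) (hq : IntervalIntegrable q volume 0 t)
    (hy : ∀ s ∈ Icc 0 t, y s = y 0 + ∫ r in (0)..s, p r)
    (hz : ∀ s ∈ Icc 0 t, z s = z 0 + ∫ r in (0)..s, q r) :
    y t * z t = y 0 * z 0 + ∫ s in (0)..t, (p s * z s + q s * y s) := by
  have hprim : ∀ {g : ℝ → ℂ}, IntervalIntegrable g volume 0 t →
      ContinuousOn (fun s => ∫ r in (0)..s, g r) (uIcc 0 t) := fun hg =>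
    intervalIntegral.continuousOn_primitive_interval' hg left_mem_uIcc
  have e : ∫ s in (0)..t, (p s * z s + q s * y s) = ∫ s in (0)..t,
      ((z 0 * p s + y 0 * q s) + (p s * (∫ r in (0)..s, q r) + q s * ∫ r in (0)..s, p r)) := by
    refine intervalIntegral.integral_congr fun s hs => ?_
    rw [uIcc_of_le ht] at hs
    rw [hy s hs, hz s hs]
    ring
  rw [e, intervalIntegral.integral_add ((hp.const_mul _).add (hq.const_mul _))
    ((hp.mul_continuousOn (hprim hq)).add (hq.mul_continuousOn (hprim hp))),
    ← integral_mul_integral_eq ht hp hq, intervalIntegral.integral_add (hp.const_mul _)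
    (hq.const_mul _), intervalIntegral.integral_const_mul, intervalIntegral.integral_const_mul,
    hy t ⟨ht, le_rfl⟩, hz t ⟨ht, le_rfl⟩]
  ring

/-- A function on an interval whose primitive vanishes at the rational points of the interval
vanishes almost everywhere there. -/
theorem ae_eq_zero_of_integral_rat_eq_zero {H : ℝ → ℂ} {T : ℝ} (hT : 0 ≤ T)
    (hH : IntervalIntegrable H volume 0 T)
    (h : ∀ q : ℚ, (q : ℝ) ∈ Ioo 0 T → ∫ s in (0)..(q : ℝ), H s = 0) :
    ∀ᵐ s ∂(volume.restrict (Ioo 0 T)), H s = 0 := by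
  have hc : ContinuousOn (fun x => ∫ s in (0)..x, H s) (Icc 0 T) := by
    have := intervalIntegral.continuousOn_primitive_interval' hH left_mem_uIcc
    rwa [uIcc_of_le hT] at this
  have h0 : ∀ x ∈ Ioo 0 T, ∫ s in (0)..x, H s = 0 := by
    intro x hx
    have hx' : x ∈ closure (Ioo 0 T ∩ range ((↑) : ℚ → ℝ)) :=
      Rat.denseRange_cast.open_subset_closure_inter isOpen_Ioo hx
    have hcx : ContinuousWithinAt (fun x => ∫ s in (0)..x, H s)
        (Ioo 0 T ∩ range ((↑) : ℚ → ℝ)) x :=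
      (hc x ⟨hx.1.le, hx.2.le⟩).mono (inter_subset_left.trans Ioo_subset_Icc_self)
    have hm := hcx.mem_closure_image hx'
    have himg : (fun x => ∫ s in (0)..x, H s) '' (Ioo 0 T ∩ range ((↑) : ℚ → ℝ)) ⊆ {0} := by
      rintro _ ⟨_, ⟨hq, q, rfl⟩, rfl⟩
      exact h q hq
    simpa using closure_mono himg hm
  rw [ae_restrict_iff' measurableSet_Ioo]
  filter_upwards [hH.ae_hasDerivAt_integral] with x hx hxT
  have hxi : x ∈ uIcc 0 T := by rw [uIcc_of_le hT]; exact ⟨hxT.1.le, hxT.2.le⟩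
  have h1 := hx hxi 0 left_mem_uIcc
  have h2 : HasDerivAt (fun x => ∫ s in (0)..x, H s) 0 x :=
    (hasDerivAt_const x (0 : ℂ)).congr_of_eventuallyEq
      (Filter.eventually_of_mem (isOpen_Ioo.mem_nhds hxT) fun y hy => h0 y hy)
  exact h1.unique h2

/-- A smooth approximation of the indicator function of `(-∞, q)`. -/
noncomputable def smoothStep (n : ℕ) (q t : ℝ) : ℝ := Real.smoothTransition (n * (q - t))

/-- A test function of time whose derivative on positive times is `- smoothStep n q`. -/
noncomputable def timeTest (n : ℕ) (q t : ℝ) : ℝ :=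
  Real.smoothTransition (t + 2) * ∫ s in t..q, smoothStep n q s

theorem contDiff_smoothStep (n : ℕ) (q : ℝ) : ContDiff ℝ ∞ (smoothStep n q) :=
  Real.smoothTransition.contDiff.comp (by fun_prop)

theorem smoothStep_of_le {n : ℕ} {q t : ℝ} (h : q ≤ t) : smoothStep n q t = 0 :=
  Real.smoothTransition.zero_of_nonpos
    (mul_nonpos_of_nonneg_of_nonpos n.cast_nonneg (sub_nonpos.2 h))

theorem hasDerivAt_integral_smoothStep (n : ℕ) (q t : ℝ) :
    HasDerivAt (fun t => ∫ s in t..q, smoothStep n q s) (-smoothStep n q t) t := by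
  have hc := (contDiff_smoothStep n q).continuous
  exact intervalIntegral.integral_hasDerivAt_left (hc.intervalIntegrable _ _)
    (hc.stronglyMeasurableAtFilter _ _) hc.continuousAt

theorem contDiff_timeTest (n : ℕ) (q : ℝ) : ContDiff ℝ ∞ (timeTest n q) := by
  refine (Real.smoothTransition.contDiff.comp (by fun_prop)).mul ?_
  rw [contDiff_infty_iff_deriv]
  refine ⟨fun t => (hasDerivAt_integral_smoothStep n q t).differentiableAt, ?_⟩
  have : deriv (fun t => ∫ s in t..q, smoothStep n q s) = fun t => -smoothStep n q t := by
    ext1 t; exact (hasDerivAt_integral_smoothStep n q t).deriv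
  rw [this]
  exact (contDiff_smoothStep n q).neg

theorem timeTest_of_neg_one_le {n : ℕ} {q t : ℝ} (ht : -1 ≤ t) :
    timeTest n q t = ∫ s in t..q, smoothStep n q s := by
  rw [timeTest, Real.smoothTransition.one_of_one_le (by linarith), one_mul]

theorem integral_smoothStep_of_le {n : ℕ} {q t : ℝ} (h : q ≤ t) :
    ∫ s in t..q, smoothStep n q s = 0 := by
  refine intervalIntegral.integral_zero_ae (.of_forall fun s hs => smoothStep_of_le ?_)
  rw [uIoc_of_ge h] at hs
  exact hs.1.le

theorem deriv_timeTest {n : ℕ} {q t : ℝ} (ht : 0 ≤ t) :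
    deriv (timeTest n q) t = -smoothStep n q t := by
  refine HasDerivAt.deriv ((hasDerivAt_integral_smoothStep n q t).congr_of_eventuallyEq ?_)
  filter_upwards [lt_mem_nhds (show (-1 : ℝ) < t by linarith)] with s hs
  exact timeTest_of_neg_one_le hs.le

theorem tsupport_timeTest_subset (n : ℕ) (q : ℝ) : tsupport (timeTest n q) ⊆ Icc (-2) q := by
  refine closure_minimal (fun t ht => ?_) isClosed_Icc
  by_contra hc
  rw [mem_Icc, not_and_or, not_le, not_le] at hc
  refine ht ?_
  rcases hc with h | h
  · rw [timeTest, Real.smoothTransition.zero_of_nonpos (by linarith), zero_mul]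
  · rw [timeTest, integral_smoothStep_of_le h.le, mul_zero]

theorem hasCompactSupport_timeTest (n : ℕ) (q : ℝ) : HasCompactSupport (timeTest n q) :=
  isCompact_Icc.of_isClosed_subset (isClosed_tsupport _) (tsupport_timeTest_subset n q)

/-- A scalar function which satisfies a differential equation in the weak sense, including the
initial value, is the primitive of the right-hand side. Countably many test functions suffice. -/
theorem ae_eq_add_integral_of_weak_equation {y g : ℝ → ℂ} {y₀ : ℂ} {T : ℝ} (hT : 0 ≤ T)
    (hy : IntervalIntegrable y volume 0 T) (hg : IntervalIntegrable g volume 0 T)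
    (h : ∀ (n : ℕ) (q : ℚ), (q : ℝ) ∈ Ioo 0 T → ((timeTest n q 0 : ℝ) : ℂ) * y₀ +
      ∫ t in Ioo 0 T, (((deriv (timeTest n q) t : ℝ) : ℂ) * y t +
        ((timeTest n q t : ℝ) : ℂ) * g t) = 0) :
    ∀ᵐ t ∂(volume.restrict (Ioo 0 T)), y t = y₀ + ∫ s in (0)..t, g s := by
  set z : ℝ → ℂ := fun t => y₀ + ∫ s in (0)..t, g s with hz
  have hzc : ContinuousOn z (uIcc 0 T) :=
    continuousOn_const.add (intervalIntegral.continuousOn_primitive_interval' hg left_mem_uIcc)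
  have hzi : IntervalIntegrable z volume 0 T := hzc.intervalIntegrable
  have hstep : ∀ (n : ℕ) (q : ℝ), Continuous fun t => ((smoothStep n q t : ℝ) : ℂ) := fun n q =>
    Complex.continuous_ofReal.comp (contDiff_smoothStep n q).continuous
  have key : ∀ (n : ℕ) (q : ℚ), (q : ℝ) ∈ Ioo 0 T →
      ∫ t in (0)..T, ((smoothStep n q t : ℝ) : ℂ) * (y t - z t) = 0 := by
    intro n q hq
    set P : ℝ → ℂ := fun t => ((∫ s in t..(q : ℝ), smoothStep n q s : ℝ) : ℂ) with hP
    have hPc : Continuous P := Complex.continuous_ofReal.comp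
      (continuous_iff_continuousAt.2 fun t => (hasDerivAt_integral_smoothStep n q t).continuousAt)
    have h1 := mul_eq_add_integral (y := P) (z := z)
      (p := fun t => -((smoothStep n q t : ℝ) : ℂ)) (q := g) hT
      ((hstep n q).neg.intervalIntegrable _ _) hg (fun s _ => ?_) (fun s _ => ?_)
    · have hPT : P T = 0 := by
        simp only [hP]
        rw [integral_smoothStep_of_le hq.2.le, Complex.ofReal_zero]
      have hz0 : z 0 = y₀ := by simp [hz]
      have h2 := h n q hq
      rw [← integral_Ioc_eq_integral_Ioo, ← intervalIntegral.integral_of_le hT] at h2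
      have h3 : ∫ t in (0)..T, (((deriv (timeTest n q) t : ℝ) : ℂ) * y t +
          ((timeTest n q t : ℝ) : ℂ) * g t) =
          ∫ t in (0)..T, (-((smoothStep n q t : ℝ) : ℂ) * y t + g t * P t) := by
        refine intervalIntegral.integral_congr fun t ht => ?_
        rw [uIcc_of_le hT] at ht
        rw [deriv_timeTest ht.1, timeTest_of_neg_one_le (by linarith [ht.1])]
        push_cast
        ring
      rw [h3, timeTest_of_neg_one_le (by norm_num)] at h2
      rw [hPT, zero_mul, hz0] at h1
      have j1 : IntervalIntegrable (fun t => -((smoothStep n q t : ℝ) : ℂ) * y t + g t * P t)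
          volume 0 T := (hy.continuousOn_mul (hstep n q).neg.continuousOn).add
            (hg.mul_continuousOn hPc.continuousOn)
      have j2 : IntervalIntegrable (fun t => -((smoothStep n q t : ℝ) : ℂ) * z t + g t * P t)
          volume 0 T := (hzi.continuousOn_mul (hstep n q).neg.continuousOn).add
            (hg.mul_continuousOn hPc.continuousOn)
      have h4 : ∫ t in (0)..T, ((smoothStep n q t : ℝ) : ℂ) * (y t - z t) =
          (∫ t in (0)..T, (-((smoothStep n q t : ℝ) : ℂ) * z t + g t * P t)) -
          ∫ t in (0)..T, (-((smoothStep n q t : ℝ) : ℂ) * y t + g t * P t) := by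
        rw [← intervalIntegral.integral_sub j2 j1]
        congr 1; ext1 t
        ring
      rw [h4]
      linear_combination -h1 - h2
    · have h5 := intervalIntegral.integral_add_adjacent_intervals
        ((contDiff_smoothStep n q).continuous.intervalIntegrable (μ := volume) 0 s)
        ((contDiff_smoothStep n q).continuous.intervalIntegrable (μ := volume) s q)
      simp only [hP]
      rw [intervalIntegral.integral_neg, intervalIntegral.integral_ofReal, ← h5]
      push_cast
      ring
    · simp [hz]
  have hyz := hy.sub hzi
  have := ae_eq_zero_of_integral_rat_eq_zero hT hyz fun q hq => ?_
  · filter_upwards [this] with t ht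
    exact sub_eq_zero.1 ht
  · have hlim : Filter.Tendsto
        (fun n : ℕ => ∫ t in (0)..T, ((smoothStep n q t : ℝ) : ℂ) * (y t - z t)) Filter.atTop
        (nhds (∫ t in (0)..T, (Iio (q : ℝ)).indicator (fun t => y t - z t) t)) := by
      refine intervalIntegral.tendsto_integral_filter_of_dominated_convergence
        (fun t => ‖y t - z t‖) (.of_forall fun n => ?_) (.of_forall fun n => ?_) hyz.norm ?_
      · exact (hyz.continuousOn_mul (hstep n q).continuousOn).def'.aestronglyMeasurable
      · refine .of_forall fun t _ => ?_
        rw [norm_mul, Complex.norm_real, Real.norm_eq_abs, smoothStep,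
          abs_of_nonneg (Real.smoothTransition.nonneg _)]
        exact mul_le_of_le_one_left (norm_nonneg _) (Real.smoothTransition.le_one _)
      · refine .of_forall fun t _ => ?_
        refine tendsto_const_nhds.congr' ?_
        by_cases htq : t < q
        · obtain ⟨N, hN⟩ := exists_nat_gt ((q - t)⁻¹)
          filter_upwards [Filter.eventually_ge_atTop N] with n hn
          have hpos : 0 < (q : ℝ) - t := sub_pos.2 htq
          have : 1 ≤ (n : ℝ) * (q - t) := by
            rw [← inv_le_iff_one_le_mul₀ hpos]
            exact hN.le.trans (by exact_mod_cast hn)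
          rw [indicator_of_mem (by exact htq), smoothStep,
            Real.smoothTransition.one_of_one_le this, Complex.ofReal_one, one_mul]
        · refine .of_forall fun n => ?_
          beta_reduce
          rw [indicator_of_notMem (by exact htq), smoothStep_of_le (not_lt.1 htq),
            Complex.ofReal_zero, zero_mul]
    simp only [key _ q hq] at hlim
    have h6 := tendsto_nhds_unique hlim tendsto_const_nhds
    rw [intervalIntegral.integral_of_le hT, integral_indicator measurableSet_Iio,
      Measure.restrict_restrict measurableSet_Iio] at h6
    rw [intervalIntegral.integral_of_le hq.1.le, integral_Ioc_eq_integral_Ioo, ← h6]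
    congr 2
    ext t
    simp only [mem_inter_iff, mem_Iio, mem_Ioc, mem_Ioo]
    constructor
    · rintro ⟨h1, h2⟩; exact ⟨h2, h1, h2.le.trans hq.2.le⟩
    · rintro ⟨h1, h2, h3⟩; exact ⟨h2, h1⟩

/-! ### From the weak formulation to an equation for each frequency -/

/-- Schwartz functions which localise in frequency. -/
theorem exists_schwartz_eq_one (R : ℝ) :
    ∃ ψ : 𝓢(Plane, ℂ), ∀ ξ ∈ Metric.ball (0 : Plane) R, ψ ξ = 1 := by
  set b : ContDiffBump (0 : Plane) := ⟨max R 1, max R 1 + 1, by positivity, by simp⟩ with hb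
  have h1 : HasCompactSupport (Complex.ofRealCLM ∘ b) := b.hasCompactSupport.comp_left rfl
  have h2 : ContDiff ℝ ∞ (Complex.ofRealCLM ∘ b) := Complex.ofRealCLM.contDiff.comp b.contDiff
  refine ⟨h1.toSchwartzMap h2, fun ξ hξ => ?_⟩
  have h3 : b ξ = 1 := b.one_of_mem_closedBall (by
    rw [mem_closedBall_zero_iff]
    rw [mem_ball_zero_iff] at hξ
    exact hξ.le.trans (le_max_left _ _))
  show ((b ξ : ℝ) : ℂ) = 1
  rw [h3, Complex.ofReal_one]

theorem locallyIntegrable_of_integrable_schwartz_mul {K : Plane → ℂ}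
    (hi : ∀ ψ : 𝓢(Plane, ℂ), Integrable fun ξ => ψ ξ * K ξ) : LocallyIntegrable K := by
  intro x
  obtain ⟨ψ, hψ⟩ := exists_schwartz_eq_one (‖x‖ + 1)
  refine ⟨Metric.ball 0 (‖x‖ + 1), Metric.isOpen_ball.mem_nhds (by simp), ?_⟩
  refine (hi ψ).integrableOn.congr_fun (fun ξ hξ => ?_) measurableSet_ball
  simp only [hψ ξ hξ, one_mul]

theorem ae_intervalIntegrable_of_integrable_schwartz_mul {w : ℝ → Plane → ℂ} {T : ℝ} (hT : 0 ≤ T)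
    (hw : ∀ ψ : 𝓢(Plane, ℂ), Integrable (fun p : ℝ × Plane => ψ p.2 * w p.1 p.2)
      ((volume.restrict (Ioo 0 T)).prod volume)) :
    ∀ᵐ ξ, IntervalIntegrable (fun t => w t ξ) volume 0 T := by
  choose χ hχ using fun N : ℕ => exists_schwartz_eq_one N
  have h1 : ∀ᵐ ξ : Plane, ∀ N : ℕ, IntegrableOn (fun t => χ N ξ * w t ξ) (Ioo 0 T) :=
    ae_all_iff.2 fun N => (hw (χ N)).prod_left_ae
  filter_upwards [h1] with ξ hξ
  obtain ⟨N, hN⟩ := exists_nat_gt ‖ξ‖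
  have h3 := hξ N
  simp only [hχ N ξ (by simpa using hN), one_mul] at h3
  rwa [intervalIntegrable_iff_integrableOn_Ioo_of_le hT]

/-- An evolution equation which holds in the sense of distributions in frequency and time holds
for almost every frequency in integrated form. -/
theorem ae_ae_eq_add_integral_of_weak_equation {y g : ℝ → Plane → ℂ} {y₀ : Plane → ℂ} {T : ℝ}
    (hT : 0 ≤ T)
    (hy : ∀ ψ : 𝓢(Plane, ℂ), Integrable (fun p : ℝ × Plane => ψ p.2 * y p.1 p.2)
      ((volume.restrict (Ioo 0 T)).prod volume))
    (hg : ∀ ψ : 𝓢(Plane, ℂ), Integrable (fun p : ℝ × Plane => ψ p.2 * g p.1 p.2)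
      ((volume.restrict (Ioo 0 T)).prod volume))
    (hy₀ : ∀ ψ : 𝓢(Plane, ℂ), Integrable fun ξ => ψ ξ * y₀ ξ)
    (h : ∀ (n : ℕ) (q : ℚ), (q : ℝ) ∈ Ioo 0 T → ∀ φ : 𝓢(Plane, ℝ),
      ((timeTest n q 0 : ℝ) : ℂ) * (∫ ξ, invFourier φ ξ * y₀ ξ) +
      ∫ t in Ioo 0 T, (((deriv (timeTest n q) t : ℝ) : ℂ) * (∫ ξ, invFourier φ ξ * y t ξ) +
        ((timeTest n q t : ℝ) : ℂ) * ∫ ξ, invFourier φ ξ * g t ξ) = 0) :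
    ∀ᵐ ξ, IntervalIntegrable (fun t => g t ξ) volume 0 T ∧
      ∀ᵐ t ∂(volume.restrict (Ioo 0 T)), y t ξ = y₀ ξ + ∫ s in (0)..t, g s ξ := by
  have hb : ∀ {c : ℝ → ℝ}, Continuous c → HasCompactSupport c → ∀ {w : ℝ → Plane → ℂ},
      (∀ ψ : 𝓢(Plane, ℂ), Integrable (fun p : ℝ × Plane => ψ p.2 * w p.1 p.2)
        ((volume.restrict (Ioo 0 T)).prod volume)) →
      ∀ ψ : 𝓢(Plane, ℂ), Integrable (fun p : ℝ × Plane => ψ p.2 * (((c p.1 : ℝ) : ℂ) * w p.1 p.2))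
        ((volume.restrict (Ioo 0 T)).prod volume) := by
    intro c hc hcc w hw ψ
    obtain ⟨B, hB⟩ := hcc.exists_bound_of_continuous hc
    refine ((hw ψ).bdd_mul (f := fun p : ℝ × Plane => ((c p.1 : ℝ) : ℂ)) (c := B)
      (Continuous.aestronglyMeasurable (by fun_prop)) (.of_forall fun p => ?_)).congr
      (.of_forall fun p => ?_)
    · rw [Complex.norm_real]; exact hB _
    · simp only
      ring
  have hK : ∀ᵐ ξ, ∀ (n : ℕ) (q : ℚ), (q : ℝ) ∈ Ioo 0 T → ((timeTest n q 0 : ℝ) : ℂ) * y₀ ξ +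
      ∫ t in Ioo 0 T, (((deriv (timeTest n q) t : ℝ) : ℂ) * y t ξ +
        ((timeTest n q t : ℝ) : ℂ) * g t ξ) = 0 := by
    refine ae_all_iff.2 fun n => ae_all_iff.2 fun q => ?_
    by_cases hq : (q : ℝ) ∈ Ioo 0 T
    swap
    · exact .of_forall fun ξ hq' => absurd hq' hq
    have hd := contDiff_timeTest n q
    have hj : ∀ ψ : 𝓢(Plane, ℂ), Integrable (fun p : ℝ × Plane => ψ p.2 *
        (((deriv (timeTest n q) p.1 : ℝ) : ℂ) * y p.1 p.2 +
          ((timeTest n q p.1 : ℝ) : ℂ) * g p.1 p.2)) ((volume.restrict (Ioo 0 T)).prod volume) := by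
      intro ψ
      simp only [mul_add]
      exact (hb (hd.continuous_deriv (by norm_num)) (hasCompactSupport_timeTest n q).deriv hy ψ).add
        (hb hd.continuous (hasCompactSupport_timeTest n q) hg ψ)
    have hi : ∀ ψ : 𝓢(Plane, ℂ), Integrable fun ξ => ψ ξ * (((timeTest n q 0 : ℝ) : ℂ) * y₀ ξ +
        ∫ t in Ioo 0 T, (((deriv (timeTest n q) t : ℝ) : ℂ) * y t ξ +
          ((timeTest n q t : ℝ) : ℂ) * g t ξ)) := by
      intro ψ
      refine (((hy₀ ψ).const_mul ((timeTest n q 0 : ℝ) : ℂ)).add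
        (hj ψ).integral_prod_right).congr (.of_forall fun ξ => ?_)
      simp only [Pi.add_apply]
      rw [integral_const_mul]
      ring
    refine (ae_eq_zero_of_integral_invFourier (locallyIntegrable_of_integrable_schwartz_mul hi) hi
      fun φ => ?_).mono fun ξ hξ _ => hξ
    rw [← h n q hq φ, ← integral_const_mul]
    have hs1 := (hb (hd.continuous_deriv (by norm_num)) (hasCompactSupport_timeTest n q).deriv hy
      (invFourier φ)).prod_right_ae
    have hs2 := (hb hd.continuous (hasCompactSupport_timeTest n q) hg
      (invFourier φ)).prod_right_ae
    have e1 : ∫ t in Ioo 0 T, (((deriv (timeTest n q) t : ℝ) : ℂ) *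
        (∫ ξ, invFourier φ ξ * y t ξ) + ((timeTest n q t : ℝ) : ℂ) * ∫ ξ, invFourier φ ξ * g t ξ) =
        ∫ t in Ioo 0 T, ∫ ξ, invFourier φ ξ * (((deriv (timeTest n q) t : ℝ) : ℂ) * y t ξ +
          ((timeTest n q t : ℝ) : ℂ) * g t ξ) := by
      refine integral_congr_ae ?_
      filter_upwards [hs1, hs2] with t h1 h2
      simp only [mul_add]
      rw [integral_add h1 h2, ← integral_const_mul, ← integral_const_mul]
      congr 2 <;> (ext ξ; ring)
    rw [e1, integral_integral_swap (hj (invFourier φ)), ← integral_add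
      ((hy₀ (invFourier φ)).const_mul _) (hj (invFourier φ)).integral_prod_right]
    congr 1; ext ξ
    dsimp only
    rw [integral_const_mul]
    ring
  filter_upwards [hK, ae_intervalIntegrable_of_integrable_schwartz_mul hT hy,
    ae_intervalIntegrable_of_integrable_schwartz_mul hT hg] with ξ h1 h2 h3
  exact ⟨h3, ae_eq_add_integral_of_weak_equation hT h2 h3 h1⟩

/-! ### Bounds for the nonlinear term -/

theorem abs_extFreq_le {m : ℕ} (ξ : Plane) (k : Fin (2 + m)) : |extFreq ξ k| ≤ ‖ξ‖ := by
  induction k using Fin.addCases with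
  | left j => rw [extFreq_castAdd]; exact PiLp.norm_apply_le ξ j
  | right j => rw [extFreq_natAdd, abs_zero]; exact norm_nonneg _

theorem abs_leraySymbol_le {m : ℕ} (i k : Fin (2 + m)) (ξ : Plane) :
    |leraySymbol i k ξ| ≤ 2 * ‖ξ‖ ^ 2 := by
  have h1 : |extFreq ξ i * extFreq ξ k| ≤ ‖ξ‖ ^ 2 := by
    rw [abs_mul, sq]
    exact mul_le_mul (abs_extFreq_le ξ i) (abs_extFreq_le ξ k) (abs_nonneg _) (norm_nonneg _)
  have h2 : |if i = k then ‖ξ‖ ^ 2 else 0| ≤ ‖ξ‖ ^ 2 := by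
    split_ifs
    · rw [abs_of_nonneg (by positivity)]
    · rw [abs_zero]; positivity
  rw [leraySymbol]
  linarith [abs_sub (if i = k then ‖ξ‖ ^ 2 else 0) (extFreq ξ i * extFreq ξ k)]

theorem enorm_conv_le {m : ℕ} (F : Plane → VelC m) (j k : Fin (2 + m)) (ξ : Plane) :
    ‖conv F j k ξ‖ₑ ≤ ∫⁻ η, ‖F η‖ₑ * ‖F (ξ - η)‖ₑ := by
  refine (enorm_integral_le_lintegral_enorm _).trans (lintegral_mono fun η => ?_)
  rw [enorm_mul]
  gcongr
  · rw [← ofReal_norm, ← ofReal_norm]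
    exact ENNReal.ofReal_le_ofReal (PiLp.norm_apply_le _ _)
  · rw [← ofReal_norm, ← ofReal_norm]
    exact ENNReal.ofReal_le_ofReal (PiLp.norm_apply_le _ _)

/-- The nonlinear term is controlled by the convolution of the size of the Fourier transform with
itself. -/
theorem enorm_nonlin_le {m : ℕ} (F : Plane → VelC m) (i : Fin (2 + m)) (ξ : Plane) :
    ‖nonlin F i ξ‖ₑ ≤ ENNReal.ofReal (8 * Real.pi * (2 + m) * ‖ξ‖ ^ 3) *
      ∫⁻ η, ‖F η‖ₑ * ‖F (ξ - η)‖ₑ := by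
  have h1 : ∀ (j : Fin 2) (k : Fin (2 + m)), ‖-(2 * Real.pi * Complex.I) * (ξ j : ℂ) *
      (leraySymbol i k ξ : ℂ) * conv F (Fin.castAdd m j) k ξ‖ₑ ≤
      ENNReal.ofReal (4 * Real.pi * ‖ξ‖ ^ 3) * ∫⁻ η, ‖F η‖ₑ * ‖F (ξ - η)‖ₑ := by
    intro j k
    rw [enorm_mul]
    gcongr
    · rw [← ofReal_norm]
      refine ENNReal.ofReal_le_ofReal ?_
      simp only [norm_mul, norm_neg, Complex.norm_ofNat, Complex.norm_real, Complex.norm_I,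
        Real.norm_eq_abs, abs_of_pos Real.pi_pos, mul_one]
      calc 2 * Real.pi * |ξ j| * |leraySymbol i k ξ| ≤ 2 * Real.pi * ‖ξ‖ * (2 * ‖ξ‖ ^ 2) := by
            gcongr
            · exact PiLp.norm_apply_le ξ j
            · exact abs_leraySymbol_le i k ξ
        _ = 4 * Real.pi * ‖ξ‖ ^ 3 := by ring
    · exact enorm_conv_le F _ k ξ
  refine (enorm_sum_le _ _).trans ((Finset.sum_le_sum fun j _ => (enorm_sum_le _ _).trans
    (Finset.sum_le_sum fun k _ => h1 j k)).trans_eq ?_)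
  simp only [Finset.sum_const, Finset.card_univ, Fintype.card_fin, nsmul_eq_mul]
  rw [← mul_assoc, ← mul_assoc]
  congr 1
  rw [← ENNReal.ofReal_natCast, ← ENNReal.ofReal_natCast, ← ENNReal.ofReal_mul (by positivity),
    ← ENNReal.ofReal_mul (by positivity)]
  congr 1
  push_cast
  ring

theorem conv_congr_ae {m : ℕ} {F G : Plane → VelC m} (h : F =ᵐ[volume] G) (j k : Fin (2 + m))
    (ξ : Plane) : conv F j k ξ = conv G j k ξ := by
  refine integral_congr_ae ?_
  have h2 : ∀ᵐ η, F (ξ - η) = G (ξ - η) :=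
    (Measure.measurePreserving_sub_left volume ξ).quasiMeasurePreserving.ae h
  filter_upwards [h, h2] with η h3 h4
  rw [h3, h4]

theorem nonlin_congr_ae {m : ℕ} {F G : Plane → VelC m} (h : F =ᵐ[volume] G) (i : Fin (2 + m)) :
    nonlin F i = nonlin G i := by
  ext ξ
  simp only [nonlin, conv_congr_ae h]

theorem lintegral_enorm_mul_enorm_sub_le {m : ℕ} {F : Plane → VelC m}
    (hF : StronglyMeasurable F) (ξ : Plane) :
    ∫⁻ η, ‖F η‖ₑ * ‖F (ξ - η)‖ₑ ≤ ∫⁻ η, ‖F η‖ₑ ^ 2 := by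
  have h : ∀ η, ‖F η‖ₑ * ‖F (ξ - η)‖ₑ ≤ 2⁻¹ * (‖F η‖ₑ ^ 2 + ‖F (ξ - η)‖ₑ ^ 2) := fun η => by
    have := two_mul_mul_le_sq_mul_add_sq_mul_inv ‖F η‖ₑ ‖F (ξ - η)‖ₑ (t := 1) (by simp) (by simp)
    simp only [mul_one, inv_one] at this
    calc ‖F η‖ₑ * ‖F (ξ - η)‖ₑ = 2⁻¹ * (2 * (‖F η‖ₑ * ‖F (ξ - η)‖ₑ)) := by
          rw [← mul_assoc, ENNReal.inv_mul_cancel (by norm_num) (by norm_num), one_mul]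
      _ ≤ _ := by gcongr
  refine (lintegral_mono h).trans_eq ?_
  have hm : Measurable fun η => ‖F η‖ₑ ^ 2 := hF.measurable.enorm.pow_const 2
  rw [lintegral_const_mul' _ _ (by norm_num), lintegral_add_left hm,
    lintegral_sub_left_eq_self (fun η => ‖F η‖ₑ ^ 2) ξ, ← two_mul, ← mul_assoc,
    ENNReal.inv_mul_cancel (by norm_num) (by norm_num), one_mul]

/-- The nonlinear term of a jointly measurable field is jointly measurable. -/
theorem stronglyMeasurable_nonlin {m : ℕ} {F : ℝ → Plane → VelC m}
    (hF : StronglyMeasurable (Function.uncurry F)) (i : Fin (2 + m)) :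
    StronglyMeasurable fun p : ℝ × Plane => nonlin (F p.1) i p.2 := by
  have h1 : ∀ k : Fin (2 + m), StronglyMeasurable fun p : ℝ × Plane => F p.1 p.2 k := fun k =>
    (EuclideanSpace.proj k : VelC m →L[ℂ] ℂ).continuous.comp_stronglyMeasurable hF
  have h2 : ∀ j k : Fin (2 + m), StronglyMeasurable fun p : ℝ × Plane => conv (F p.1) j k p.2 := by
    intro j k
    refine StronglyMeasurable.integral_prod_right (f := fun (p : ℝ × Plane) (η : Plane) =>
      F p.1 η j * F p.1 (p.2 - η) k) ?_
    exact ((h1 j).comp_measurable (g := fun q : (ℝ × Plane) × Plane => (q.1.1, q.2))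
      (by fun_prop)).mul ((h1 k).comp_measurable
        (g := fun q : (ℝ × Plane) × Plane => (q.1.1, q.1.2 - q.2)) (by fun_prop))
  simp only [nonlin]
  refine Finset.stronglyMeasurable_fun_sum _ fun j _ =>
    Finset.stronglyMeasurable_fun_sum _ fun k _ => StronglyMeasurable.mul ?_ (h2 _ k)
  refine Measurable.stronglyMeasurable ?_
  simp only [leraySymbol]
  have h3 : ∀ k : Fin (2 + m), Measurable fun p : ℝ × Plane => extFreq p.2 k := by
    intro k
    induction k using Fin.addCases with
    | left j => simp only [extFreq_castAdd]; fun_prop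
    | right j => simp only [extFreq_natAdd]; fun_prop
  have h4 := h3 i
  have h5 := h3 k
  split_ifs <;> fun_prop

theorem exists_schwartz_eq_norm_sq_mul (ψ : 𝓢(Plane, ℂ)) :
    ∃ χ : 𝓢(Plane, ℂ), ∀ ξ, χ ξ = ((‖ξ‖ ^ 2 : ℝ) : ℂ) * ψ ξ := by
  obtain ⟨φ₁, φ₂, h⟩ := exists_eq_invFourier_add ψ
  have h2 : (-(4 * (Real.pi : ℂ) ^ 2)) ≠ 0 := by simp [Real.pi_ne_zero]
  refine ⟨(-(4 * (Real.pi : ℂ) ^ 2))⁻¹ • (invFourier (Δ φ₁) + Complex.I • invFourier (Δ φ₂)),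
    fun ξ => ?_⟩
  rw [smul_apply, add_apply, smul_apply, smul_eq_mul, smul_eq_mul, invFourier_laplacian_apply,
    invFourier_laplacian_apply, h]
  field_simp
  ring

theorem integrable_schwartz_mul_component {m : ℕ} {T B : ℝ} {V : ℝ → Plane → VelC m}
    (hV : StronglyMeasurable (Function.uncurry V))
    (hB : ∀ᵐ t ∂(volume.restrict (Ioo 0 T)), ∫⁻ ξ, ‖V t ξ‖ₑ ^ 2 ≤ ENNReal.ofReal (B ^ 2))
    (i : Fin (2 + m)) (ψ : 𝓢(Plane, ℂ)) :
    Integrable (fun p : ℝ × Plane => ψ p.2 * V p.1 p.2 i)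
      ((volume.restrict (Ioo 0 T)).prod volume) := by
  have hm : StronglyMeasurable fun p : ℝ × Plane => ψ p.2 * V p.1 p.2 i :=
    (ψ.continuous.stronglyMeasurable.comp_measurable measurable_snd).mul
      ((EuclideanSpace.proj i : VelC m →L[ℂ] ℂ).continuous.comp_stronglyMeasurable hV)
  refine ⟨hm.aestronglyMeasurable, ?_⟩
  rw [hasFiniteIntegral_iff_enorm, lintegral_prod _ hm.measurable.enorm.aemeasurable]
  have hψ : ∫⁻ ξ, ‖ψ ξ‖ₑ ^ 2 < ⊤ := by
    have := (eLpNorm_lt_top_iff_lintegral_rpow_enorm_lt_top (by norm_num) (by norm_num)).1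
      (memLp_schwartz ψ).2
    simpa using this
  have hle : ∀ᵐ t ∂(volume.restrict (Ioo 0 T)), ∫⁻ ξ, ‖ψ ξ * V t ξ i‖ₑ ≤
      (∫⁻ ξ, ‖ψ ξ‖ₑ ^ 2) + ENNReal.ofReal (B ^ 2) := by
    filter_upwards [hB] with t ht
    refine le_trans ?_ (add_le_add_right ht _)
    rw [← lintegral_add_left (ψ.continuous.measurable.enorm.pow_const 2)]
    refine lintegral_mono fun ξ => ?_
    have h1 := two_mul_mul_le_sq_mul_add_sq_mul_inv ‖ψ ξ‖ₑ ‖V t ξ‖ₑ (t := 1) (by simp) (by simp)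
    simp only [mul_one, inv_one] at h1
    refine le_trans ?_ h1
    rw [enorm_mul, two_mul]
    refine le_trans ?_ le_self_add
    gcongr
    rw [← ofReal_norm, ← ofReal_norm]
    exact ENNReal.ofReal_le_ofReal (PiLp.norm_apply_le _ _)
  refine (lintegral_mono_ae hle).trans_lt ?_
  rw [lintegral_const]
  exact ENNReal.mul_lt_top (ENNReal.add_lt_top.2 ⟨hψ, ENNReal.ofReal_lt_top⟩) (by simp)

theorem integrable_schwartz_mul_nonlin {m : ℕ} {T B : ℝ} {U : ℝ → Plane → VelC m}
    (hU : StronglyMeasurable (Function.uncurry U))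
    (hB : ∀ᵐ t ∂(volume.restrict (Ioo 0 T)), ∫⁻ ξ, ‖U t ξ‖ₑ ^ 2 ≤ ENNReal.ofReal (B ^ 2))
    (i : Fin (2 + m)) (ψ : 𝓢(Plane, ℂ)) :
    Integrable (fun p : ℝ × Plane => ψ p.2 * nonlin (U p.1) i p.2)
      ((volume.restrict (Ioo 0 T)).prod volume) := by
  have hm : StronglyMeasurable fun p : ℝ × Plane => ψ p.2 * nonlin (U p.1) i p.2 :=
    (ψ.continuous.stronglyMeasurable.comp_measurable measurable_snd).mul
      (stronglyMeasurable_nonlin hU i)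
  refine ⟨hm.aestronglyMeasurable, ?_⟩
  rw [hasFiniteIntegral_iff_enorm, lintegral_prod _ hm.measurable.enorm.aemeasurable]
  set K := 8 * Real.pi * (2 + m) with hK
  have hψ : ∫⁻ ξ : Plane, ENNReal.ofReal (K * ‖ξ‖ ^ 3) * ‖ψ ξ‖ₑ < ⊤ := by
    have := ((ψ.integrable_pow_mul volume 3).const_mul K).2
    rw [hasFiniteIntegral_iff_enorm] at this
    refine lt_of_eq_of_lt (lintegral_congr fun ξ => ?_) this
    rw [← ofReal_norm, ← ofReal_norm, ← ENNReal.ofReal_mul (by positivity)]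
    rw [Real.norm_of_nonneg (by positivity), mul_assoc]
  have hle : ∀ᵐ t ∂(volume.restrict (Ioo 0 T)), ∫⁻ ξ, ‖ψ ξ * nonlin (U t) i ξ‖ₑ ≤
      (∫⁻ ξ : Plane, ENNReal.ofReal (K * ‖ξ‖ ^ 3) * ‖ψ ξ‖ₑ) * ENNReal.ofReal (B ^ 2) := by
    filter_upwards [hB] with t ht
    rw [← lintegral_mul_const' _ _ ENNReal.ofReal_ne_top]
    refine lintegral_mono fun ξ => ?_
    have h1 := enorm_nonlin_le (U t) i ξ
    have h2 := (lintegral_enorm_mul_enorm_sub_le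
      (hU.comp_measurable (measurable_const.prodMk measurable_id) : StronglyMeasurable (U t)) ξ).trans ht
    rw [enorm_mul, mul_comm (ENNReal.ofReal _) ‖ψ ξ‖ₑ, mul_assoc]
    gcongr
    exact h1.trans (by gcongr; exact h2)
  refine (lintegral_mono_ae hle).trans_lt ?_
  rw [lintegral_const]
  exact ENNReal.mul_lt_top (ENNReal.mul_lt_top hψ ENNReal.ofReal_lt_top) (by simp)

theorem lintegral_enorm_sq_le_of_norm_le {m : ℕ} {F : Plane → VelC m} {f : L2Vel m} {B : ℝ}
    (h : F =ᵐ[volume] fourierL2 f) (hf : ‖f‖ ≤ B) :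
    ∫⁻ ξ, ‖F ξ‖ₑ ^ 2 ≤ ENNReal.ofReal (B ^ 2) := by
  have : ∫⁻ ξ, ‖F ξ‖ₑ ^ 2 = ∫⁻ ξ, ‖fourierL2 f ξ‖ₑ ^ 2 :=
    lintegral_congr_ae (h.mono fun ξ hξ => by simp only [hξ])
  rw [this, lintegral_enorm_fourierL2_sq]
  exact ENNReal.ofReal_le_ofReal (pow_le_pow_left₀ (norm_nonneg _) hf 2)

theorem exists_norm_le_of_memLp_top {m : ℕ} {T : ℝ} {v : ℝ → L2Vel m}
    (hv : MemLp v ⊤ (volume.restrict (Ioo 0 T))) :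
    ∃ B, ∀ᵐ t ∂(volume.restrict (Ioo 0 T)), ‖v t‖ ≤ B := by
  refine ⟨(eLpNorm v ⊤ (volume.restrict (Ioo 0 T))).toReal, ?_⟩
  have h := ae_le_eLpNormEssSup (f := v) (μ := volume.restrict (Ioo 0 T))
  filter_upwards [h] with t ht
  rw [← eLpNorm_exponent_top] at ht
  rw [← toReal_enorm]
  exact ENNReal.toReal_mono hv.2.ne ht

/-- For almost every frequency, the components of `V` satisfy
`∂ₜ V_i = - 4 π² |ξ|² V_i + |ξ|⁻² nonlin U i` with the initial value `F₀`, in integrated form and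
for almost every time. The integrability of the right-hand side is a part of the condition. -/
abbrev FrequencyEquation {m : ℕ} (T : ℝ) (F₀ : Plane → VelC m) (U V : ℝ → Plane → VelC m) : Prop :=
  ∀ᵐ ξ : Plane, ∀ i : Fin (2 + m),
    IntervalIntegrable (fun t => nonlin (U t) i ξ / ((‖ξ‖ ^ 2 : ℝ) : ℂ)) volume 0 T ∧
    IntervalIntegrable (fun t => V t ξ i) volume 0 T ∧
    ∀ᵐ t ∂(volume.restrict (Ioo 0 T)), V t ξ i = F₀ ξ i +
      ∫ s in (0)..t, (-(((4 * Real.pi ^ 2 * ‖ξ‖ ^ 2 : ℝ)) : ℂ) * V s ξ i +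
        nonlin (U s) i ξ / ((‖ξ‖ ^ 2 : ℝ) : ℂ))

/-- The Fourier transform of a solution satisfies the equation for almost every frequency. The
weak formulation gives the equation multiplied by `|ξ|²`, which is divided out at the end. -/
theorem IsWeakSolution.ae_frequency_equation {m : ℕ} {T : ℝ} {u₀ : L2Vel m} {u v : ℝ → L2Vel m}
    (hT : 0 ≤ T) (h : IsWeakSolution T u₀ u v) (h0 : IsDivFree u₀)
    (hu : MemLp u ⊤ (volume.restrict (Ioo 0 T))) {U V : ℝ → Plane → VelC m}
    (hU : StronglyMeasurable (Function.uncurry U)) (hV : StronglyMeasurable (Function.uncurry V))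
    (hUu : ∀ᵐ t ∂(volume.restrict (Ioo 0 T)), U t =ᵐ[volume] fourierL2 (u t))
    (hVv : ∀ᵐ t ∂(volume.restrict (Ioo 0 T)), V t =ᵐ[volume] fourierL2 (v t)) :
    FrequencyEquation T (fourierL2 u₀) U V := by
  obtain ⟨A, hA⟩ := exists_norm_le_of_memLp_top hu
  obtain ⟨B, hB⟩ := exists_norm_le_of_memLp_top h.memLp_top
  have hUA : ∀ᵐ t ∂(volume.restrict (Ioo 0 T)), ∫⁻ ξ, ‖U t ξ‖ₑ ^ 2 ≤ ENNReal.ofReal (A ^ 2) := by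
    filter_upwards [hA, hUu] with t h1 h2 using lintegral_enorm_sq_le_of_norm_le h2 h1
  have hVB : ∀ᵐ t ∂(volume.restrict (Ioo 0 T)), ∫⁻ ξ, ‖V t ξ‖ₑ ^ 2 ≤ ENNReal.ofReal (B ^ 2) := by
    filter_upwards [hB, hVv] with t h1 h2 using lintegral_enorm_sq_le_of_norm_le h2 h1
  refine ae_all_iff.2 fun i => ?_
  have i1 : ∀ ψ : 𝓢(Plane, ℂ), Integrable (fun p : ℝ × Plane =>
      ψ p.2 * (((‖p.2‖ ^ 2 : ℝ) : ℂ) * V p.1 p.2 i)) ((volume.restrict (Ioo 0 T)).prod volume) := by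
    intro ψ
    obtain ⟨χ, hχ⟩ := exists_schwartz_eq_norm_sq_mul ψ
    refine (integrable_schwartz_mul_component hV hVB i χ).congr (.of_forall fun p => ?_)
    simp only [hχ]
    ring
  have i2 : ∀ ψ : 𝓢(Plane, ℂ), Integrable (fun p : ℝ × Plane =>
      ψ p.2 * (-(4 * Real.pi ^ 2) * ((‖p.2‖ ^ 2 : ℝ) : ℂ) * (((‖p.2‖ ^ 2 : ℝ) : ℂ) * V p.1 p.2 i)))
      ((volume.restrict (Ioo 0 T)).prod volume) := by
    intro ψ
    obtain ⟨χ, hχ⟩ := exists_schwartz_eq_norm_sq_mul ψ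
    refine ((i1 χ).const_mul (-(4 * (Real.pi : ℂ) ^ 2))).congr (.of_forall fun p => ?_)
    simp only [hχ]
    ring
  have i3 := integrable_schwartz_mul_nonlin hU hUA i
  have key := ae_ae_eq_add_integral_of_weak_equation (T := T)
    (y := fun t ξ => ((‖ξ‖ ^ 2 : ℝ) : ℂ) * V t ξ i)
    (g := fun t ξ => -(4 * Real.pi ^ 2) * ((‖ξ‖ ^ 2 : ℝ) : ℂ) * (((‖ξ‖ ^ 2 : ℝ) : ℂ) * V t ξ i) +
      nonlin (U t) i ξ) (y₀ := fun ξ => ((‖ξ‖ ^ 2 : ℝ) : ℂ) * fourierL2 u₀ ξ i) hT i1 ?_ ?_ ?_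
  · have hv : ∀ᵐ ξ : Plane, IntervalIntegrable (fun t => V t ξ i) volume 0 T :=
      ae_intervalIntegrable_of_integrable_schwartz_mul hT
        (integrable_schwartz_mul_component hV hVB i)
    filter_upwards [key, hv, ae_norm_pos] with ξ h1 h2 h3
    have hξ : ((‖ξ‖ ^ 2 : ℝ) : ℂ) ≠ 0 := by
      rw [Complex.ofReal_ne_zero]; positivity
    have h4 : IntervalIntegrable (fun t => nonlin (U t) i ξ / ((‖ξ‖ ^ 2 : ℝ) : ℂ)) volume 0 T := by
      have := (h1.1.add (h2.const_mul ((4 * Real.pi ^ 2) * ((‖ξ‖ ^ 2 : ℝ) : ℂ) ^ 2))).div_const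
        ((‖ξ‖ ^ 2 : ℝ) : ℂ)
      refine this.congr fun t _ => ?_
      congr 1
      ring
    refine ⟨h4, h2, ?_⟩
    filter_upwards [h1.2] with t ht
    refine mul_left_cancel₀ hξ (ht.trans ?_)
    rw [mul_add, ← intervalIntegral.integral_const_mul]
    congr 2
    ext s
    field_simp
    push_cast
    ring
  · intro ψ
    simp only [mul_add]
    refine ((i2 ψ).add (i3 ψ)).congr (.of_forall fun p => ?_)
    simp only [Pi.add_apply]
  · intro ψ
    obtain ⟨χ, hχ⟩ := exists_schwartz_eq_norm_sq_mul ψ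
    refine (integrable_schwartz_mul_apply u₀ i χ).congr (.of_forall fun p => ?_)
    simp only [hχ]
    ring
  · intro n q hq φ
    refine Eq.trans ?_ (h.fourier_equation h0 i (contDiff_timeTest n q)
      (hasCompactSupport_timeTest n q)
      ((tsupport_timeTest_subset n q).trans fun t ht => ht.2.trans_lt hq.2) φ)
    congr 1
    refine integral_congr_ae ?_
    filter_upwards [hUu, hVv, (i2 (invFourier φ)).prod_right_ae, (i3 (invFourier φ)).prod_right_ae]
      with t h1 h2 h3 h4
    have e1 : ∫ ξ : Plane, invFourier φ ξ * (((‖ξ‖ ^ 2 : ℝ) : ℂ) * V t ξ i) =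
        ∫ ξ : Plane, invFourier φ ξ * (((‖ξ‖ ^ 2 : ℝ) : ℂ) * fourierL2 (v t) ξ i) :=
      integral_congr_ae (h2.mono fun ξ hξ => by simp only [hξ])
    have e2 : ∫ ξ : Plane, invFourier φ ξ * (-(4 * Real.pi ^ 2) * ((‖ξ‖ ^ 2 : ℝ) : ℂ) *
        (((‖ξ‖ ^ 2 : ℝ) : ℂ) * V t ξ i)) = ∫ ξ : Plane, invFourier φ ξ * (-(4 * Real.pi ^ 2) *
        ((‖ξ‖ ^ 2 : ℝ) : ℂ) * (((‖ξ‖ ^ 2 : ℝ) : ℂ) * fourierL2 (v t) ξ i)) :=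
      integral_congr_ae (h2.mono fun ξ hξ => by simp only [hξ])
    simp only [mul_add] at h3 h4 ⊢
    rw [integral_add h3 h4, e1, e2, nonlin_congr_ae h1]
    ring

/-! ### The scalar damped equation -/

/-- A solution in the almost everywhere sense has an absolutely continuous representative. -/
theorem exists_continuousOn_of_ae_eq_add_integral {y h : ℝ → ℂ} {y₀ : ℂ} {T l : ℝ} (hT : 0 ≤ T)
    (hy : IntervalIntegrable y volume 0 T) (hh : IntervalIntegrable h volume 0 T)
    (heq : ∀ᵐ t ∂(volume.restrict (Ioo 0 T)), y t = y₀ + ∫ s in (0)..t, (-(l : ℂ) * y s + h s)) :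
    ∃ z : ℝ → ℂ, ContinuousOn z (Icc 0 T) ∧ z 0 = y₀ ∧
      (∀ᵐ t ∂(volume.restrict (Ioo 0 T)), y t = z t) ∧
      ∀ t ∈ Icc 0 T, z t = z 0 + ∫ s in (0)..t, (-(l : ℂ) * z s + h s) := by
  have hi : IntervalIntegrable (fun s => -(l : ℂ) * y s + h s) volume 0 T :=
    (hy.const_mul _).add hh
  refine ⟨fun t => y₀ + ∫ s in (0)..t, (-(l : ℂ) * y s + h s), ?_, by simp, heq, fun t ht => ?_⟩
  · have := intervalIntegral.continuousOn_primitive_interval' hi left_mem_uIcc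
    rw [uIcc_of_le hT] at this
    exact continuousOn_const.add this
  · simp only [intervalIntegral.integral_same, add_zero]
    congr 1
    rw [intervalIntegral.integral_of_le ht.1, intervalIntegral.integral_of_le ht.1,
      integral_Ioc_eq_integral_Ioo, integral_Ioc_eq_integral_Ioo]
    refine integral_congr_ae ?_
    filter_upwards [ae_restrict_of_ae_restrict_of_subset (Ioo_subset_Ioo_right ht.2) heq] with s hs
    rw [← hs]

/-- Duhamel's formula, as an estimate. -/
theorem ae_enorm_le_of_ae_eq_add_integral {y h : ℝ → ℂ} {y₀ : ℂ} {T l : ℝ} (hT : 0 ≤ T)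
    (hy : IntervalIntegrable y volume 0 T) (hh : IntervalIntegrable h volume 0 T)
    (heq : ∀ᵐ t ∂(volume.restrict (Ioo 0 T)), y t = y₀ + ∫ s in (0)..t, (-(l : ℂ) * y s + h s)) :
    ∀ᵐ t ∂(volume.restrict (Ioo 0 T)), ‖y t‖ₑ ≤ ENNReal.ofReal (Real.exp (-(l * t))) * ‖y₀‖ₑ +
      ∫⁻ s in Ioo 0 t, ENNReal.ofReal (Real.exp (-(l * (t - s)))) * ‖h s‖ₑ := by
  obtain ⟨z, hzc, hz0, hyz, hz⟩ := exists_continuousOn_of_ae_eq_add_integral hT hy hh heq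
  filter_upwards [hyz, ae_restrict_mem measurableSet_Ioo] with t ht htT
  have hsub : uIcc 0 t ⊆ uIcc 0 T := by
    rw [uIcc_of_le hT, uIcc_of_le htT.1.le]; exact Icc_subset_Icc_right htT.2.le
  have hh' := hh.mono_set hsub
  have hzc' : ContinuousOn z (uIcc 0 t) := hzc.mono (by rwa [← uIcc_of_le hT])
  have hE : Continuous fun s : ℝ => ((Real.exp (l * s) : ℝ) : ℂ) := by fun_prop
  have h1 := mul_eq_add_integral (y := z) (z := fun s => ((Real.exp (l * s) : ℝ) : ℂ))
    (p := fun s => -(l : ℂ) * z s + h s) (q := fun s => (l : ℂ) * ((Real.exp (l * s) : ℝ) : ℂ))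
    htT.1.le ((hzc'.intervalIntegrable.const_mul _).add hh')
    ((hE.const_mul (l : ℂ)).intervalIntegrable _ _)
    (fun s hs => hz s ⟨hs.1, hs.2.trans htT.2.le⟩) (fun s _ => ?_)
  · have h2 : ∫ s in (0)..t, ((-(l : ℂ) * z s + h s) * ((Real.exp (l * s) : ℝ) : ℂ) +
        (l : ℂ) * ((Real.exp (l * s) : ℝ) : ℂ) * z s) =
        ∫ s in (0)..t, ((Real.exp (l * s) : ℝ) : ℂ) * h s := by
      congr 1; ext s; ring
    have h3 : z t = ((Real.exp (-(l * t)) : ℝ) : ℂ) * y₀ +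
        ∫ s in (0)..t, ((Real.exp (-(l * (t - s))) : ℝ) : ℂ) * h s := by
      have h4 : ∀ s, ((Real.exp (-(l * (t - s))) : ℝ) : ℂ) * h s =
          ((Real.exp (-(l * t)) : ℝ) : ℂ) * (((Real.exp (l * s) : ℝ) : ℂ) * h s) := by
        intro s
        rw [← mul_assoc, ← Complex.ofReal_mul, ← Real.exp_add]
        congr 3; ring
      simp_rw [h4]
      rw [intervalIntegral.integral_const_mul, ← h2]
      have h5 : ((Real.exp (-(l * t)) : ℝ) : ℂ) * ((Real.exp (l * t) : ℝ) : ℂ) = 1 := by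
        rw [← Complex.ofReal_mul, ← Real.exp_add]; simp
      simp only [mul_zero, Real.exp_zero, Complex.ofReal_one, mul_one, hz0] at h1
      rw [← mul_add, ← h1]
      linear_combination (-z t) * h5
    rw [ht, h3]
    refine (enorm_add_le _ _).trans (add_le_add ?_ ?_)
    · rw [enorm_mul, ← ofReal_norm (((Real.exp (-(l * t)) : ℝ) : ℂ)), Complex.norm_real,
        Real.norm_of_nonneg (Real.exp_pos _).le]
    · rw [intervalIntegral.integral_of_le htT.1.le, integral_Ioc_eq_integral_Ioo]
      refine (enorm_integral_le_lintegral_enorm _).trans_eq (lintegral_congr fun s => ?_)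
      rw [enorm_mul, ← ofReal_norm (((Real.exp (-(l * (t - s))) : ℝ) : ℂ)), Complex.norm_real,
        Real.norm_of_nonneg (Real.exp_pos _).le]
  · have hd : ∀ x ∈ uIcc 0 s, HasDerivAt (fun s => ((Real.exp (l * s) : ℝ) : ℂ))
        ((l : ℂ) * ((Real.exp (l * x) : ℝ) : ℂ)) x := by
      intro x _
      have := ((hasDerivAt_id x).const_mul l).exp.ofReal_comp
      convert! this using 1
      simp [mul_comm]
    rw [intervalIntegral.integral_eq_sub_of_hasDerivAt hd
      ((hE.const_mul (l : ℂ)).intervalIntegrable _ _)]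
    ring

/-- The energy identity of the damped equation. -/
theorem ae_norm_sq_add_eq_of_ae_eq_add_integral {y h : ℝ → ℂ} {y₀ : ℂ} {T l : ℝ} (hT : 0 ≤ T)
    (hy : IntervalIntegrable y volume 0 T) (hh : IntervalIntegrable h volume 0 T)
    (heq : ∀ᵐ t ∂(volume.restrict (Ioo 0 T)), y t = y₀ + ∫ s in (0)..t, (-(l : ℂ) * y s + h s)) :
    IntegrableOn (fun s => ‖y s‖ ^ 2) (Ioo 0 T) ∧
    IntegrableOn (fun s => (h s * (starRingEnd ℂ) (y s)).re) (Ioo 0 T) ∧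
    ∀ᵐ t ∂(volume.restrict (Ioo 0 T)), ‖y t‖ ^ 2 + 2 * l * (∫ s in Ioo 0 t, ‖y s‖ ^ 2) =
      ‖y₀‖ ^ 2 + 2 * ∫ s in Ioo 0 t, (h s * (starRingEnd ℂ) (y s)).re := by
  obtain ⟨z, hzc, hz0, hyz, hz⟩ := exists_continuousOn_of_ae_eq_add_integral hT hy hh heq
  refine ⟨?_, ?_, ?_⟩
  · have h1 : IntegrableOn (fun s => ‖z s‖ ^ 2) (Ioo 0 T) :=
      ((hzc.norm.pow 2).integrableOn_Icc).mono_set Ioo_subset_Icc_self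
    exact h1.congr (hyz.mono fun s hs => by simp only [hs])
  · have h1 : IntervalIntegrable (fun s => h s * (starRingEnd ℂ) (z s)) volume 0 T :=
      hh.mul_continuousOn (Complex.continuous_conj.comp_continuousOn (by rwa [uIcc_of_le hT]))
    rw [intervalIntegrable_iff_integrableOn_Ioo_of_le hT] at h1
    exact (Complex.reCLM.integrable_comp h1).congr
      (hyz.mono fun s hs => by simp only [hs, Complex.reCLM_apply])
  filter_upwards [hyz, ae_restrict_mem measurableSet_Ioo] with t ht htT
  have hsub : uIcc 0 t ⊆ uIcc 0 T := by
    rw [uIcc_of_le hT, uIcc_of_le htT.1.le]; exact Icc_subset_Icc_right htT.2.le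
  have hh' := hh.mono_set hsub
  have hzc' : ContinuousOn z (uIcc 0 t) := hzc.mono (by rwa [← uIcc_of_le hT])
  have hp : IntervalIntegrable (fun s => -(l : ℂ) * z s + h s) volume 0 t :=
    (hzc'.intervalIntegrable.const_mul _).add hh'
  have hpc : IntervalIntegrable (fun s => (starRingEnd ℂ) (-(l : ℂ) * z s + h s)) volume 0 t :=
    ⟨(Complex.conjCLE.toContinuousLinearMap.integrable_comp hp.1),
      (Complex.conjCLE.toContinuousLinearMap.integrable_comp hp.2)⟩
  have h1 := mul_eq_add_integral (y := z) (z := fun s => (starRingEnd ℂ) (z s))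
    (p := fun s => -(l : ℂ) * z s + h s) (q := fun s => (starRingEnd ℂ) (-(l : ℂ) * z s + h s))
    htT.1.le hp hpc (fun s hs => hz s ⟨hs.1, hs.2.trans htT.2.le⟩) (fun s hs => ?_)
  · have hzz : ContinuousOn (fun s => (starRingEnd ℂ) (z s)) (uIcc 0 t) :=
      Complex.continuous_conj.comp_continuousOn hzc'
    have i1 : IntervalIntegrable (fun s => ‖z s‖ ^ 2) volume 0 t :=
      (hzc'.norm.pow 2).intervalIntegrable
    have i2' : IntervalIntegrable (fun s => h s * (starRingEnd ℂ) (z s)) volume 0 t :=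
      hh'.mul_continuousOn hzz
    have i2 : IntervalIntegrable (fun s => (h s * (starRingEnd ℂ) (z s)).re) volume 0 t :=
      ⟨Complex.reCLM.integrable_comp i2'.1, Complex.reCLM.integrable_comp i2'.2⟩
    have e1 : ∫ s in (0)..t, ((-(l : ℂ) * z s + h s) * (starRingEnd ℂ) (z s) +
        (starRingEnd ℂ) (-(l : ℂ) * z s + h s) * z s) =
        ((∫ s in (0)..t, (-(2 * l) * ‖z s‖ ^ 2 + 2 * (h s * (starRingEnd ℂ) (z s)).re) : ℝ) : ℂ) := by
      rw [← intervalIntegral.integral_ofReal]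
      congr 1; ext s
      have hn : ((‖z s‖ ^ 2 : ℝ) : ℂ) = z s * (starRingEnd ℂ) (z s) := by
        rw [Complex.mul_conj, Complex.normSq_eq_norm_sq]
      have hr : ((2 * (h s * (starRingEnd ℂ) (z s)).re : ℝ) : ℂ) =
          h s * (starRingEnd ℂ) (z s) + (starRingEnd ℂ) (h s) * z s := by
        have := Complex.add_conj (h s * (starRingEnd ℂ) (z s))
        rw [map_mul, Complex.conj_conj] at this
        exact this.symm
      rw [Complex.ofReal_add, hr, Complex.ofReal_mul, hn]
      simp only [map_add, map_mul, map_neg, Complex.conj_ofReal]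
      push_cast
      ring
    rw [e1, Complex.mul_conj, Complex.mul_conj, ← Complex.ofReal_add, Complex.ofReal_inj,
      Complex.normSq_eq_norm_sq, Complex.normSq_eq_norm_sq, hz0,
      intervalIntegral.integral_add (i1.const_mul _) (i2.const_mul _),
      intervalIntegral.integral_const_mul, intervalIntegral.integral_const_mul,
      intervalIntegral.integral_of_le htT.1.le, intervalIntegral.integral_of_le htT.1.le,
      integral_Ioc_eq_integral_Ioo, integral_Ioc_eq_integral_Ioo] at h1
    have hyz' := ae_restrict_of_ae_restrict_of_subset (Ioo_subset_Ioo_right htT.2.le) hyz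
    have e2 : ∫ s in Ioo 0 t, ‖y s‖ ^ 2 = ∫ s in Ioo 0 t, ‖z s‖ ^ 2 :=
      integral_congr_ae (hyz'.mono fun s hs => by simp only [hs])
    have e3 : ∫ s in Ioo 0 t, (h s * (starRingEnd ℂ) (y s)).re =
        ∫ s in Ioo 0 t, (h s * (starRingEnd ℂ) (z s)).re :=
      integral_congr_ae (hyz'.mono fun s hs => by simp only [hs])
    rw [ht, e2, e3]
    linarith
  · have h2 : (starRingEnd ℂ) (∫ r in (0)..s, (-(l : ℂ) * z r + h r)) =
        ∫ r in (0)..s, (starRingEnd ℂ) (-(l : ℂ) * z r + h r) := by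
      rw [intervalIntegral.integral_of_le hs.1, intervalIntegral.integral_of_le hs.1, integral_conj]
    rw [hz s ⟨hs.1, hs.2.trans htT.2.le⟩, map_add, h2]

/-! ### Estimates for the heat flow -/

theorem lintegral_Ioi_exp_neg {c : ℝ} (hc : 0 < c) (s : ℝ) :
    ∫⁻ t in Ioi s, ENNReal.ofReal (Real.exp (-(c * (t - s)))) = ENNReal.ofReal (1 / c) := by
  have h1 : ∀ t, Real.exp (-(c * (t - s))) = Real.exp (c * s) * Real.exp (-c * t) := fun t => by
    rw [← Real.exp_add]; congr 1; ring
  simp_rw [h1]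
  rw [← ofReal_integral_eq_lintegral_ofReal
    ((integrableOn_exp_mul_Ioi (neg_lt_zero.2 hc) s).const_mul _)
    (.of_forall fun t => by positivity),
    integral_const_mul, integral_exp_mul_Ioi (neg_lt_zero.2 hc), neg_div_neg_eq, ← mul_div_assoc,
    ← Real.exp_add]
  congr 2
  rw [← Real.exp_zero]
  congr 1; ring

theorem lintegral_sq_lintegral_eq {E : ℝ → Plane → ℝ≥0∞} (hE : Measurable (Function.uncurry E))
    (I : Set ℝ) : ∫⁻ t in I, (∫⁻ ξ, E t ξ) ^ 2 = ∫⁻ ξ, ∫⁻ η, ∫⁻ t in I, E t ξ * E t η := by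
  have hEξ : ∀ t, Measurable (E t) := fun t => hE.comp measurable_prodMk_left
  have h1 : ∀ t, (∫⁻ ξ, E t ξ) ^ 2 = ∫⁻ ξ, ∫⁻ η, E t ξ * E t η := by
    intro t
    have : ∀ ξ, ∫⁻ η, E t ξ * E t η = E t ξ * ∫⁻ η, E t η := fun ξ => lintegral_const_mul _ (hEξ t)
    simp_rw [this]
    rw [lintegral_mul_const _ (hEξ t), sq]
  have hm : Measurable fun q : (ℝ × Plane) × Plane => E q.1.1 q.1.2 * E q.1.1 q.2 :=
    (hE.comp (g := Function.uncurry E) (f := fun q : (ℝ × Plane) × Plane => (q.1.1, q.1.2))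
      (by fun_prop)).mul (hE.comp (g := Function.uncurry E)
      (f := fun q : (ℝ × Plane) × Plane => (q.1.1, q.2)) (by fun_prop))
  simp_rw [h1]
  rw [lintegral_lintegral_swap hm.lintegral_prod_right'.aemeasurable]
  refine lintegral_congr fun ξ => ?_
  rw [lintegral_lintegral_swap]
  exact (hm.comp (f := fun q : ℝ × Plane => ((q.1, ξ), q.2)) (by fun_prop)).aemeasurable

/-- The free heat flow with square integrable data has a Fourier transform in `L²_t L¹_ξ`. -/
theorem lintegral_sq_lintegral_heat_le {f : Plane → ℝ≥0∞} (hf : Measurable f) (T : ℝ) :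
    ∫⁻ t in Ioo 0 T, (∫⁻ ξ : Plane,
      ENNReal.ofReal (Real.exp (-(4 * Real.pi ^ 2 * ‖ξ‖ ^ 2 * t))) * f ξ) ^ 2 ≤
      ENNReal.ofReal (1 / Real.pi) * ∫⁻ ξ, f ξ ^ 2 := by
  have hEm : Measurable (Function.uncurry fun (t : ℝ) (ξ : Plane) =>
      ENNReal.ofReal (Real.exp (-(4 * Real.pi ^ 2 * ‖ξ‖ ^ 2 * t))) * f ξ) := by
    unfold Function.uncurry; fun_prop
  refine (lintegral_mono_set Ioo_subset_Ioi_self).trans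
    ((lintegral_sq_lintegral_eq hEm (Ioi 0)).trans_le ?_)
  calc _
    _ ≤ ∫⁻ ξ, ∫⁻ η, ENNReal.ofReal (1 / (4 * Real.pi ^ 2)) *
          (ENNReal.ofReal (1 / (‖ξ‖ ^ 2 + ‖η‖ ^ 2)) * (f ξ * f η)) := by
        refine lintegral_mono_ae ?_
        filter_upwards [ae_norm_pos] with ξ hξ
        refine lintegral_mono fun η => le_of_eq ?_
        have hc : 0 < 4 * Real.pi ^ 2 * (‖ξ‖ ^ 2 + ‖η‖ ^ 2) := by positivity
        have h2 : ∀ t, ENNReal.ofReal (Real.exp (-(4 * Real.pi ^ 2 * ‖ξ‖ ^ 2 * t))) * f ξ *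
            (ENNReal.ofReal (Real.exp (-(4 * Real.pi ^ 2 * ‖η‖ ^ 2 * t))) * f η) = ENNReal.ofReal
            (Real.exp (-(4 * Real.pi ^ 2 * (‖ξ‖ ^ 2 + ‖η‖ ^ 2) * (t - 0)))) * (f ξ * f η) := by
          intro t
          have : Real.exp (-(4 * Real.pi ^ 2 * (‖ξ‖ ^ 2 + ‖η‖ ^ 2) * (t - 0))) =
              Real.exp (-(4 * Real.pi ^ 2 * ‖ξ‖ ^ 2 * t)) *
                Real.exp (-(4 * Real.pi ^ 2 * ‖η‖ ^ 2 * t)) := by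
            rw [← Real.exp_add]; congr 1; ring
          rw [this, ENNReal.ofReal_mul (Real.exp_pos _).le]
          ring
        simp_rw [h2]
        rw [lintegral_mul_const _ (by fun_prop), lintegral_Ioi_exp_neg hc,
          ← mul_assoc (ENNReal.ofReal (1 / (4 * Real.pi ^ 2))),
              ← ENNReal.ofReal_mul (by positivity)]
        congr 2
        field_simp
    _ ≤ ENNReal.ofReal (1 / (4 * Real.pi ^ 2)) * (ENNReal.ofReal (4 * Real.pi) *
        ∫⁻ ξ, f ξ ^ 2) := by
        simp_rw [lintegral_const_mul' _ _ ENNReal.ofReal_ne_top]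
        gcongr
        exact lintegral_lintegral_inv_add_sq_le hf
    _ = _ := by
        rw [← mul_assoc, ← ENNReal.ofReal_mul (by positivity)]
        congr 2
        field_simp

/-- The convolution of a function with itself. -/
noncomputable def selfConv (a : Plane → ℝ≥0∞) (ξ : Plane) : ℝ≥0∞ := ∫⁻ η, a η * a (ξ - η)

/-- The contribution of the time `s` to the Duhamel integral at the time `t`, at frequency `ξ`. -/
noncomputable def duhamelTerm (a : ℝ → Plane → ℝ≥0∞) (s t : ℝ) (ξ : Plane) : ℝ≥0∞ :=
  if 0 < s ∧ s < t then
    ENNReal.ofReal (‖ξ‖ * Real.exp (-(4 * Real.pi ^ 2 * ‖ξ‖ ^ 2 * (t - s)))) * selfConv (a s) ξ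
  else 0

theorem measurable_selfConv {a : ℝ → Plane → ℝ≥0∞} (ha : Measurable (Function.uncurry a)) :
    Measurable fun p : ℝ × Plane => selfConv (a p.1) p.2 := by
  refine Measurable.lintegral_prod_right' (f := fun q : (ℝ × Plane) × Plane =>
    a q.1.1 q.2 * a q.1.1 (q.1.2 - q.2)) ?_
  exact (ha.comp (g := Function.uncurry a) (f := fun q : (ℝ × Plane) × Plane => (q.1.1, q.2))
    (by fun_prop)).mul (ha.comp (g := Function.uncurry a)
    (f := fun q : (ℝ × Plane) × Plane => (q.1.1, q.1.2 - q.2)) (by fun_prop))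

theorem measurable_duhamelTerm {a : ℝ → Plane → ℝ≥0∞} (ha : Measurable (Function.uncurry a)) :
    Measurable fun q : (ℝ × ℝ) × Plane => duhamelTerm a q.1.1 q.1.2 q.2 := by
  refine Measurable.ite ?_ (Measurable.mul (by fun_prop) ?_) measurable_const
  · exact (measurableSet_lt (f := fun _ : (ℝ × ℝ) × Plane => (0 : ℝ)) (g := fun q => q.1.1)
      (by fun_prop) (by fun_prop)).inter (measurableSet_lt (f := fun q : (ℝ × ℝ) × Plane => q.1.1)
      (g := fun q => q.1.2) (by fun_prop) (by fun_prop))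
  · exact (measurable_selfConv ha).comp (f := fun q : (ℝ × ℝ) × Plane => (q.1.1, q.2)) (by fun_prop)

/-- The kernel `1 / |x + y|` applied to the convolution square, after the substitution
`ξ = η + ζ`. -/
theorem lintegral_inv_norm_mul_selfConv_le {a : Plane → ℝ≥0∞} (ha : Measurable a) :
    ∫⁻ ξ : Plane, ENNReal.ofReal (‖ξ‖⁻¹) * selfConv a ξ ≤
      ENNReal.ofReal (56 * Real.pi) * ∫⁻ ξ, ENNReal.ofReal ‖ξ‖ * a ξ ^ 2 := by
  refine le_trans (le_of_eq ?_) (lintegral_lintegral_inv_norm_add_le ha)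
  calc ∫⁻ ξ : Plane, ENNReal.ofReal (‖ξ‖⁻¹) * selfConv a ξ
      = ∫⁻ ξ : Plane, ∫⁻ η, ENNReal.ofReal (‖ξ‖⁻¹) * (a η * a (ξ - η)) := by
        refine lintegral_congr fun ξ => ?_
        rw [selfConv, lintegral_const_mul' _ _ ENNReal.ofReal_ne_top]
    _ = ∫⁻ η, ∫⁻ ξ : Plane, ENNReal.ofReal (‖ξ‖⁻¹) * (a η * a (ξ - η)) :=
        lintegral_lintegral_swap (by unfold Function.uncurry; fun_prop)
    _ = _ := by
        refine lintegral_congr fun η => ?_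
        rw [← lintegral_add_left_eq_self _ η]
        refine lintegral_congr fun ζ => ?_
        rw [add_sub_cancel_left]

/-- The Duhamel integral of the nonlinear term has a Fourier transform in `L²_t L¹_ξ`: the
contributions of the single times are decreasing in time and integrable in time, so that the
superposition principle applies. -/
theorem lintegral_sq_lintegral_duhamelTerm_le {a : ℝ → Plane → ℝ≥0∞}
    (ha : Measurable (Function.uncurry a)) (T : ℝ) :
    ∫⁻ t in Ioo 0 T, (∫⁻ ξ, ∫⁻ s, duhamelTerm a s t ξ) ^ 2 ≤
      4 * ∫⁻ s in Ioo 0 T,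
        (ENNReal.ofReal (14 / Real.pi) * ∫⁻ ξ, ENNReal.ofReal ‖ξ‖ * a s ξ ^ 2) ^ 2 := by
  have has : ∀ s, Measurable (a s) := fun s => ha.comp measurable_prodMk_left
  have hm := measurable_duhamelTerm ha
  set F : ℝ → ℝ → ℝ≥0∞ := fun s t => if t < T then ∫⁻ ξ, duhamelTerm a s t ξ else 0 with hF
  set D : ℝ → ℝ≥0∞ := (Ioo 0 T).indicator fun s =>
    ENNReal.ofReal (14 / Real.pi) * ∫⁻ ξ, ENNReal.ofReal ‖ξ‖ * a s ξ ^ 2 with hD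
  have h0 : ∀ s t, ¬ (0 < s ∧ s < t ∧ t < T) → F s t = 0 := by
    intro s t h
    simp only [hF]
    split_ifs with htT
    · have : ¬ (0 < s ∧ s < t) := fun h' => h ⟨h'.1, h'.2, htT⟩
      simp only [duhamelTerm, if_neg this, lintegral_zero]
    · rfl
  have key := sq_lintegral_superposition_le (F := F) (D := D) (T := T) ?_ h0 ?_ ?_
  · calc ∫⁻ t in Ioo 0 T, (∫⁻ ξ, ∫⁻ s, duhamelTerm a s t ξ) ^ 2
        ≤ ∫⁻ t in Ioo 0 T, (∫⁻ s, F s t) ^ 2 := by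
          refine setLIntegral_mono' measurableSet_Ioo fun t ht => ?_
          rw [lintegral_lintegral_swap]
          · simp only [hF, if_pos ht.2]; rfl
          · exact (hm.comp (f := fun q : Plane × ℝ => ((q.2, t), q.1)) (by fun_prop)).aemeasurable
      _ ≤ ∫⁻ t, (∫⁻ s, F s t) ^ 2 := setLIntegral_le_lintegral _ _
      _ ≤ 4 * ∫⁻ s, D s ^ 2 := key
      _ = _ := by
          rw [← lintegral_indicator measurableSet_Ioo]
          congr 2; ext s
          simp only [hD, indicator]
          split_ifs <;> simp
  · refine Measurable.ite (measurableSet_lt measurable_snd measurable_const) ?_ measurable_const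
    exact hm.lintegral_prod_right'
  · intro s r t hsr hrt
    simp only [hF]
    split_ifs with h1 h2
    · refine lintegral_mono fun ξ => ?_
      simp only [duhamelTerm]
      by_cases hs : 0 < s
      · rw [if_pos ⟨hs, hsr.trans_le hrt⟩, if_pos ⟨hs, hsr⟩]
        gcongr
      · rw [if_neg fun h => hs h.1]; exact zero_le
    · exact absurd (hrt.trans_lt h1) h2
    · exact zero_le
    · exact zero_le
  · refine .of_forall fun s => ?_
    by_cases hs : s ∈ Ioo 0 T
    swap
    · have : ∀ t, F s t = 0 := fun t => h0 s t fun h => hs ⟨h.1, h.2.1.trans h.2.2⟩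
      simp only [this, lintegral_zero]
      exact zero_le
    simp only [hD, indicator_of_mem hs]
    calc ∫⁻ t, F s t ≤ ∫⁻ t, ∫⁻ ξ, duhamelTerm a s t ξ := by
          refine lintegral_mono fun t => ?_
          simp only [hF]
          split_ifs
          · exact le_rfl
          · exact zero_le
      _ = ∫⁻ ξ, ∫⁻ t, duhamelTerm a s t ξ := lintegral_lintegral_swap
          (hm.comp (f := fun q : ℝ × Plane => ((s, q.1), q.2)) (by fun_prop)).aemeasurable
      _ ≤ ∫⁻ ξ : Plane, ENNReal.ofReal (1 / (4 * Real.pi ^ 2)) *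
            (ENNReal.ofReal (‖ξ‖⁻¹) * selfConv (a s) ξ) := by
          refine lintegral_mono_ae ?_
          filter_upwards [ae_norm_pos] with ξ hξ
          have hc : 0 < 4 * Real.pi ^ 2 * ‖ξ‖ ^ 2 := by positivity
          have h1 : ∀ t, duhamelTerm a s t ξ = (Ioi s).indicator (fun t => ENNReal.ofReal
              (Real.exp (-(4 * Real.pi ^ 2 * ‖ξ‖ ^ 2 * (t - s)))) *
                (ENNReal.ofReal ‖ξ‖ * selfConv (a s) ξ)) t := by
            intro t
            simp only [duhamelTerm, indicator, mem_Ioi, hs.1, true_and]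
            split_ifs
            · rw [ENNReal.ofReal_mul (norm_nonneg _)]; ring
            · rfl
          simp_rw [h1]
          rw [lintegral_indicator measurableSet_Ioi, lintegral_mul_const _ (by fun_prop),
            lintegral_Ioi_exp_neg hc, ← mul_assoc, ← mul_assoc,
                ← ENNReal.ofReal_mul (by positivity),
            ← ENNReal.ofReal_mul (by positivity)]
          refine le_of_eq ?_
          congr 2
          field_simp
      _ ≤ ENNReal.ofReal (1 / (4 * Real.pi ^ 2)) * (ENNReal.ofReal (56 * Real.pi) *
            ∫⁻ ξ, ENNReal.ofReal ‖ξ‖ * a s ξ ^ 2) := by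
          rw [lintegral_const_mul' _ _ ENNReal.ofReal_ne_top]
          gcongr
          exact lintegral_inv_norm_mul_selfConv_le (has s)
      _ = _ := by
          rw [← mul_assoc, ← ENNReal.ofReal_mul (by positivity)]
          congr 2
          field_simp
          norm_num

theorem enorm_le_sum_enorm_apply {n : ℕ} (x : EuclideanSpace ℂ (Fin n)) : ‖x‖ₑ ≤ ∑ i, ‖x i‖ₑ := by
  have h : x = ∑ i, EuclideanSpace.single i (x i) := by
    ext k
    rw [WithLp.ofLp_sum, Finset.sum_apply]
    simp
  calc ‖x‖ₑ = ‖∑ i, EuclideanSpace.single i (x i)‖ₑ := by rw [← h]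
    _ ≤ ∑ i, ‖EuclideanSpace.single i (x i)‖ₑ := enorm_sum_le _ _
    _ = ∑ i, ‖x i‖ₑ := by
      refine Finset.sum_congr rfl fun i _ => ?_
      rw [← ofReal_norm, PiLp.norm_single, ofReal_norm]

theorem enorm_apply_le {n : ℕ} (x : EuclideanSpace ℂ (Fin n)) (i : Fin n) : ‖x i‖ₑ ≤ ‖x‖ₑ := by
  rw [← ofReal_norm, ← ofReal_norm]
  exact ENNReal.ofReal_le_ofReal (PiLp.norm_apply_le x i)

theorem enorm_nonlin_div_le {m : ℕ} (F : Plane → VelC m) (i : Fin (2 + m)) {ξ : Plane}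
    (hξ : 0 < ‖ξ‖) :
    ‖nonlin F i ξ / ((‖ξ‖ ^ 2 : ℝ) : ℂ)‖ₑ ≤
      ENNReal.ofReal (8 * Real.pi * (2 + m)) *
        (ENNReal.ofReal ‖ξ‖ * selfConv (fun η => ‖F η‖ₑ) ξ) := by
  have h1 : ‖(((‖ξ‖ ^ 2 : ℝ) : ℂ))⁻¹‖ₑ = ENNReal.ofReal ((‖ξ‖ ^ 2)⁻¹) := by
    rw [← ofReal_norm, norm_inv, Complex.norm_real, Real.norm_of_nonneg (by positivity)]
  rw [div_eq_mul_inv, enorm_mul, h1, mul_comm]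
  refine (mul_le_mul_right (enorm_nonlin_le F i ξ) _).trans_eq ?_
  rw [← mul_assoc, ← mul_assoc, ← ENNReal.ofReal_mul (by positivity),
    ← ENNReal.ofReal_mul (by positivity)]
  congr 2
  field_simp

/-- The pointwise Duhamel estimate for the Fourier transform of the solution. -/
theorem ae_ae_enorm_le_heat_add_duhamel {m : ℕ} {T : ℝ} (hT : 0 ≤ T) {F₀ : Plane → VelC m}
    (hF₀ : Measurable F₀) {U V : ℝ → Plane → VelC m}
    (hU : StronglyMeasurable (Function.uncurry U)) (hV : StronglyMeasurable (Function.uncurry V))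
    (heq : FrequencyEquation T F₀ U V) :
    ∀ᵐ t ∂(volume.restrict (Ioo 0 T)), ∀ᵐ ξ : Plane, ‖V t ξ‖ₑ ≤
      ENNReal.ofReal (2 + m) * (ENNReal.ofReal (Real.exp (-(4 * Real.pi ^ 2 * ‖ξ‖ ^ 2 * t))) *
          ‖F₀ ξ‖ₑ) + ENNReal.ofReal (8 * Real.pi * (2 + m) ^ 2) *
          ∫⁻ s, duhamelTerm (fun s η => ‖U s η‖ₑ) s t ξ := by
  have hUm : Measurable (Function.uncurry fun s η => ‖U s η‖ₑ) := hU.measurable.enorm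
  have hD := measurable_duhamelTerm hUm
  have hDi : Measurable fun p : ℝ × Plane => ∫⁻ s, duhamelTerm (fun s η => ‖U s η‖ₑ) s p.1 p.2 :=
    Measurable.lintegral_prod_right' (f := fun q : (ℝ × Plane) × ℝ =>
      duhamelTerm (fun s η => ‖U s η‖ₑ) q.2 q.1.1 q.1.2)
      (hD.comp (f := fun q : (ℝ × Plane) × ℝ => ((q.2, q.1.1), q.1.2)) (by fun_prop))
  have hF₀n : Measurable fun ξ => ‖F₀ ξ‖ₑ := hF₀.enorm
  rw [Measure.ae_ae_comm]
  swap
  · refine measurableSet_le (f := fun p : ℝ × Plane => ‖V p.1 p.2‖ₑ) hV.measurable.enorm ?_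
    exact Measurable.add (by fun_prop) (hDi.const_mul _)
  filter_upwards [heq, ae_norm_pos] with ξ h1 hξ
  have h2 : ∀ᵐ t ∂(volume.restrict (Ioo 0 T)), ∀ i : Fin (2 + m), ‖V t ξ i‖ₑ ≤
      ENNReal.ofReal (Real.exp (-(4 * Real.pi ^ 2 * ‖ξ‖ ^ 2 * t))) * ‖F₀ ξ i‖ₑ +
      ∫⁻ s in Ioo 0 t, ENNReal.ofReal (Real.exp (-(4 * Real.pi ^ 2 * ‖ξ‖ ^ 2 * (t - s)))) *
        ‖nonlin (U s) i ξ / ((‖ξ‖ ^ 2 : ℝ) : ℂ)‖ₑ :=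
    ae_all_iff.2 fun i => ae_enorm_le_of_ae_eq_add_integral hT (h1 i).2.1 (h1 i).1 (h1 i).2.2
  filter_upwards [h2] with t ht
  have h3 : ∀ i : Fin (2 + m), ‖V t ξ i‖ₑ ≤
      ENNReal.ofReal (Real.exp (-(4 * Real.pi ^ 2 * ‖ξ‖ ^ 2 * t))) * ‖F₀ ξ‖ₑ +
      ENNReal.ofReal (8 * Real.pi * (2 + m)) *
        ∫⁻ s, duhamelTerm (fun s η => ‖U s η‖ₑ) s t ξ := by
    intro i
    refine (ht i).trans (add_le_add (mul_le_mul_right (enorm_apply_le _ i) _) ?_)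
    rw [← lintegral_const_mul' _ _ ENNReal.ofReal_ne_top, ← lintegral_indicator measurableSet_Ioo]
    refine lintegral_mono fun s => ?_
    simp only [indicator, duhamelTerm, mem_Ioo]
    split_ifs with hs
    · rw [ENNReal.ofReal_mul (norm_nonneg _)]
      refine (mul_le_mul_right (enorm_nonlin_div_le (U s) i hξ) _).trans_eq ?_
      ring
    · exact zero_le
  refine (enorm_le_sum_enorm_apply _).trans ((Finset.sum_le_sum fun i _ => h3 i).trans_eq ?_)
  rw [Finset.sum_const, Finset.card_univ, Fintype.card_fin, nsmul_eq_mul, mul_add,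
    ← ENNReal.ofReal_natCast, ← mul_assoc (ENNReal.ofReal _) (ENNReal.ofReal (8 * Real.pi * (2 + m))),
    ← ENNReal.ofReal_mul (by positivity)]
  push_cast
  congr 3
  ring

theorem add_sq_le_two_mul (a b : ℝ≥0∞) : (a + b) ^ 2 ≤ 2 * (a ^ 2 + b ^ 2) := by
  have h := two_mul_mul_le_sq_mul_add_sq_mul_inv a b (t := 1) (by simp) (by simp)
  simp only [mul_one, inv_one] at h
  calc (a + b) ^ 2 = a ^ 2 + b ^ 2 + 2 * (a * b) := by ring
    _ ≤ a ^ 2 + b ^ 2 + (a ^ 2 + b ^ 2) := by gcongr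
    _ = 2 * (a ^ 2 + b ^ 2) := by ring

theorem lintegral_sq_le_of_ae_le_add {μ : Measure ℝ} {W H N : ℝ → ℝ≥0∞} {c₁ c₂ X Y : ℝ≥0∞}
    (hH : Measurable H) (hc₁ : c₁ ≠ ⊤) (hc₂ : c₂ ≠ ⊤)
    (hle : ∀ᵐ t ∂μ, W t ≤ c₁ * H t + c₂ * N t) (hX : ∫⁻ t, H t ^ 2 ∂μ ≤ X)
    (hY : ∫⁻ t, N t ^ 2 ∂μ ≤ Y) : ∫⁻ t, W t ^ 2 ∂μ ≤ 2 * c₁ ^ 2 * X + 2 * c₂ ^ 2 * Y := by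
  have h : ∀ᵐ t ∂μ, W t ^ 2 ≤ 2 * c₁ ^ 2 * H t ^ 2 + 2 * c₂ ^ 2 * N t ^ 2 := by
    filter_upwards [hle] with t ht
    calc W t ^ 2 ≤ (c₁ * H t + c₂ * N t) ^ 2 := by gcongr
      _ ≤ 2 * ((c₁ * H t) ^ 2 + (c₂ * N t) ^ 2) := add_sq_le_two_mul _ _
      _ = _ := by ring
  refine (lintegral_mono_ae h).trans ?_
  rw [lintegral_add_left ((hH.pow_const 2).const_mul _), lintegral_const_mul' _ _ (by finiteness),
    lintegral_const_mul' _ _ (by finiteness)]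
  gcongr

/-- The constant of the `L²_t L¹_ξ` estimate. -/
noncomputable def estimateConst (m : ℕ) : ℝ :=
  2 * (2 + m) ^ 2 / Real.pi + 8 * ((8 * Real.pi * (2 + m) ^ 2) * (14 / Real.pi)) ^ 2

theorem estimateConst_bound (m : ℕ) (A M : ℝ) :
    2 * ENNReal.ofReal (2 + m) ^ 2 * (ENNReal.ofReal (1 / Real.pi) * ENNReal.ofReal (A ^ 2)) +
      2 * ENNReal.ofReal (8 * Real.pi * (2 + m) ^ 2) ^ 2 * (4 * (ENNReal.ofReal (14 / Real.pi) ^ 2 *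
        (ENNReal.ofReal (M ^ 2) * ENNReal.ofReal (M ^ 2)))) ≤
      ENNReal.ofReal (estimateConst m * (A ^ 2 + M ^ 4)) := by
  obtain ⟨a, ha⟩ : ∃ a : ℝ, a = 8 * Real.pi * (2 + m) ^ 2 := ⟨_, rfl⟩
  obtain ⟨b, hb⟩ : ∃ b : ℝ, b = 14 / Real.pi := ⟨_, rfl⟩
  obtain ⟨n, hn⟩ : ∃ n : ℝ, n = 2 + m := ⟨_, rfl⟩
  have ha0 : 0 ≤ a := by rw [ha]; positivity
  have hb0 : 0 ≤ b := by rw [hb]; positivity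
  have hn0 : 0 ≤ n := by rw [hn]; positivity
  have h2 : (2 : ℝ≥0∞) = ENNReal.ofReal 2 := by simp
  have h4 : (4 : ℝ≥0∞) = ENNReal.ofReal 4 := by simp
  rw [estimateConst, ← ha, ← hb, ← hn]
  calc _ = ENNReal.ofReal (2 * n ^ 2 * (1 / Real.pi * A ^ 2) +
        2 * a ^ 2 * (4 * (b ^ 2 * (M ^ 2 * M ^ 2)))) := by
        rw [h2, h4, ← ENNReal.ofReal_pow hn0, ← ENNReal.ofReal_pow ha0, ← ENNReal.ofReal_pow hb0]
        repeat rw [← ENNReal.ofReal_mul (by positivity)]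
        rw [← ENNReal.ofReal_add (by positivity) (by positivity)]
    _ ≤ _ := by
        refine ENNReal.ofReal_le_ofReal ?_
        have h1 : 0 ≤ 2 * n ^ 2 / Real.pi * M ^ 4 := by positivity
        have h2 : 0 ≤ 8 * (a * b) ^ 2 * A ^ 2 := by positivity
        have h3 : (2 * n ^ 2 / Real.pi + 8 * (a * b) ^ 2) * (A ^ 2 + M ^ 4) =
            2 * n ^ 2 * (1 / Real.pi * A ^ 2) + 2 * a ^ 2 * (4 * (b ^ 2 * (M ^ 2 * M ^ 2))) +
            2 * n ^ 2 / Real.pi * M ^ 4 + 8 * (a * b) ^ 2 * A ^ 2 := by ring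
        linarith

/-- The `L²_t L¹_ξ` estimate for the Fourier transform of the solution, in terms of the energy
of the transporting field on the Fourier side. -/
theorem lintegral_sq_lintegral_enorm_le {m : ℕ} {T A M : ℝ} (hT : 0 ≤ T)
    {F₀ : Plane → VelC m} (hF₀ : Measurable F₀) (hA : ∫⁻ ξ, ‖F₀ ξ‖ₑ ^ 2 ≤ ENNReal.ofReal (A ^ 2))
    {U V : ℝ → Plane → VelC m}
    (hU : StronglyMeasurable (Function.uncurry U)) (hV : StronglyMeasurable (Function.uncurry V))
    (hUM : ∀ᵐ t ∂(volume.restrict (Ioo 0 T)), ∫⁻ ξ, ‖U t ξ‖ₑ ^ 2 ≤ ENNReal.ofReal (M ^ 2))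
    (hUD : ∫⁻ t in Ioo 0 T, ∫⁻ ξ : Plane, ENNReal.ofReal (‖ξ‖ ^ 2) * ‖U t ξ‖ₑ ^ 2 ≤
      ENNReal.ofReal (M ^ 2))
    (heq : FrequencyEquation T F₀ U V) :
    ∫⁻ t in Ioo 0 T, (∫⁻ ξ, ‖V t ξ‖ₑ) ^ 2 ≤
      ENNReal.ofReal (estimateConst m * (A ^ 2 + M ^ 4)) := by
  have hUm : Measurable (Function.uncurry fun s η => ‖U s η‖ₑ) := hU.measurable.enorm
  have hUs : ∀ s, Measurable fun η => ‖U s η‖ₑ := fun s => hUm.of_uncurry_left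
  have hF₀n : Measurable fun ξ => ‖F₀ ξ‖ₑ := hF₀.enorm
  have h := lintegral_sq_le_of_ae_le_add (μ := volume.restrict (Ioo 0 T))
    (W := fun t => ∫⁻ ξ, ‖V t ξ‖ₑ) (H := fun t => ∫⁻ ξ : Plane,
      ENNReal.ofReal (Real.exp (-(4 * Real.pi ^ 2 * ‖ξ‖ ^ 2 * t))) * ‖F₀ ξ‖ₑ)
    (N := fun t => ∫⁻ ξ, ∫⁻ s, duhamelTerm (fun s η => ‖U s η‖ₑ) s t ξ)
    (c₁ := ENNReal.ofReal (2 + m)) (c₂ := ENNReal.ofReal (8 * Real.pi * (2 + m) ^ 2))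
    (X := ENNReal.ofReal (1 / Real.pi) * ENNReal.ofReal (A ^ 2))
    (Y := 4 * (ENNReal.ofReal (14 / Real.pi) ^ 2 *
      (ENNReal.ofReal (M ^ 2) * ENNReal.ofReal (M ^ 2))))
    ?_ ENNReal.ofReal_ne_top ENNReal.ofReal_ne_top ?_ ?_ ?_
  · exact h.trans (estimateConst_bound m A M)
  · exact Measurable.lintegral_prod_right' (f := fun p : ℝ × Plane =>
      ENNReal.ofReal (Real.exp (-(4 * Real.pi ^ 2 * ‖p.2‖ ^ 2 * p.1))) * ‖F₀ p.2‖ₑ)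
        (Measurable.mul (by fun_prop) (hF₀n.comp measurable_snd))
  · filter_upwards [ae_ae_enorm_le_heat_add_duhamel hT hF₀ hU hV heq] with t ht
    refine (lintegral_mono_ae ht).trans_eq ?_
    rw [lintegral_add_left (by fun_prop), lintegral_const_mul' _ _ ENNReal.ofReal_ne_top,
      lintegral_const_mul' _ _ ENNReal.ofReal_ne_top]
  · exact (lintegral_sq_lintegral_heat_le hF₀n T).trans (by gcongr)
  · refine (lintegral_sq_lintegral_duhamelTerm_le hUm T).trans ?_
    gcongr
    simp_rw [mul_pow]
    rw [lintegral_const_mul' _ _ (by finiteness)]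
    gcongr
    calc ∫⁻ t in Ioo 0 T, (∫⁻ ξ : Plane, ENNReal.ofReal ‖ξ‖ * ‖U t ξ‖ₑ ^ 2) ^ 2
        ≤ ∫⁻ t in Ioo 0 T, ENNReal.ofReal (M ^ 2) *
            ∫⁻ ξ : Plane, ENNReal.ofReal (‖ξ‖ ^ 2) * ‖U t ξ‖ₑ ^ 2 := by
          refine lintegral_mono_ae ?_
          filter_upwards [hUM] with t ht
          exact (sq_lintegral_norm_mul_sq_le (hUs t)).trans (by gcongr)
      _ ≤ _ := by
          rw [lintegral_const_mul' _ _ ENNReal.ofReal_ne_top]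
          gcongr

/-! ### The nonlinear term does not contribute to the energy -/

/-- The rate at which the nonlinear term changes the energy of the frequency `ξ`. -/
noncomputable def transfer {m : ℕ} (F : Plane → VelC m) (ξ : Plane) : ℝ :=
  ∑ i, (nonlin F i ξ / ((‖ξ‖ ^ 2 : ℝ) : ℂ) * (starRingEnd ℂ) (F ξ i)).re

/-- The trilinear density whose integral in `η` gives the energy transfer at `ξ`. -/
noncomputable def triad {m : ℕ} (F : Plane → VelC m) (j : Fin 2) (k : Fin (2 + m))
    (q : Plane × Plane) : ℂ :=
  ((q.1 j : ℝ) : ℂ) * (F q.2 (Fin.castAdd m j) * F (q.1 - q.2) k) * (starRingEnd ℂ) (F q.1 k)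

theorem stronglyMeasurable_apply {m : ℕ} {α : Type*} [MeasurableSpace α] {F : α → VelC m}
    (hF : StronglyMeasurable F) (k : Fin (2 + m)) : StronglyMeasurable fun x => F x k :=
  (EuclideanSpace.proj k : VelC m →L[ℂ] ℂ).continuous.comp_stronglyMeasurable hF

theorem stronglyMeasurable_triad {m : ℕ} {F : Plane → VelC m} (hF : StronglyMeasurable F)
    (j : Fin 2) (k : Fin (2 + m)) : StronglyMeasurable (triad F j k) := by
  have h1 : StronglyMeasurable fun q : Plane × Plane => ((q.1 j : ℝ) : ℂ) :=
    Measurable.stronglyMeasurable (by fun_prop)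
  have h2 : StronglyMeasurable fun q : Plane × Plane => F q.2 (Fin.castAdd m j) :=
    (stronglyMeasurable_apply hF _).comp_measurable measurable_snd
  have h3 : StronglyMeasurable fun q : Plane × Plane => F (q.1 - q.2) k :=
    (stronglyMeasurable_apply hF _).comp_measurable (by fun_prop)
  have h4 : StronglyMeasurable fun q : Plane × Plane => F q.1 k :=
    (stronglyMeasurable_apply hF _).comp_measurable measurable_fst
  exact (h1.mul (h2.mul h3)).mul (Complex.continuous_conj.comp_stronglyMeasurable h4)

theorem integrable_triad {m : ℕ} {F : Plane → VelC m} (hF : StronglyMeasurable F)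
    (hfin : ∫⁻ ξ : Plane, ENNReal.ofReal ‖ξ‖ * ‖F ξ‖ₑ * selfConv (fun η => ‖F η‖ₑ) ξ ≠ ⊤)
    (j : Fin 2) (k : Fin (2 + m)) : Integrable (triad F j k) (volume.prod volume) := by
  have hm := stronglyMeasurable_triad hF j k
  refine ⟨hm.aestronglyMeasurable, ?_⟩
  rw [hasFiniteIntegral_iff_enorm, lintegral_prod _ hm.measurable.enorm.aemeasurable]
  refine lt_of_le_of_lt (lintegral_mono fun ξ => ?_) (lt_top_iff_ne_top.2 hfin)
  rw [selfConv, ← lintegral_const_mul' _ _ (by finiteness)]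
  refine lintegral_mono fun η => ?_
  simp only [triad, enorm_mul, RCLike.enorm_conj]
  have h1 : ‖((ξ j : ℝ) : ℂ)‖ₑ ≤ ENNReal.ofReal ‖ξ‖ := by
    rw [← ofReal_norm, Complex.norm_real]
    exact ENNReal.ofReal_le_ofReal (PiLp.norm_apply_le ξ j)
  calc ‖((ξ j : ℝ) : ℂ)‖ₑ * (‖F η (Fin.castAdd m j)‖ₑ * ‖F (ξ - η) k‖ₑ) * ‖F ξ k‖ₑ
      ≤ ENNReal.ofReal ‖ξ‖ * (‖F η‖ₑ * ‖F (ξ - η)‖ₑ) * ‖F ξ‖ₑ := by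
        gcongr <;> exact enorm_apply_le _ _
    _ = _ := by ring

theorem measurePreserving_sub_neg :
    MeasurePreserving (fun q : Plane × Plane => (q.1 - q.2, -q.2)) (volume.prod volume)
      (volume.prod volume) :=
  ((MeasurePreserving.id volume).prod (Measure.measurePreserving_neg volume)).comp
    (measurePreserving_sub_prod volume volume)

/-- The substitution `(ξ, η) ↦ (ξ - η, -η)` turns the sum of the triads into its complex
conjugate, so that its integral is real. -/
theorem conj_integral_sum_triad {m : ℕ} {F : Plane → VelC m} (hF : StronglyMeasurable F)
    (hherm : ∀ᵐ ξ, ∀ k, F (-ξ) k = (starRingEnd ℂ) (F ξ k))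
    (hdiv : ∀ᵐ ξ : Plane, ∑ j : Fin 2, (ξ j : ℂ) * F ξ (Fin.castAdd m j) = 0) :
    (starRingEnd ℂ) (∫ q, ∑ j, ∑ k, triad F j k q ∂(volume.prod volume)) =
      ∫ q, ∑ j, ∑ k, triad F j k q ∂(volume.prod volume) := by
  have hm : StronglyMeasurable fun q => ∑ j, ∑ k, triad F j k q :=
    Finset.stronglyMeasurable_fun_sum _ fun j _ =>
      Finset.stronglyMeasurable_fun_sum _ fun k _ => stronglyMeasurable_triad hF j k
  rw [← integral_conj]
  conv_rhs => rw [← measurePreserving_sub_neg.map_eq]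
  rw [integral_map measurePreserving_sub_neg.measurable.aemeasurable hm.aestronglyMeasurable]
  refine integral_congr_ae ?_
  have hdiv' : ∀ᵐ ξ : Plane, ∑ j : Fin 2, (((-ξ) j : ℝ) : ℂ) * F (-ξ) (Fin.castAdd m j) = 0 :=
    (Measure.measurePreserving_neg (volume : Measure Plane)).quasiMeasurePreserving.ae hdiv
  have h1 := (Measure.quasiMeasurePreserving_snd (μ := (volume : Measure Plane))
    (ν := (volume : Measure Plane))).ae (hherm.and hdiv')
  filter_upwards [h1] with q hq
  obtain ⟨hq1, hq2⟩ := hq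
  have hsum : ∑ j, ∑ k, (starRingEnd ℂ) (triad F j k q) -
      ∑ j, ∑ k, triad F j k (q.1 - q.2, -q.2) =
      -(∑ j : Fin 2, (((-q.2) j : ℝ) : ℂ) * F (-q.2) (Fin.castAdd m j)) *
        ∑ k, F q.1 k * (starRingEnd ℂ) (F (q.1 - q.2) k) := by
    rw [neg_mul, Finset.sum_mul_sum, ← Finset.sum_sub_distrib, ← Finset.sum_neg_distrib]
    refine Finset.sum_congr rfl fun j _ => ?_
    rw [← Finset.sum_sub_distrib, ← Finset.sum_neg_distrib]
    refine Finset.sum_congr rfl fun k _ => ?_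
    simp only [triad, map_mul, Complex.conj_conj, Complex.conj_ofReal, ← hq1, sub_neg_eq_add,
      sub_add_cancel, PiLp.neg_apply, PiLp.sub_apply]
    push_cast
    ring
  rw [hq2, neg_zero, zero_mul, sub_eq_zero] at hsum
  simpa only [map_sum] using hsum

/-- The energy transfer, with the Leray symbol removed by means of the divergence condition. -/
theorem transfer_eq {m : ℕ} {F : Plane → VelC m} {ξ : Plane} (hξ : 0 < ‖ξ‖)
    (hdiv : ∑ j : Fin 2, (ξ j : ℂ) * F ξ (Fin.castAdd m j) = 0) :
    transfer F ξ = (-(2 * Real.pi * Complex.I) * ∑ j : Fin 2, ∑ k, ((ξ j : ℝ) : ℂ) *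
      conv F (Fin.castAdd m j) k ξ * (starRingEnd ℂ) (F ξ k)).re := by
  have hξ' : ((‖ξ‖ ^ 2 : ℝ) : ℂ) ≠ 0 := by
    rw [Complex.ofReal_ne_zero]; positivity
  have hL : ∀ k, ∑ i, (leraySymbol i k ξ : ℂ) * (starRingEnd ℂ) (F ξ i) =
      ((‖ξ‖ ^ 2 : ℝ) : ℂ) * (starRingEnd ℂ) (F ξ k) := by
    intro k
    have := congrArg (starRingEnd ℂ) (sum_leraySymbol_mul k hdiv)
    simp only [map_sum, map_mul, Complex.conj_ofReal] at this
    rw [← this]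
    exact Finset.sum_congr rfl fun i _ => by rw [leraySymbol_symm]
  rw [transfer, ← Complex.re_sum]
  congr 1
  calc ∑ i, nonlin F i ξ / ((‖ξ‖ ^ 2 : ℝ) : ℂ) * (starRingEnd ℂ) (F ξ i)
      = ∑ j : Fin 2, ∑ k, -(2 * Real.pi * Complex.I) * (ξ j : ℂ) * conv F (Fin.castAdd m j) k ξ /
          ((‖ξ‖ ^ 2 : ℝ) : ℂ) * ∑ i, (leraySymbol i k ξ : ℂ) * (starRingEnd ℂ) (F ξ i) := by
        simp only [nonlin, Finset.sum_div, Finset.sum_mul, Finset.mul_sum]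
        rw [Finset.sum_comm]
        refine Finset.sum_congr rfl fun j _ => ?_
        rw [Finset.sum_comm]
        refine Finset.sum_congr rfl fun k _ => Finset.sum_congr rfl fun i _ => by ring
    _ = _ := by
        simp only [hL, Finset.mul_sum]
        refine Finset.sum_congr rfl fun j _ => Finset.sum_congr rfl fun k _ => ?_
        field_simp

/-- The total energy transfer vanishes. -/
theorem integral_transfer_eq_zero {m : ℕ} {F : Plane → VelC m} (hF : StronglyMeasurable F)
    (hherm : ∀ᵐ ξ, ∀ k, F (-ξ) k = (starRingEnd ℂ) (F ξ k))
    (hdiv : ∀ᵐ ξ : Plane, ∑ j : Fin 2, (ξ j : ℂ) * F ξ (Fin.castAdd m j) = 0)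
    (hfin : ∫⁻ ξ : Plane, ENNReal.ofReal ‖ξ‖ * ‖F ξ‖ₑ * selfConv (fun η => ‖F η‖ₑ) ξ ≠ ⊤) :
    ∫ ξ, transfer F ξ = 0 := by
  have hi := integrable_triad hF hfin
  have hinner : ∀ (j : Fin 2) (k : Fin (2 + m)) (ξ : Plane), ∫ η, triad F j k (ξ, η) =
      ((ξ j : ℝ) : ℂ) * conv F (Fin.castAdd m j) k ξ * (starRingEnd ℂ) (F ξ k) := by
    intro j k ξ
    simp only [triad]
    rw [integral_mul_const, integral_const_mul]
    rfl
  have hint : ∀ (j : Fin 2) (k : Fin (2 + m)), Integrable fun ξ : Plane =>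
      ((ξ j : ℝ) : ℂ) * conv F (Fin.castAdd m j) k ξ * (starRingEnd ℂ) (F ξ k) := fun j k =>
    (hi j k).integral_prod_left.congr (.of_forall fun ξ => hinner j k ξ)
  have hS : ∀ j : Fin 2, Integrable fun ξ : Plane => ∑ k, ((ξ j : ℝ) : ℂ) *
      conv F (Fin.castAdd m j) k ξ * (starRingEnd ℂ) (F ξ k) := fun j =>
    integrable_finsetSum _ fun k _ => hint j k
  have hS' : ∀ j : Fin 2, Integrable (fun q => ∑ k, triad F j k q) (volume.prod volume) := fun j =>
    integrable_finsetSum _ fun k _ => hi j k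
  have hQ : ∫ ξ : Plane, ∑ j : Fin 2, ∑ k, ((ξ j : ℝ) : ℂ) * conv F (Fin.castAdd m j) k ξ *
      (starRingEnd ℂ) (F ξ k) = ∫ q, ∑ j, ∑ k, triad F j k q ∂(volume.prod volume) := by
    rw [integral_finsetSum _ fun j _ => hS j, integral_finsetSum _ fun j _ => hS' j]
    refine Finset.sum_congr rfl fun j _ => ?_
    rw [integral_finsetSum _ fun k _ => hint j k, integral_finsetSum _ fun k _ => hi j k]
    refine Finset.sum_congr rfl fun k _ => ?_
    rw [integral_prod _ (hi j k)]
    simp only [hinner]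
  have himag : (∫ q, ∑ j, ∑ k, triad F j k q ∂(volume.prod volume)).im = 0 :=
    Complex.conj_eq_iff_im.1 (conj_integral_sum_triad hF hherm hdiv)
  have hI : Integrable fun ξ : Plane => -(2 * Real.pi * Complex.I) * ∑ j : Fin 2, ∑ k,
      ((ξ j : ℝ) : ℂ) * conv F (Fin.castAdd m j) k ξ * (starRingEnd ℂ) (F ξ k) :=
    (integrable_finsetSum _ fun j _ => hS j).const_mul _
  calc ∫ ξ, transfer F ξ = ∫ ξ : Plane, (-(2 * Real.pi * Complex.I) * ∑ j : Fin 2, ∑ k,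
        ((ξ j : ℝ) : ℂ) * conv F (Fin.castAdd m j) k ξ * (starRingEnd ℂ) (F ξ k)).re := by
        refine integral_congr_ae ?_
        filter_upwards [hdiv, ae_norm_pos] with ξ h1 h2 using transfer_eq h2 h1
    _ = (∫ ξ : Plane, -(2 * Real.pi * Complex.I) * ∑ j : Fin 2, ∑ k,
        ((ξ j : ℝ) : ℂ) * conv F (Fin.castAdd m j) k ξ * (starRingEnd ℂ) (F ξ k)).re :=
        integral_re hI
    _ = 0 := by
        rw [integral_const_mul, hQ, Complex.mul_re, himag]
        simp

theorem enorm_transfer_le {m : ℕ} (F : Plane → VelC m) {ξ : Plane} (hξ : 0 < ‖ξ‖) :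
    ‖transfer F ξ‖ₑ ≤ ENNReal.ofReal (8 * Real.pi * (2 + m) ^ 2) *
      (ENNReal.ofReal ‖ξ‖ * ‖F ξ‖ₑ * selfConv (fun η => ‖F η‖ₑ) ξ) := by
  have h1 : ∀ i, ‖(nonlin F i ξ / ((‖ξ‖ ^ 2 : ℝ) : ℂ) * (starRingEnd ℂ) (F ξ i)).re‖ₑ ≤
      ENNReal.ofReal (8 * Real.pi * (2 + m)) *
        (ENNReal.ofReal ‖ξ‖ * ‖F ξ‖ₑ * selfConv (fun η => ‖F η‖ₑ) ξ) := by
    intro i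
    calc ‖(nonlin F i ξ / ((‖ξ‖ ^ 2 : ℝ) : ℂ) * (starRingEnd ℂ) (F ξ i)).re‖ₑ
        ≤ ‖nonlin F i ξ / ((‖ξ‖ ^ 2 : ℝ) : ℂ) * (starRingEnd ℂ) (F ξ i)‖ₑ := by
          rw [← ofReal_norm, ← ofReal_norm]
          exact ENNReal.ofReal_le_ofReal (Complex.abs_re_le_norm _)
      _ ≤ ENNReal.ofReal (8 * Real.pi * (2 + m)) *
            (ENNReal.ofReal ‖ξ‖ * selfConv (fun η => ‖F η‖ₑ) ξ) * ‖F ξ‖ₑ := by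
          rw [enorm_mul, RCLike.enorm_conj]
          exact mul_le_mul' (enorm_nonlin_div_le F i hξ) (enorm_apply_le _ _)
      _ = _ := by ring
  refine (enorm_sum_le _ _).trans ((Finset.sum_le_sum fun i _ => h1 i).trans_eq ?_)
  rw [Finset.sum_const, Finset.card_univ, Fintype.card_fin, nsmul_eq_mul, ← mul_assoc,
    ← ENNReal.ofReal_natCast, ← ENNReal.ofReal_mul (by positivity)]
  congr 2
  push_cast
  ring

/-- The trilinear form is controlled by the energy and the dissipation. The trilinear estimate is
used with `ε = (1 + Y) ^ (-1/2)`, where `Y` is the dissipation; the summand `1` keeps `ε` finite. -/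
theorem lintegral_mul_selfConv_le {a : Plane → ℝ≥0∞} (ha : Measurable a) {B : ℝ} (hB : 0 ≤ B)
    (haB : ∫⁻ ξ, a ξ ^ 2 ≤ ENNReal.ofReal (B ^ 2))
    (hfin : ∫⁻ ξ : Plane, ENNReal.ofReal (‖ξ‖ ^ 2) * a ξ ^ 2 ≠ ⊤) :
    ∫⁻ ξ : Plane, ENNReal.ofReal ‖ξ‖ * a ξ * selfConv a ξ ≤ ENNReal.ofReal B *
      (ENNReal.ofReal (1 + 2 * Real.pi) *
        (1 + ∫⁻ ξ : Plane, ENNReal.ofReal (‖ξ‖ ^ 2) * a ξ ^ 2)) := by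
  set Y := ∫⁻ ξ : Plane, ENNReal.ofReal (‖ξ‖ ^ 2) * a ξ ^ 2 with hY
  have htop : 1 + Y ≠ ⊤ := ENNReal.add_ne_top.2 ⟨ENNReal.one_ne_top, hfin⟩
  obtain ⟨Z, hZ⟩ : ∃ Z : ℝ≥0∞, Z ^ 2 = 1 + Y :=
    ⟨(1 + Y) ^ (1 / 2 : ℝ), by rw [← ENNReal.rpow_natCast, ← ENNReal.rpow_mul]; norm_num⟩
  have hZ0 : Z ≠ 0 := by
    rintro rfl
    exact (by simp : 1 + Y ≠ 0) (by rw [← hZ]; simp)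
  have hZt : Z ≠ ⊤ := by
    rintro rfl
    exact htop (by rw [← hZ]; simp)
  have hx : ∫⁻ ξ : Plane, ENNReal.ofReal ‖ξ‖ * a ξ ^ 2 ≤ ENNReal.ofReal B * Z := by
    refine (ENNReal.pow_le_pow_left_iff (n := 2) (by norm_num)).1 ?_
    rw [mul_pow, hZ, ← ENNReal.ofReal_pow hB]
    refine (sq_lintegral_norm_mul_sq_le ha).trans (mul_le_mul' haB ?_)
    exact le_add_self
  have hg : Measurable fun ξ : Plane => ENNReal.ofReal ‖ξ‖ * a ξ := by fun_prop
  have hYg : ∫⁻ ξ : Plane, (ENNReal.ofReal ‖ξ‖ * a ξ) ^ 2 = Y := by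
    refine lintegral_congr fun ξ => ?_
    rw [mul_pow, ENNReal.ofReal_pow (norm_nonneg _)]
  calc ∫⁻ ξ : Plane, ENNReal.ofReal ‖ξ‖ * a ξ * selfConv a ξ
      = ∫⁻ ξ : Plane, ∫⁻ η, ENNReal.ofReal ‖ξ‖ * a ξ * (a η * a (ξ - η)) := by
        refine lintegral_congr fun ξ => ?_
        rw [selfConv, lintegral_const_mul]
        fun_prop
    _ = ∫⁻ η, ∫⁻ ξ : Plane, ENNReal.ofReal ‖ξ‖ * a ξ * (a η * a (ξ - η)) :=
        lintegral_lintegral_swap (by unfold Function.uncurry; fun_prop)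
    _ = ∫⁻ η, ∫⁻ ζ, a η * a ζ * (ENNReal.ofReal ‖η + ζ‖ * a (η + ζ)) := by
        refine lintegral_congr fun η => ?_
        rw [← lintegral_add_left_eq_self _ η]
        refine lintegral_congr fun ζ => ?_
        rw [add_sub_cancel_left]
        ring
    _ ≤ (∫⁻ ξ : Plane, ENNReal.ofReal ‖ξ‖ * a ξ ^ 2) *
          (Z⁻¹ * (∫⁻ ξ : Plane, (ENNReal.ofReal ‖ξ‖ * a ξ) ^ 2) +
            ENNReal.ofReal (2 * Real.pi) * Z⁻¹⁻¹) :=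
        lintegral_lintegral_mul_mul_add_le ha hg (ENNReal.inv_ne_zero.2 hZt)
          (ENNReal.inv_ne_top.2 hZ0)
    _ ≤ ENNReal.ofReal B * Z * (Z + ENNReal.ofReal (2 * Real.pi) * Z) := by
        rw [inv_inv, hYg]
        gcongr
        calc Z⁻¹ * Y ≤ Z⁻¹ * Z ^ 2 := by rw [hZ]; gcongr; exact le_add_self
          _ = Z := by rw [sq, ← mul_assoc, ENNReal.inv_mul_cancel hZ0 hZt, one_mul]
    _ = _ := by
        rw [← hZ, ENNReal.ofReal_add (by norm_num) (by positivity), ENNReal.ofReal_one]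
        ring

/-! ### The energy equality -/

/-- A bound for almost every `t < T` passes to the endpoint `T`, by monotone convergence. -/
theorem setLIntegral_Ioo_le_of_ae {f : ℝ → ℝ≥0∞} {T : ℝ} {c : ℝ≥0∞} (hT : 0 < T)
    (h : ∀ᵐ t ∂(volume.restrict (Ioo 0 T)), ∫⁻ s in Ioo 0 t, f s ≤ c) :
    ∫⁻ s in Ioo 0 T, f s ≤ c := by
  have hD := Measure.dense_of_ae ((ae_restrict_iff' measurableSet_Ioo).1 h)
  obtain ⟨x, hxm, hx, hxT⟩ := exists_seq_strictMono_tendsto' hT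
  have hU : Ioo 0 T = ⋃ n, Ioo 0 (x n) := by
    ext t
    simp only [mem_iUnion, mem_Ioo]
    constructor
    · rintro ⟨h1, h2⟩
      obtain ⟨n, hn⟩ := (hxT.eventually (lt_mem_nhds h2)).exists
      exact ⟨n, h1, hn⟩
    · rintro ⟨n, h1, h2⟩
      exact ⟨h1, h2.trans (hx n).2⟩
  rw [hU, setLIntegral_iUnion_of_directed f
    (Monotone.directed_le fun a b hab => Ioo_subset_Ioo_right (hxm.monotone hab))]
  refine iSup_le fun n => ?_
  obtain ⟨t, ht, hgood⟩ := hD.inter_open_nonempty (Ioo (x n) T) isOpen_Ioo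
    (nonempty_Ioo.2 (hx n).2)
  exact (lintegral_mono_set (Ioo_subset_Ioo_right ht.1.le)).trans
    (hgood ⟨(hx n).1.trans ht.1, ht.2⟩)

theorem measurable_setLIntegral_Ioo {f : ℝ → Plane → ℝ≥0∞} (hf : Measurable (Function.uncurry f)) :
    Measurable fun p : ℝ × Plane => ∫⁻ s in Ioo 0 p.1, f s p.2 := by
  have h : ∀ p : ℝ × Plane, ∫⁻ s in Ioo 0 p.1, f s p.2 =
      ∫⁻ s, if 0 < s ∧ s < p.1 then f s p.2 else 0 := fun p => by
    rw [← lintegral_indicator measurableSet_Ioo]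
    simp only [indicator, mem_Ioo]
  simp_rw [h]
  refine Measurable.lintegral_prod_right' (f := fun q : (ℝ × Plane) × ℝ =>
    if 0 < q.2 ∧ q.2 < q.1.1 then f q.2 q.1.2 else 0) (Measurable.ite ?_ ?_ measurable_const)
  · exact (measurableSet_lt measurable_const measurable_snd).inter
      (measurableSet_lt measurable_snd (measurable_fst.comp measurable_fst))
  · exact hf.comp (g := Function.uncurry f) (f := fun q : (ℝ × Plane) × ℝ => (q.2, q.1.2))
      (by fun_prop)

theorem stronglyMeasurable_setIntegral_Ioo {f : ℝ → Plane → ℝ}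
    (hf : StronglyMeasurable (Function.uncurry f)) :
    StronglyMeasurable fun p : ℝ × Plane => ∫ s in Ioo 0 p.1, f s p.2 := by
  have h : ∀ p : ℝ × Plane, ∫ s in Ioo 0 p.1, f s p.2 =
      ∫ s, if 0 < s ∧ s < p.1 then f s p.2 else 0 := fun p => by
    rw [← integral_indicator measurableSet_Ioo]
    simp only [indicator, mem_Ioo]
  simp_rw [h]
  refine StronglyMeasurable.integral_prod_right' (f := fun q : (ℝ × Plane) × ℝ =>
    if 0 < q.2 ∧ q.2 < q.1.1 then f q.2 q.1.2 else 0)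
    (StronglyMeasurable.ite ?_ ?_ stronglyMeasurable_const)
  · exact (measurableSet_lt measurable_const measurable_snd).inter
      (measurableSet_lt measurable_snd (measurable_fst.comp measurable_fst))
  · exact hf.comp_measurable (f := Function.uncurry f)
      (g := fun q : (ℝ × Plane) × ℝ => (q.2, q.1.2)) (by fun_prop)

theorem stronglyMeasurable_transfer {m : ℕ} {V : ℝ → Plane → VelC m}
    (hV : StronglyMeasurable (Function.uncurry V)) :
    StronglyMeasurable (Function.uncurry fun t ξ => transfer (V t) ξ) := by
  have h1 : ∀ i : Fin (2 + m), StronglyMeasurable fun p : ℝ × Plane =>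
      nonlin (V p.1) i p.2 / ((‖p.2‖ ^ 2 : ℝ) : ℂ) * (starRingEnd ℂ) (V p.1 p.2 i) := fun i =>
    StronglyMeasurable.mul ((stronglyMeasurable_nonlin hV i).div
        (Measurable.stronglyMeasurable (by fun_prop)))
      (Complex.continuous_conj.comp_stronglyMeasurable (stronglyMeasurable_apply hV i))
  have h2 : StronglyMeasurable fun p : ℝ × Plane => ∑ i : Fin (2 + m),
      (nonlin (V p.1) i p.2 / ((‖p.2‖ ^ 2 : ℝ) : ℂ) * (starRingEnd ℂ) (V p.1 p.2 i)).re :=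
    Finset.stronglyMeasurable_fun_sum _ fun i _ =>
      Complex.continuous_re.comp_stronglyMeasurable (h1 i)
  exact h2

/-- The energy transfer is integrable in time and frequency. -/
theorem integrable_transfer {m : ℕ} {T B : ℝ} (hB : 0 ≤ B) {V : ℝ → Plane → VelC m}
    (hV : StronglyMeasurable (Function.uncurry V))
    (hVB : ∀ᵐ t ∂(volume.restrict (Ioo 0 T)), ∫⁻ ξ, ‖V t ξ‖ₑ ^ 2 ≤ ENNReal.ofReal (B ^ 2))
    (hY : ∀ᵐ t ∂(volume.restrict (Ioo 0 T)),
      ∫⁻ ξ : Plane, ENNReal.ofReal (‖ξ‖ ^ 2) * ‖V t ξ‖ₑ ^ 2 ≠ ⊤)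
    (hD : ∫⁻ t in Ioo 0 T, ∫⁻ ξ : Plane, ENNReal.ofReal (‖ξ‖ ^ 2) * ‖V t ξ‖ₑ ^ 2 ≠ ⊤) :
    Integrable (fun p : ℝ × Plane => transfer (V p.1) p.2)
      ((volume.restrict (Ioo 0 T)).prod volume) := by
  have hm : StronglyMeasurable fun p : ℝ × Plane => transfer (V p.1) p.2 :=
    stronglyMeasurable_transfer hV
  have hVm : Measurable (Function.uncurry fun t ξ => ‖V t ξ‖ₑ) := hV.measurable.enorm
  refine ⟨hm.aestronglyMeasurable, ?_⟩
  rw [hasFiniteIntegral_iff_enorm, lintegral_prod _ hm.measurable.enorm.aemeasurable]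
  have hle : ∀ᵐ t ∂(volume.restrict (Ioo 0 T)), ∫⁻ ξ, ‖transfer (V t) ξ‖ₑ ≤
      ENNReal.ofReal (8 * Real.pi * (2 + m) ^ 2) * (ENNReal.ofReal B *
        (ENNReal.ofReal (1 + 2 * Real.pi) *
          (1 + ∫⁻ ξ : Plane, ENNReal.ofReal (‖ξ‖ ^ 2) * ‖V t ξ‖ₑ ^ 2))) := by
    filter_upwards [hVB, hY] with t h1 h2
    refine le_trans (lintegral_mono_ae (ae_norm_pos.mono fun ξ hξ => enorm_transfer_le (V t) hξ)) ?_
    rw [lintegral_const_mul' _ _ ENNReal.ofReal_ne_top]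
    gcongr
    exact lintegral_mul_selfConv_le hVm.of_uncurry_left hB h1 h2
  refine (lintegral_mono_ae hle).trans_lt ?_
  rw [lintegral_const_mul' _ _ ENNReal.ofReal_ne_top, lintegral_const_mul' _ _ ENNReal.ofReal_ne_top,
    lintegral_const_mul' _ _ ENNReal.ofReal_ne_top, lintegral_add_left measurable_const,
    lintegral_const]
  refine ENNReal.mul_lt_top ENNReal.ofReal_lt_top (ENNReal.mul_lt_top ENNReal.ofReal_lt_top
    (ENNReal.mul_lt_top ENNReal.ofReal_lt_top (ENNReal.add_lt_top.2 ⟨?_, lt_top_iff_ne_top.2 hD⟩)))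
  simp

/-- The energy identity for a single frequency. -/
theorem ae_ae_energy_identity {m : ℕ} {T : ℝ} (hT : 0 ≤ T) {F₀ : Plane → VelC m}
    {V : ℝ → Plane → VelC m}
    (heq : FrequencyEquation T F₀ V V) :
    ∀ᵐ ξ : Plane, ∀ᵐ t ∂(volume.restrict (Ioo 0 T)),
      ‖V t ξ‖ₑ ^ 2 + ∫⁻ s in Ioo 0 t, ENNReal.ofReal (8 * Real.pi ^ 2 * ‖ξ‖ ^ 2) * ‖V s ξ‖ₑ ^ 2 =
        ENNReal.ofReal (‖F₀ ξ‖ ^ 2 + 2 * ∫ s in Ioo 0 t, transfer (V s) ξ) ∧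
      0 ≤ ‖F₀ ξ‖ ^ 2 + 2 * ∫ s in Ioo 0 t, transfer (V s) ξ := by
  filter_upwards [heq] with ξ h
  have hE := fun i => ae_norm_sq_add_eq_of_ae_eq_add_integral hT (h i).2.1 (h i).1 (h i).2.2
  have hn : ∀ x : VelC m, ‖x‖ ^ 2 = ∑ i, ‖x i‖ ^ 2 := EuclideanSpace.norm_sq_eq
  have hi : IntegrableOn (fun s => ‖V s ξ‖ ^ 2) (Ioo 0 T) := by
    simp only [hn]
    exact integrable_finsetSum _ fun i _ => (hE i).1
  filter_upwards [ae_all_iff.2 fun i => (hE i).2.2, ae_restrict_mem measurableSet_Ioo] with t ht htT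
  have hsub : Ioo 0 t ⊆ Ioo 0 T := Ioo_subset_Ioo_right htT.2.le
  have h1 : ‖V t ξ‖ ^ 2 + 2 * (4 * Real.pi ^ 2 * ‖ξ‖ ^ 2) * (∫ s in Ioo 0 t, ‖V s ξ‖ ^ 2) =
      ‖F₀ ξ‖ ^ 2 + 2 * ∫ s in Ioo 0 t, transfer (V s) ξ := by
    simp only [hn, transfer]
    rw [integral_finsetSum _ fun i _ => (hE i).1.mono_set hsub,
      integral_finsetSum _ fun i _ => (hE i).2.1.mono_set hsub, Finset.mul_sum, Finset.mul_sum,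
      ← Finset.sum_add_distrib, ← Finset.sum_add_distrib]
    exact Finset.sum_congr rfl fun i _ => ht i
  have h2 : ∀ x : VelC m, ‖x‖ₑ ^ 2 = ENNReal.ofReal (‖x‖ ^ 2) := fun x => by
    rw [ENNReal.ofReal_pow (norm_nonneg _), ofReal_norm]
  rw [← h1]
  refine ⟨?_, by positivity⟩
  simp only [h2]
  rw [lintegral_const_mul' _ _ ENNReal.ofReal_ne_top,
    ← ofReal_integral_eq_lintegral_ofReal (hi.mono_set hsub) (.of_forall fun s => by positivity),
    ← ENNReal.ofReal_mul (by positivity), ← ENNReal.ofReal_add (by positivity) (by positivity)]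
  congr 2
  ring

/-- The energy equality, on the Fourier side. -/
theorem ae_energy_eq {m : ℕ} {T B : ℝ} (hT : 0 ≤ T) (hB : 0 ≤ B) {F₀ : Plane → VelC m}
    (hF₀ : StronglyMeasurable F₀) (hF₀' : ∫⁻ ξ, ‖F₀ ξ‖ₑ ^ 2 ≠ ⊤) {V : ℝ → Plane → VelC m}
    (hV : StronglyMeasurable (Function.uncurry V))
    (hVB : ∀ᵐ t ∂(volume.restrict (Ioo 0 T)), ∫⁻ ξ, ‖V t ξ‖ₑ ^ 2 ≤ ENNReal.ofReal (B ^ 2))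
    (hY : ∀ᵐ t ∂(volume.restrict (Ioo 0 T)),
      ∫⁻ ξ : Plane, ENNReal.ofReal (‖ξ‖ ^ 2) * ‖V t ξ‖ₑ ^ 2 ≠ ⊤)
    (hD : ∫⁻ t in Ioo 0 T, ∫⁻ ξ : Plane, ENNReal.ofReal (‖ξ‖ ^ 2) * ‖V t ξ‖ₑ ^ 2 ≠ ⊤)
    (hherm : ∀ᵐ t ∂(volume.restrict (Ioo 0 T)), ∀ᵐ ξ, ∀ k,
      V t (-ξ) k = (starRingEnd ℂ) (V t ξ k))
    (hdiv : ∀ᵐ t ∂(volume.restrict (Ioo 0 T)), ∀ᵐ ξ : Plane,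
      ∑ j : Fin 2, (ξ j : ℂ) * V t ξ (Fin.castAdd m j) = 0)
    (heq : FrequencyEquation T F₀ V V) :
    ∀ᵐ t ∂(volume.restrict (Ioo 0 T)), (∫⁻ ξ, ‖V t ξ‖ₑ ^ 2) +
      ∫⁻ s in Ioo 0 t, ∫⁻ ξ : Plane, ENNReal.ofReal (8 * Real.pi ^ 2 * ‖ξ‖ ^ 2) * ‖V s ξ‖ₑ ^ 2 =
      ∫⁻ ξ, ‖F₀ ξ‖ₑ ^ 2 := by
  have hVm : Measurable (Function.uncurry fun t ξ => ‖V t ξ‖ₑ) := hV.measurable.enorm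
  have hVm2 : Measurable fun p : ℝ × Plane => ‖V p.1 p.2‖ₑ := hVm
  have hVs : ∀ t, Measurable fun ξ => ‖V t ξ‖ₑ := fun t => hVm.of_uncurry_left
  have hdm : Measurable (Function.uncurry fun (s : ℝ) (ξ : Plane) =>
      ENNReal.ofReal (8 * Real.pi ^ 2 * ‖ξ‖ ^ 2) * ‖V s ξ‖ₑ ^ 2) :=
    Measurable.mul (by fun_prop) (hVm.pow_const 2)
  have hLm := measurable_setLIntegral_Ioo hdm
  have hGm := stronglyMeasurable_setIntegral_Ioo (stronglyMeasurable_transfer hV)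
  have hG := integrable_transfer hB hV hVB hY hD
  have hF₀i : Integrable fun ξ => ‖F₀ ξ‖ ^ 2 := by
    refine ⟨(hF₀.norm.pow 2).aestronglyMeasurable, ?_⟩
    rw [hasFiniteIntegral_iff_enorm]
    refine lt_of_eq_of_lt (lintegral_congr fun ξ => ?_) (lt_top_iff_ne_top.2 hF₀')
    rw [enorm_pow, enorm_norm]
  have hswap := ae_ae_energy_identity hT heq
  rw [← Measure.ae_ae_comm] at hswap
  swap
  · have hRm : Measurable fun p : ℝ × Plane =>
        ‖F₀ p.2‖ ^ 2 + 2 * ∫ s in Ioo 0 p.1, transfer (V s) p.2 :=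
      ((hF₀.norm.measurable.comp measurable_snd).pow_const 2).add (hGm.measurable.const_mul 2)
    exact (measurableSet_eq_fun ((hVm2.pow_const 2).add hLm) hRm.ennreal_ofReal).inter
      (measurableSet_le measurable_const hRm)
  have hzero : ∀ᵐ s ∂(volume.restrict (Ioo 0 T)), ∫ ξ, transfer (V s) ξ = 0 := by
    filter_upwards [hVB, hY, hherm, hdiv] with s h1 h2 h3 h4
    refine integral_transfer_eq_zero (hV.comp_measurable measurable_prodMk_left) h3 h4 ?_
    refine ne_top_of_le_ne_top ?_ (lintegral_mul_selfConv_le (hVs s) hB h1 h2)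
    finiteness
  filter_upwards [hswap, ae_restrict_mem measurableSet_Ioo] with t ht htT
  have hsub : Ioo 0 t ⊆ Ioo 0 T := Ioo_subset_Ioo_right htT.2.le
  have hGt : Integrable (fun p : ℝ × Plane => transfer (V p.1) p.2)
      ((volume.restrict (Ioo 0 t)).prod volume) :=
    hG.mono_measure (Measure.prod_mono (Measure.restrict_mono hsub le_rfl) le_rfl)
  have hGi : ∫ ξ, ∫ s in Ioo 0 t, transfer (V s) ξ = 0 := by
    rw [← integral_integral_swap (f := fun s ξ => transfer (V s) ξ) hGt]
    exact integral_eq_zero_of_ae (ae_restrict_of_ae_restrict_of_subset hsub hzero)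
  calc (∫⁻ ξ, ‖V t ξ‖ₑ ^ 2) + ∫⁻ s in Ioo 0 t, ∫⁻ ξ : Plane,
        ENNReal.ofReal (8 * Real.pi ^ 2 * ‖ξ‖ ^ 2) * ‖V s ξ‖ₑ ^ 2
      = ∫⁻ ξ : Plane, (‖V t ξ‖ₑ ^ 2 + ∫⁻ s in Ioo 0 t,
          ENNReal.ofReal (8 * Real.pi ^ 2 * ‖ξ‖ ^ 2) * ‖V s ξ‖ₑ ^ 2) := by
        rw [lintegral_add_left ((hVs t).pow_const 2), lintegral_lintegral_swap hdm.aemeasurable]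
    _ = ∫⁻ ξ, ENNReal.ofReal (‖F₀ ξ‖ ^ 2 + 2 * ∫ s in Ioo 0 t, transfer (V s) ξ) :=
        lintegral_congr_ae (ht.mono fun ξ hξ => hξ.1)
    _ = ENNReal.ofReal (∫ ξ, ‖F₀ ξ‖ ^ 2) := by
        have hj : Integrable fun ξ => 2 * ∫ s in Ioo 0 t, transfer (V s) ξ :=
          hGt.integral_prod_right.const_mul 2
        have hRi : Integrable fun ξ => ‖F₀ ξ‖ ^ 2 + 2 * ∫ s in Ioo 0 t, transfer (V s) ξ :=
          hF₀i.add hj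
        rw [← ofReal_integral_eq_lintegral_ofReal hRi (ht.mono fun ξ hξ => hξ.2),
          integral_add hF₀i hj, integral_const_mul, hGi, mul_zero, add_zero]
    _ = _ := by
        rw [ofReal_integral_eq_lintegral_ofReal hF₀i (.of_forall fun ξ => by positivity)]
        refine lintegral_congr fun ξ => ?_
        rw [ENNReal.ofReal_pow (norm_nonneg _), ofReal_norm]

/-! ### From the Fourier side back to the solution -/

/-- The bound for the supremum follows from the one for the Fourier transform. -/
theorem lintegral_eLpNorm_sq_le_of_lintegral_sq_le {m : ℕ} {T : ℝ} {c : ℝ≥0∞}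
    {v : ℝ → L2Vel m} {V : ℝ → Plane → VelC m}
    (hVv : ∀ᵐ t ∂(volume.restrict (Ioo 0 T)), V t =ᵐ[volume] fourierL2 (v t))
    (h : ∫⁻ t in Ioo 0 T, (∫⁻ ξ, ‖V t ξ‖ₑ) ^ 2 ≤ c) :
    ∫⁻ t in Ioo 0 T, eLpNorm (fourierL2 (v t)) 1 volume ^ 2 ≤ c ∧
      ∫⁻ t in Ioo 0 T, eLpNorm (v t) ⊤ volume ^ 2 ≤ c := by
  have h1 : ∫⁻ t in Ioo 0 T, eLpNorm (fourierL2 (v t)) 1 volume ^ 2 ≤ c := by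
    refine le_of_eq_of_le (lintegral_congr_ae ?_) h
    filter_upwards [hVv] with t ht
    rw [← eLpNorm_congr_ae ht, eLpNorm_one_eq_lintegral_enorm]
  refine ⟨h1, le_trans (lintegral_mono fun t => ?_) h1⟩
  gcongr
  exact eLpNorm_top_le_eLpNorm_fourierL2 (v t)

/-- The dissipation on the Fourier side, with the factor `4 π² ≥ 1` dropped. -/
theorem lintegral_norm_sq_mul_enorm_sq_le {m : ℕ} {f : L2Vel m} {g : Fin 2 → L2Vel m}
    (h : IsWeakGradient f g) {F : Plane → VelC m} (hF : F =ᵐ[volume] fourierL2 f) :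
    ∫⁻ ξ : Plane, ENNReal.ofReal (‖ξ‖ ^ 2) * ‖F ξ‖ₑ ^ 2 ≤ ENNReal.ofReal (∑ j, ‖g j‖ ^ 2) := by
  rw [← lintegral_norm_sq_mul_enorm_fourierL2_sq h]
  refine lintegral_mono_ae (hF.mono fun ξ hξ => ?_)
  rw [hξ]
  gcongr
  have : (1 : ℝ) ≤ 4 * Real.pi ^ 2 := by nlinarith [Real.pi_gt_three]
  nlinarith [sq_nonneg ‖ξ‖]

theorem InEnergyClass.integrableOn_sum_norm_sq {m : ℕ} {T : ℝ} {u : ℝ → L2Vel m}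
    {Du : ℝ → Fin 2 → L2Vel m} (h : InEnergyClass T u Du) :
    IntegrableOn (fun t => ∑ j, ‖Du t j‖ ^ 2) (Ioo 0 T) :=
  integrable_finsetSum _ fun j _ =>
    (memLp_two_iff_integrable_sq_norm (h.memLp_grad j).1).1 (h.memLp_grad j)

theorem InEnergyClass.lintegral_dissipation_le {m : ℕ} {T t : ℝ} {u : ℝ → L2Vel m}
    {Du : ℝ → Fin 2 → L2Vel m} (h : InEnergyClass T u Du) {U : ℝ → Plane → VelC m}
    (hUu : ∀ᵐ t ∂(volume.restrict (Ioo 0 T)), U t =ᵐ[volume] fourierL2 (u t)) (ht : t ≤ T) :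
    ∫⁻ s in Ioo 0 t, ∫⁻ ξ : Plane, ENNReal.ofReal (‖ξ‖ ^ 2) * ‖U s ξ‖ₑ ^ 2 ≤
      ENNReal.ofReal (∫ s in Ioo 0 t, ∑ j, ‖Du s j‖ ^ 2) := by
  have hsub : Ioo 0 t ⊆ Ioo 0 T := Ioo_subset_Ioo_right ht
  rw [ofReal_integral_eq_lintegral_ofReal (h.integrableOn_sum_norm_sq.mono_set hsub)
    (.of_forall fun s => by positivity)]
  refine lintegral_mono_ae (ae_restrict_of_ae_restrict_of_subset hsub ?_)
  filter_upwards [hUu, h.isWeakGradient] with s h1 h2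
    using lintegral_norm_sq_mul_enorm_sq_le h2 h1

theorem stronglyMeasurable_fourierL2 {m : ℕ} (f : L2Vel m) : StronglyMeasurable (fourierL2 f) :=
  Lp.stronglyMeasurable _

/-- The estimate for the linear problem with transport term `(u · ∇) u`. -/
theorem IsWeakSolution.lintegral_eLpNorm_sq_le {m : ℕ} {T M : ℝ} {u₀ : L2Vel m}
    {u v : ℝ → L2Vel m} {Du : ℝ → Fin 2 → L2Vel m} (hT : 0 < T) (h0 : IsDivFree u₀)
    (hu : InEnergyClass T u Du)
    (hM : ∀ᵐ t ∂(volume.restrict (Ioo 0 T)),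
      ‖u t‖ ^ 2 + ∫ s in Ioo 0 t, ∑ j, ‖Du s j‖ ^ 2 ≤ M ^ 2)
    (hv : IsWeakSolution T u₀ u v) :
    ∫⁻ t in Ioo 0 T, eLpNorm (fourierL2 (v t)) 1 volume ^ 2 ≤
        ENNReal.ofReal (estimateConst m * (‖u₀‖ ^ 2 + M ^ 4)) ∧
      ∫⁻ t in Ioo 0 T, eLpNorm (v t) ⊤ volume ^ 2 ≤
        ENNReal.ofReal (estimateConst m * (‖u₀‖ ^ 2 + M ^ 4)) := by
  obtain ⟨U, hU, hUu⟩ := exists_stronglyMeasurable_fourierL2 hu.memLp_top.1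
  obtain ⟨V, hV, hVv⟩ := exists_stronglyMeasurable_fourierL2 hv.memLp_top.1
  have hnn : ∀ t, 0 ≤ ∫ s in Ioo 0 t, ∑ j, ‖Du s j‖ ^ 2 := fun t =>
    integral_nonneg fun s => by positivity
  refine lintegral_eLpNorm_sq_le_of_lintegral_sq_le hVv
    (lintegral_sq_lintegral_enorm_le hT.le (stronglyMeasurable_fourierL2 u₀).measurable
      (lintegral_enorm_fourierL2_sq u₀).le hU hV ?_ ?_
      (hv.ae_frequency_equation hT.le h0 hu.memLp_top hU hV hUu hVv))
  · filter_upwards [hM, hUu] with t h1 h2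
    refine (lintegral_enorm_sq_le_of_norm_le h2 le_rfl).trans (ENNReal.ofReal_le_ofReal ?_)
    linarith [hnn t]
  · refine setLIntegral_Ioo_le_of_ae hT ?_
    filter_upwards [hM, ae_restrict_mem measurableSet_Ioo] with t h1 ht
    refine (hu.lintegral_dissipation_le hUu ht.2.le).trans (ENNReal.ofReal_le_ofReal ?_)
    linarith [sq_nonneg ‖u t‖]

/-- The estimate for the Navier-Stokes equations. In two variables every weak solution of finite
energy obeys the energy equality, so that no bound on `v` has to be assumed. -/
theorem IsWeakSolution.lintegral_eLpNorm_sq_le_of_self {m : ℕ} {T : ℝ} {u₀ : L2Vel m}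
    {v : ℝ → L2Vel m} {Dv : ℝ → Fin 2 → L2Vel m} (hT : 0 < T) (h0 : IsDivFree u₀)
    (hE : InEnergyClass T v Dv) (hv : IsWeakSolution T u₀ v v) :
    ∫⁻ t in Ioo 0 T, eLpNorm (fourierL2 (v t)) 1 volume ^ 2 ≤
        ENNReal.ofReal (estimateConst m * (‖u₀‖ ^ 2 + ‖u₀‖ ^ 4)) ∧
      ∫⁻ t in Ioo 0 T, eLpNorm (v t) ⊤ volume ^ 2 ≤
        ENNReal.ofReal (estimateConst m * (‖u₀‖ ^ 2 + ‖u₀‖ ^ 4)) := by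
  obtain ⟨V, hV, hVv⟩ := exists_stronglyMeasurable_fourierL2 hv.memLp_top.1
  obtain ⟨B, hB⟩ := exists_norm_le_of_memLp_top hv.memLp_top
  have heq := hv.ae_frequency_equation hT.le h0 hv.memLp_top hV hV hVv hVv
  have hA := lintegral_enorm_fourierL2_sq u₀
  have hVB : ∀ᵐ t ∂(volume.restrict (Ioo 0 T)),
      ∫⁻ ξ, ‖V t ξ‖ₑ ^ 2 ≤ ENNReal.ofReal (|B| ^ 2) := by
    filter_upwards [hB, hVv] with t h1 h2
      using lintegral_enorm_sq_le_of_norm_le h2 (h1.trans (le_abs_self B))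
  have hY : ∀ᵐ t ∂(volume.restrict (Ioo 0 T)),
      ∫⁻ ξ : Plane, ENNReal.ofReal (‖ξ‖ ^ 2) * ‖V t ξ‖ₑ ^ 2 ≠ ⊤ := by
    filter_upwards [hVv, hE.isWeakGradient] with t h1 h2
      using ne_top_of_le_ne_top ENNReal.ofReal_ne_top (lintegral_norm_sq_mul_enorm_sq_le h2 h1)
  have hherm : ∀ᵐ t ∂(volume.restrict (Ioo 0 T)), ∀ᵐ ξ, ∀ k,
      V t (-ξ) k = (starRingEnd ℂ) (V t ξ k) := by
    filter_upwards [hVv] with t ht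
    have hneg := (Measure.measurePreserving_neg (volume : Measure Plane)).quasiMeasurePreserving.ae
      ht
    filter_upwards [ht, hneg, ae_all_iff.2 fun k => fourierL2_neg_ae (v t) k] with ξ h1 h2 h3 k
    rw [h1, h2, h3]
  have hdiv : ∀ᵐ t ∂(volume.restrict (Ioo 0 T)), ∀ᵐ ξ : Plane,
      ∑ j : Fin 2, (ξ j : ℂ) * V t ξ (Fin.castAdd m j) = 0 := by
    filter_upwards [hVv, hv.isDivFree] with t h1 h2
    filter_upwards [h1, sum_coord_mul_fourierL2_ae h2] with ξ h3 h4
    rw [h3, h4]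
  have henergy := ae_energy_eq hT.le (abs_nonneg B) (stronglyMeasurable_fourierL2 u₀)
    (hA.trans_ne ENNReal.ofReal_ne_top) hV hVB hY
    (ne_top_of_le_ne_top ENNReal.ofReal_ne_top (hE.lintegral_dissipation_le hVv le_rfl))
    hherm hdiv heq
  refine lintegral_eLpNorm_sq_le_of_lintegral_sq_le hVv
    (lintegral_sq_lintegral_enorm_le hT.le (stronglyMeasurable_fourierL2 u₀).measurable hA.le
      hV hV ?_ ?_ heq)
  · filter_upwards [henergy] with t ht
    rw [← hA, ← ht]
    exact le_self_add
  · refine setLIntegral_Ioo_le_of_ae hT ?_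
    filter_upwards [henergy] with t ht
    rw [← hA, ← ht]
    refine le_trans (lintegral_mono fun s => lintegral_mono fun ξ => ?_) le_add_self
    gcongr
    have : (1 : ℝ) ≤ 8 * Real.pi ^ 2 := by nlinarith [Real.pi_gt_three]
    nlinarith [sq_nonneg ‖ξ‖]

end PlanarFlow

theorem mainTheorem6 (m : ℕ) :
    (∃ C : ℝ → ℝ → ℝ, ∀ (T M : ℝ) (u₀ : PlanarFlow.L2Vel m) (u v : ℝ → PlanarFlow.L2Vel m)
      (Du : ℝ → Fin 2 → PlanarFlow.L2Vel m),
      0 < T → PlanarFlow.IsDivFree u₀ →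
      PlanarFlow.InEnergyClass T u Du →
      (∀ᵐ t ∂(volume.restrict (Ioo 0 T)), PlanarFlow.IsDivFree (u t)) →
      (∀ᵐ t ∂(volume.restrict (Ioo 0 T)),
        ‖u t‖ ^ 2 + ∫ s in Ioo 0 t, ∑ j, ‖Du s j‖ ^ 2 ≤ M ^ 2) →
      PlanarFlow.IsWeakSolution T u₀ u v →
      ∫⁻ t in Ioo 0 T, eLpNorm (PlanarFlow.fourierL2 (v t)) 1 volume ^ 2
          ≤ ENNReal.ofReal (C ‖u₀‖ M) ∧
        ∫⁻ t in Ioo 0 T, eLpNorm (v t) ∞ volume ^ 2 ≤ ENNReal.ofReal (C ‖u₀‖ M)) ∧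
    (∃ C : ℝ → ℝ, ∀ (T : ℝ) (u₀ : PlanarFlow.L2Vel m) (v : ℝ → PlanarFlow.L2Vel m)
      (Dv : ℝ → Fin 2 → PlanarFlow.L2Vel m),
      0 < T → PlanarFlow.IsDivFree u₀ →
      PlanarFlow.InEnergyClass T v Dv →
      PlanarFlow.IsWeakSolution T u₀ v v →
      ∫⁻ t in Ioo 0 T, eLpNorm (PlanarFlow.fourierL2 (v t)) 1 volume ^ 2
          ≤ ENNReal.ofReal (C ‖u₀‖) ∧
        ∫⁻ t in Ioo 0 T, eLpNorm (v t) ∞ volume ^ 2 ≤ ENNReal.ofReal (C ‖u₀‖)) := by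

  refine ⟨⟨fun A M => PlanarFlow.estimateConst m * (A ^ 2 + M ^ 4), ?_⟩,
    ⟨fun A => PlanarFlow.estimateConst m * (A ^ 2 + A ^ 4), ?_⟩⟩
  · intro T M u₀ u v Du hT h0 hu _ hM hv
    exact hv.lintegral_eLpNorm_sq_le hT h0 hu hM
  · intro T u₀ v Dv hT h0 hE hv
    exact hv.lintegral_eLpNorm_sq_le_of_self hT h0 hE
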